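/- **Setting.** There are $k\ge 2$ arms, an objective measure (index $0$) and $m\ge 0$ constraint measures with thresholds $\gamma_1,\dots,\gamma_m$. Pulling arm $i$ in round $t=1,2,\dots$ yields a reward vector $(X_{t,i0},\dots,X_{t,im})$; the $X_{t,ij}\sim N(\mu_{ij},\sigma_{ij}^2)$ are independent over rounds, arms and measures, with known $\sigma_{ij}^2>0$. Arm $i$ is feasible if $\mu_{ij}\le\gamma_j$ for all $1\le j\le m$. Assume that there is a unique best feasible arm (the feasible arm with the largest $\mu_{i0}$), say arm $1$, and that $\mu_{ij}\ne\gamma_j$ for all $i$ and all $j\geq 1$. An algorithm chooses the arm $I_t$ of round $t$ from the past observations and possibly additional randomness, without anticipating the rewards of round $t$. Let $N_{t,i}$ be the number of samples of arm $i$ before round $t$. Once every arm has been sampled, the posterior under a flat prior is $\Pi_t=\bigotimes_{i,j}N(\mu_{t,ij},\sigma_{ij}^2/N_{t,i})$, where $\mu_{t,ij}$ is the average of the samples of measure $j$ of arm $i$ before round $t$, and $P_{t,1}$ is the $\Pi_t$-probability that $\theta_{1j}\le\gamma_j$ for all $1\le j\le m$ and that no arm $i\neq 1$ satisfies both $\theta_{i0}>\theta_{10}$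 and $\theta_{ij}\le\gamma_j$ for all $1\le j\le m$. **BFAI-TS** with parameter $\beta\in(0,1)$ first takes $n_0\ge1$ samples of each arm. Afterwards, in round $t$, a *draw* samples $\theta\sim\Pi_t$ and returns the arm with the largest $\theta_{i0}$ among the arms that are feasible under $\theta$, or a uniformly chosen arm if none is. The algorithm makes a draw $I^{(1)}_t$ and pulls it with probability $\beta$; otherwise it repeats independent draws until one of them differs from $I_t^{(1)}$, and pulls that arm. **Rates.** For $i\ne1$ and $a,b>0$ let $$r_i(b,a)=\frac{(\mu_{i0}-\mu_{10})^2}{2(\sigma_{i0}^2/a+\sigma_{10}^2/b)}\mathbf 1\{i\text{ feasible or }\mu_{i0}<\mu_{10}\}+a\sum_{j\ge1:\,\mu_{ij}>\gamma_j}\frac{(\mu_{ij}-\gamma_j)^2}{2\sigma_{ij}^2}.$$ For $\beta\in(0,1)$ let $(\alpha_i^\beta)_{i\neq1}$ be the vector with $\alpha_i^\beta>0$, $\sum_{i\ne1}\alpha_i^\beta=1-\beta$ and $r_i(\beta,\alpha_i^\beta)=r_{i'}(\beta,\alpha_{i'}^\beta)$ for all $i,i'\ne1$, and put $$\Gamma_\beta=\min\Big(\min_{i\ne1}r_i(\beta,\alpha_i^\beta),\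 \min_{1\le j\le m}\beta\frac{(\mu_{1j}-\gamma_j)^2}{2\sigma_{1j}^2}\Big),$$ where the second minimum is omitted if $m=0$. Let $\beta^*\in(0,1)$ be a maximizer of $\beta\mapsto\Gamma_\beta$. **Theorem 2.** For every $\beta\in(0,1)$ the vector $(\alpha_i^\beta)_{i\ne1}$ exists and is unique, and a maximizer $\beta^*$ exists. Moreover: 1. For any algorithm, almost surely, if every arm is sampled at least once and $N_{n,1}/n\to\beta$ for some $\beta\in(0,1)$, then $\limsup_{n\to\infty}-\frac1n\log(1-P_{n,1})\le\Gamma_\beta$. For every $\beta\in(0,1)$, BFAI-TS with parameter $\beta$ satisfies $\lim_{n\to\infty}-\frac1n\log(1-P_{n,1})=\Gamma_\beta$ almost surely. 2. For any algorithm, almost surely, if every arm is sampled at least once, then $\limsup_{n\to\infty}-\frac1n\log(1-P_{n,1})\le\Gamma_{\beta^*}$. BFAI-TS with parameter $\beta^*$ satisfies $\lim_{n\to\infty}-\frac1n\log(1-P_{n,1})=\Gamma_{\beta^*}$ almost surely. -/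

import Mathlib

open MeasureTheory ProbabilityTheory Filter Topology Set
open scoped NNReal ENNReal

namespace BFAI

noncomputable section

/-- A best-feasible-arm instance with `k` arms, one objective measure (index `0`) and `m` constraint
measures (indices `1, …, m`, written `j.succ` with `j : Fin m`): the true means `μ_{ij}`, the known
positive variances `σ_{ij}²` and the constraint thresholds `γ_j`. -/
structure Problem (k m : ℕ) where
  mean : Fin k → Fin (m + 1) → ℝ
  var : Fin k → Fin (m + 1) → ℝ≥0
  thr : Fin m → ℝ
  var_pos : ∀ i j, 0 < var i j

namespace Problem

variable {k m : ℕ} (ν : Problem k m)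

/-- Feasibility of arm `i` under the vector of means `θ`. -/
def FeasibleAt (θ : Fin k → Fin (m + 1) → ℝ) (i : Fin k) : Prop :=
  ∀ j : Fin m, θ i j.succ ≤ ν.thr j

/-- Arm `s` is the unique best feasible arm. -/
def IsUniqueBest (s : Fin k) : Prop :=
  ν.FeasibleAt ν.mean s ∧ ∀ i, i ≠ s → ν.FeasibleAt ν.mean i → ν.mean i 0 < ν.mean s 0

/-- No arm lies on the boundary of a constraint. -/
def NoBoundary : Prop := ∀ (i : Fin k) (j : Fin m), ν.mean i j.succ ≠ ν.thr j

/-! ### The optimal rates -/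

/-- Feasible but suboptimal arms. -/
def Fw (s : Fin k) : Set (Fin k) := {i | ν.FeasibleAt ν.mean i ∧ i ≠ s}

/-- Infeasible arms whose objective mean is no worse than that of the best feasible arm. -/
def Ib (s : Fin k) : Set (Fin k) :=
  {i | ν.mean s 0 ≤ ν.mean i 0 ∧ ∃ j : Fin m, ν.thr j < ν.mean i j.succ}

/-- Infeasible arms whose objective mean is worse than that of the best feasible arm. -/
def Iw (s : Fin k) : Set (Fin k) :=
  {i | ν.mean i 0 < ν.mean s 0 ∧ ∃ j : Fin m, ν.thr j < ν.mean i j.succ}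

open Classical in
/-- The constraints satisfied by arm `i`. -/
def MF (i : Fin k) : Finset (Fin m) := {j | ν.mean i j.succ ≤ ν.thr j}

open Classical in
/-- The constraints violated by arm `i`. -/
def MI (i : Fin k) : Finset (Fin m) := {j | ν.thr j < ν.mean i j.succ}

open Classical in
/-- The exponent of false evaluation of arm `i ≠ s` when arm `s` has sampling rate `b > 0` and arm
`i` has sampling rate `a > 0`. -/
def armRate (s : Fin k) (b a : ℝ) (i : Fin k) : ℝ :=
  (if i ∈ ν.Fw s ∪ ν.Iw s then
      (ν.mean i 0 - ν.mean s 0) ^ 2 / (2 * ((ν.var i 0 : ℝ) / a + (ν.var s 0 : ℝ) / b))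
    else 0) +
  (if i ∈ ν.Ib s ∪ ν.Iw s then
      a * ∑ j ∈ ν.MI i, (ν.mean i j.succ - ν.thr j) ^ 2 / (2 * (ν.var i j.succ : ℝ))
    else 0)

/-- `α` is the vector of optimal sampling rates when the best feasible arm `s` gets the proportion
`β`: the other rates are positive, add up to `1 - β`, and balance the exponents of the arms
(the common factor `1 / 2` in all exponents is immaterial here). -/
def IsOptimalRates (s : Fin k) (β : ℝ) (α : Fin k → ℝ) : Prop :=
  α s = β ∧ (∀ i, i ≠ s → 0 < α i) ∧ ∑ i ∈ Finset.univ.erase s, α i = 1 - β ∧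
    ∀ i i', i ≠ s → i' ≠ s → ν.armRate s β (α i) i = ν.armRate s β (α i') i'

/-- The optimal sampling rates `α^β`. -/
def optRates (s : Fin k) (β : ℝ) : Fin k → ℝ :=
  Classical.epsilon (ν.IsOptimalRates s β)

/-- `Γ_β`: the minimum of the exponents of the arms `i ≠ s` at the optimal sampling rates and of the
exponents `β (μ_{sj} - γ_j)² / (2 σ_{sj}²)` of the constraints satisfied by `s`. (A minimum of a
finite family that is non-empty when there are at least two arms.) -/
def Gam (s : Fin k) (β : ℝ) : ℝ :=
  sInf ({r | ∃ i, i ≠ s ∧ r = ν.armRate s β (ν.optRates s β i) i} ∪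
    {r | ∃ j ∈ ν.MF s, r = β * ((ν.mean s j.succ - ν.thr j) ^ 2 / (2 * (ν.var s j.succ : ℝ)))})

/-- `b` is an optimal proportion `β*`: it maximizes `β ↦ Γ_β` over `(0, 1)`. -/
def IsOptimalBeta (s : Fin k) (b : ℝ) : Prop :=
  b ∈ Ioo (0 : ℝ) 1 ∧ ∀ β ∈ Ioo (0 : ℝ) 1, ν.Gam s β ≤ ν.Gam s b

/-! ### Posterior quantities

A law `Q` on vectors of means stands for the current posterior. -/

/-- The probability under `Q` that arm `i` is the best feasible arm. -/
def bestProb (Q : Measure (Fin k → Fin (m + 1) → ℝ)) (i : Fin k) : ℝ :=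
  Q.real {θ | (∀ i', i' ≠ i → ¬ (θ i 0 < θ i' 0 ∧ ν.FeasibleAt θ i')) ∧ ν.FeasibleAt θ i}

open Classical in
/-- The arms that are feasible under `θ`. -/
def feasibleSet (θ : Fin k → Fin (m + 1) → ℝ) : Finset (Fin k) := {i | ν.FeasibleAt θ i}

open Classical in
/-- The arms that maximize the objective among the arms feasible under `θ`. -/
def argmaxSet (θ : Fin k → Fin (m + 1) → ℝ) : Finset (Fin k) :=
  {i ∈ ν.feasibleSet θ | ∀ i' ∈ ν.feasibleSet θ, θ i' 0 ≤ θ i 0}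

open Classical in
/-- The probability of selecting arm `i` given the posterior sample `θ`: the best feasible arm under
`θ` is selected if some arm is feasible (ties, which have posterior probability zero, are broken
uniformly), and otherwise an arm is chosen uniformly. -/
def selectProb (θ : Fin k → Fin (m + 1) → ℝ) (i : Fin k) : ℝ :=
  if (ν.feasibleSet θ).Nonempty then
    (if i ∈ ν.argmaxSet θ then 1 / ((ν.argmaxSet θ).card : ℝ) else 0)
  else 1 / (k : ℝ)

/-- The probability that one draw `θ ∼ Q`, followed by the selection above, returns arm `i`. -/
def candidateProb (Q : Measure (Fin k → Fin (m + 1) → ℝ)) (i : Fin k) : ℝ :=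
  ∫ θ, ν.selectProb θ i ∂Q

open Classical in
/-- The law of the second candidate given the first candidate `i₁`: the draw is repeated
independently until it returns an arm other than `i₁`, so that `i ≠ i₁` is obtained if, for some
`r`, the first `r` draws return `i₁` and the next one returns `i`. -/
def secondProb (Q : Measure (Fin k → Fin (m + 1) → ℝ)) (i₁ i : Fin k) : ℝ :=
  if i = i₁ then 0 else ∑' r : ℕ, ν.candidateProb Q i₁ ^ r * ν.candidateProb Q i

open Classical in
/-- The probability that a round of BFAI-TS with parameter `β` and current posterior `Q` pulls arm
`i`: a first candidate `i₁` is drawn; it is pulled with probability `β`, and the second candidate is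
pulled with probability `1 - β`. -/
def pullProb (β : ℝ) (Q : Measure (Fin k → Fin (m + 1) → ℝ)) (i : Fin k) : ℝ :=
  ∑ i₁, ν.candidateProb Q i₁ *
    (β * (if i = i₁ then 1 else 0) + (1 - β) * ν.secondProb Q i₁ i)

end Problem

/-! ### Sampling algorithms

Rounds are numbered `1, 2, …`. The reward table is `X t ω i j`, the reward of arm `i` and measure
`j` in round `t`; the arm pulled in round `t` is `I t ω`. -/

section Runs

variable {k m : ℕ} {Ω : Type*}

open Classical in
/-- `N_{t,i}`: the number of samples of arm `i` before round `t`. -/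
def count (I : ℕ → Ω → Fin k) (t : ℕ) (i : Fin k) (ω : Ω) : ℕ :=
  ∑ l ∈ Finset.Ico 1 t, if I l ω = i then 1 else 0

open Classical in
/-- `μ_{t,ij}`: the posterior mean before round `t` (the prior is flat). -/
def postMean (X : ℕ → Ω → Fin k → Fin (m + 1) → ℝ) (I : ℕ → Ω → Fin k) (t : ℕ) (i : Fin k)
    (j : Fin (m + 1)) (ω : Ω) : ℝ :=
  (∑ l ∈ Finset.Ico 1 t, if I l ω = i then X l ω (I l ω) j else 0) / (count I t i ω : ℝ)

/-- `Π_t`: the posterior before round `t`, the product of the `N(μ_{t,ij}, σ_{ij}² / N_{t,i})`. It is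
meaningful only once each arm has been sampled, since the flat prior is improper. -/
def posterior (ν : Problem k m) (X : ℕ → Ω → Fin k → Fin (m + 1) → ℝ) (I : ℕ → Ω → Fin k) (t : ℕ)
    (ω : Ω) : Measure (Fin k → Fin (m + 1) → ℝ) :=
  Measure.pi fun i => Measure.pi fun j =>
    gaussianReal (postMean X I t i j ω) (ν.var i j / (count I t i ω : ℝ≥0))

/-- `-(1/n) log (1 - P_{n,s})`. -/
def empRate (ν : Problem k m) (X : ℕ → Ω → Fin k → Fin (m + 1) → ℝ) (I : ℕ → Ω → Fin k)
    (s : Fin k) (n : ℕ) (ω : Ω) : ℝ :=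
  -(1 / (n : ℝ)) * Real.log (1 - ν.bestProb (posterior ν X I n ω) s)

/-- The sigma algebra of what has been observed before round `t`: the arms pulled and their reward
vectors. -/
abbrev observed (X : ℕ → Ω → Fin k → Fin (m + 1) → ℝ) (I : ℕ → Ω → Fin k) (t : ℕ) :
    MeasurableSpace Ω :=
  ⨆ l ∈ Finset.Ico 1 t,
    MeasurableSpace.comap (fun ω => (I l ω, X l ω (I l ω))) inferInstance

/-- `I` is the sequence of pulls of a sampling algorithm on the instance `ν` with rewards `X`: the
rewards are independent over rounds, arms and measures, with law `N(μ_{ij}, σ_{ij}²)`, and the pull in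
round `t` does not anticipate: the rewards of round `t` are independent of the observations before
round `t` together with the choice in round `t`. The choice may depend on the observations and on
additional randomness in any way. -/
structure IsAlgorithmRun [MeasurableSpace Ω] (ν : Problem k m) (P : Measure Ω)
    (X : ℕ → Ω → Fin k → Fin (m + 1) → ℝ) (I : ℕ → Ω → Fin k) : Prop where
  measurable_reward : ∀ t, Measurable (X t)
  measurable_pull : ∀ t, Measurable (I t)
  reward_law : ∀ t, 1 ≤ t → ∀ i j,
    P.map (fun ω => X t ω i j) = gaussianReal (ν.mean i j) (ν.var i j)
  reward_indep : iIndepFun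
    (fun (p : ℕ × Fin k × Fin (m + 1)) (ω : Ω) => X (p.1 + 1) ω p.2.1 p.2.2) P
  nonanticipating : ∀ t, 1 ≤ t →
    Indep (MeasurableSpace.comap (X t) inferInstance)
      (observed X I t ⊔ MeasurableSpace.comap (I t) inferInstance) P

/-- The pulls `I` are those of BFAI-TS with parameter `β`, with `n₀` initial samples of each arm: the
first `k * n₀` rounds collect `n₀` samples of each arm, and in each later round the conditional law of
the pull given the observations is the one prescribed by the algorithm under the posterior. -/
structure IsBFAITS [MeasurableSpace Ω] (ν : Problem k m) (P : Measure Ω)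
    (X : ℕ → Ω → Fin k → Fin (m + 1) → ℝ) (I : ℕ → Ω → Fin k) (n₀ : ℕ) (β : ℝ) : Prop where
  init : ∀ᵐ ω ∂P, ∀ i, count I (k * n₀ + 1) i ω = n₀
  pull_law : ∀ t, k * n₀ < t → ∀ i : Fin k,
    P[({ω | I t ω = i}).indicator (fun _ => (1 : ℝ)) | observed X I t] =ᵐ[P]
      fun ω => ν.pullProb β (posterior ν X I t ω) i

end Runs

end

end BFAI

/-! The posterior is a product of Gaussians whose precisions are proportional to the sample sizes.
Each way in which arm `s` can fail to be the best feasible arm therefore has posterior probability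
`exp (-n E + o(n))`, where `E` is a quadratic cost at the proportions `N n i / n`. Arm `i` is
feasible and beats `s` at the cost `exponent`: the two objective means are moved to a common level
and the violated constraints of `i` are repaired. Arm `s` violates constraint `j` at the cost
`conExponent`. Upper bounds come from Chernoff's inequality with the optimal tilt
(`gaussPost_beat_le`, `gaussPost_violate_le`), lower bounds from the mass of a box
(`gaussPost_beat_ge`, `gaussPost_violate_ge`). Failure is a union of finitely many such events, so
its rate is the smallest cost.

The lower bounds hold along every path: an arm sampled finitely often may have a wrong sample mean,
but its proportion tends to zero. Costs are monotone in the proportions, and the proportions of the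
arms other than `s` cannot all exceed the balanced rates, so some cost is at most the balanced
level. This bounds the rate of every algorithm by `Γ_β`, or by the maximum of `Γ` if the proportion
of `s` is not prescribed (`eventually_pathRate_le_gam`, `eventually_pathRate_le_optimal`).

For attainment, every arm is sampled infinitely often under BFAI-TS (`tendsto_count`). The posterior
concentrates, the first candidate is `s` with probability tending to one, and `s` receives the
proportion `β`. If `c i` is the probability of drawing arm `i`, then after first candidate `s` the
second one is `l` with probability `c l / (1 - c s)`. Fix a level `ρ < Γ_β` and let `a i` be the
proportion at which arm `i` has cost `ρ`; these add up to less than `1 - β`. While some arm has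
fewer than `a i * n` samples, `1 - c s` is at least about `exp (-n ρ)`, whereas `c l` is
exponentially smaller for an arm with more than `(a l + ζ) * n` samples; by Borel–Cantelli such arms
are eventually not pulled (`eventually_pull_ne`). The slack in the sum of the `a i` then makes
deficient periods short (`eventually_le_count`), so all costs are eventually almost `Γ_β`.

Randomness enters through three almost sure facts: sample means converge for arms sampled infinitely
often, counts follow the sums of their conditional probabilities, and exponentially unlikely pulls
eventually stop. The rest is deterministic, for a `SamplePath` or a `TopTwoPath`. -/

namespace BFAI

noncomputable section

/-! ### The rate of comparison of two Gaussian means -/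

/-- The rate `(u / a + v / b)⁻¹`, extended by `0` to `a = 0` or `b = 0`. -/
def pairRate (u v a b : ℝ) : ℝ := a * b / (u * b + v * a)

section pairRate

variable {u v a b a' b' : ℝ}

lemma pairRate_nonneg (hu : 0 < u) (hv : 0 < v) (ha : 0 ≤ a) (hb : 0 ≤ b) :
    0 ≤ pairRate u v a b := by
  unfold pairRate; positivity

@[simp] lemma pairRate_zero_left : pairRate u v 0 b = 0 := by simp [pairRate]

@[simp] lemma pairRate_zero_right : pairRate u v a 0 = 0 := by simp [pairRate]

lemma pairRate_symm : pairRate u v a b = pairRate v u b a := by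
  unfold pairRate; rw [mul_comm a b, add_comm]

lemma pairRate_mul (c : ℝ) : pairRate u v (c * a) (c * b) = c * pairRate u v a b := by
  unfold pairRate
  rcases eq_or_ne c 0 with rfl | hc
  · simp
  · rw [show u * (c * b) + v * (c * a) = c * (u * b + v * a) by ring,
      show c * a * (c * b) = c * (c * (a * b)) by ring, mul_div_mul_left _ _ hc, mul_div_assoc]

lemma pairRate_eq (ha : 0 < a) (hb : 0 < b) : pairRate u v a b = 1 / (u / a + v / b) := by
  unfold pairRate
  rw [div_add_div _ _ ha.ne' hb.ne', one_div_div, mul_comm a v]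

lemma pairRate_lt (hu : 0 < u) (hv : 0 < v) (ha : 0 ≤ a) (h : a < a') (hb : 0 < b) :
    pairRate u v a b < pairRate u v a' b := by
  have ha' : 0 < a' := ha.trans_lt h
  unfold pairRate
  rw [div_lt_div_iff₀ (by positivity) (by positivity)]
  have : 0 < u * b ^ 2 := by positivity
  nlinarith

lemma pairRate_mono_left (hu : 0 < u) (hv : 0 < v) (ha : 0 ≤ a) (h : a ≤ a') (hb : 0 ≤ b) :
    pairRate u v a b ≤ pairRate u v a' b := by
  rcases h.eq_or_lt with rfl | h
  · rfl
  rcases hb.eq_or_lt with rfl | hb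
  · simp
  exact (pairRate_lt hu hv ha h hb).le

lemma pairRate_mono (hu : 0 < u) (hv : 0 < v) (ha : 0 ≤ a) (h : a ≤ a') (hb : 0 ≤ b)
    (h' : b ≤ b') : pairRate u v a b ≤ pairRate u v a' b' := by
  refine (pairRate_mono_left hu hv ha h hb).trans ?_
  rw [pairRate_symm, pairRate_symm (a := a')]
  exact pairRate_mono_left hv hu hb h' (ha.trans h)

lemma pairRate_le (hu : 0 < u) (hv : 0 < v) (ha : 0 ≤ a) (hb : 0 ≤ b) :
    pairRate u v a b ≤ a / u := by
  unfold pairRate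
  rcases hb.eq_or_lt with rfl | hb
  · simp; positivity
  · rw [div_le_div_iff₀ (by positivity) hu]
    have : 0 ≤ v * a * a := by positivity
    nlinarith

lemma le_pairRate (hu : 0 < u) (hv : 0 < v) (ha : 0 ≤ a) (hb : 0 ≤ b) :
    min a b / (u + v) ≤ pairRate u v a b := by
  have h0 : 0 ≤ min a b := le_min ha hb
  refine le_trans (le_of_eq ?_)
    (pairRate_mono hu hv h0 (min_le_left a b) h0 (min_le_right a b))
  unfold pairRate
  rcases h0.eq_or_lt with h | h
  · rw [← h]; simp
  · field_simp

/-- The denominator vanishes only at the origin. There the quotient has the default value `0`, which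
is the right one because of `0 ≤ pairRate u v a b ≤ a / u`. -/
lemma continuousOn_pairRate (hu : 0 < u) (hv : 0 < v) :
    ContinuousOn (fun p : ℝ × ℝ => pairRate u v p.1 p.2) (Ici 0 ×ˢ Ici 0) := by
  rintro ⟨a, b⟩ ⟨ha, hb⟩
  simp only [mem_Ici] at ha hb
  by_cases h : u * b + v * a = 0
  · have h1 : 0 ≤ u * b := by positivity
    have h2 : 0 ≤ v * a := by positivity
    have ha0 : a = 0 := by
      have : v * a = 0 := by linarith
      simpa [hv.ne'] using this
    subst ha0
    have : Tendsto (fun p : ℝ × ℝ => p.1 / u) (𝓝[Ici 0 ×ˢ Ici 0] (0, b)) (𝓝 0) := by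
      have : Continuous (fun p : ℝ × ℝ => p.1 / u) := by fun_prop
      simpa using (this.tendsto (0, b)).mono_left nhdsWithin_le_nhds
    simp only [ContinuousWithinAt, pairRate_zero_left]
    refine tendsto_of_tendsto_of_tendsto_of_le_of_le' tendsto_const_nhds this ?_ ?_
    · filter_upwards [self_mem_nhdsWithin] with p hp using pairRate_nonneg hu hv hp.1 hp.2
    · filter_upwards [self_mem_nhdsWithin] with p hp using pairRate_le hu hv hp.1 hp.2
  · unfold pairRate
    apply ContinuousAt.continuousWithinAt
    fun_prop (disch := exact h)

end pairRate

/-! ### Exponents of the failure events at an arbitrary allocation -/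

namespace Problem

variable {k m : ℕ} (ν : Problem k m) (s : Fin k)

/-- The exponent of the event that arm `i` is feasible and beats arm `s`, under a Gaussian law with
means `M` and precisions proportional to `b` for arm `s` and to `a` for arm `i`. -/
def exponent (M : Fin k → Fin (m + 1) → ℝ) (b a : ℝ) (i : Fin k) : ℝ :=
  (max (M s 0 - M i 0) 0) ^ 2 / 2 * pairRate (ν.var i 0) (ν.var s 0) a b +
    a * ∑ j : Fin m, (max (M i j.succ - ν.thr j) 0) ^ 2 / (2 * (ν.var i j.succ : ℝ))

/-- The exponent of the event that arm `s` violates constraint `j`. -/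
def conExponent (M : Fin k → Fin (m + 1) → ℝ) (b : ℝ) (j : Fin m) : ℝ :=
  b * ((max (ν.thr j - M s j.succ) 0) ^ 2 / (2 * (ν.var s j.succ : ℝ)))

variable {ν s}

lemma var_pos' (ν : Problem k m) (i : Fin k) (j : Fin (m + 1)) : (0 : ℝ) < ν.var i j := by
  exact_mod_cast ν.var_pos i j

lemma not_feasibleAt {θ : Fin k → Fin (m + 1) → ℝ} {i : Fin k} :
    ¬ ν.FeasibleAt θ i ↔ ∃ j : Fin m, ν.thr j < θ i j.succ := by
  simp [FeasibleAt]

/-- Homogeneity of degree one passes from sample sizes to proportions, with `c` the number of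
rounds. -/
lemma exponent_mul (M : Fin k → Fin (m + 1) → ℝ) (c b a : ℝ) (i : Fin k) :
    ν.exponent s M (c * b) (c * a) i = c * ν.exponent s M b a i := by
  unfold exponent; rw [pairRate_mul]; ring

lemma conExponent_mul (M : Fin k → Fin (m + 1) → ℝ) (c b : ℝ) (j : Fin m) :
    ν.conExponent s M (c * b) j = c * ν.conExponent s M b j := by
  unfold conExponent; ring

/-- The positive parts encode the classes of arms: a gap of favourable sign costs nothing. Unlike
`armRate`, the right side has the correct limit `0` at `a = 0` instead of the default of a division
by zero, which makes compactness arguments possible. -/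
lemma armRate_eq_exponent (hs : ν.IsUniqueBest s) {a b : ℝ} (ha : 0 < a) (hb : 0 < b) {i : Fin k}
    (hi : i ≠ s) : ν.armRate s b a i = ν.exponent s ν.mean b a i := by
  unfold armRate exponent
  congr 1
  · by_cases h : i ∈ ν.Fw s ∪ ν.Iw s
    · rw [if_pos h, pairRate_eq ha hb]
      have hlt : ν.mean i 0 < ν.mean s 0 := by
        rcases h with h | h
        · exact hs.2 i hi h.1
        · exact h.1
      rw [max_eq_left (by linarith)]
      have := ν.var_pos' i 0
      have := ν.var_pos' s 0
      field_simp
      ring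
    · rw [if_neg h]
      have : ν.mean s 0 ≤ ν.mean i 0 := by
        by_contra hlt
        push Not at hlt
        apply h
        by_cases hf : ν.FeasibleAt ν.mean i
        · exact Or.inl ⟨hf, hi⟩
        · exact Or.inr ⟨hlt, not_feasibleAt.1 hf⟩
      rw [max_eq_right (by linarith)]
      simp
  · have hsum : ∑ j ∈ ν.MI i, (ν.mean i j.succ - ν.thr j) ^ 2 / (2 * (ν.var i j.succ : ℝ)) =
        ∑ j : Fin m, (max (ν.mean i j.succ - ν.thr j) 0) ^ 2 / (2 * (ν.var i j.succ : ℝ)) := by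
      unfold MI
      rw [Finset.sum_filter]
      refine Finset.sum_congr rfl fun j _ => ?_
      split_ifs with h
      · rw [max_eq_left (by linarith)]
      · rw [max_eq_right (by linarith)]; simp
    by_cases h : i ∈ ν.Ib s ∪ ν.Iw s
    · rw [if_pos h, hsum]
    · rw [if_neg h]
      have : ν.FeasibleAt ν.mean i := by
        by_contra hf
        rw [not_feasibleAt] at hf
        apply h
        rcases le_or_gt (ν.mean s 0) (ν.mean i 0) with h1 | h1
        · exact Or.inl ⟨h1, hf⟩
        · exact Or.inr ⟨h1, hf⟩
      rw [Finset.sum_eq_zero, mul_zero]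
      intro j _
      rw [max_eq_right (by linarith [this j])]
      simp

lemma conSum_nonneg (M : Fin k → Fin (m + 1) → ℝ) (i : Fin k) :
    0 ≤ ∑ j : Fin m, (max (M i j.succ - ν.thr j) 0) ^ 2 / (2 * (ν.var i j.succ : ℝ)) :=
  Finset.sum_nonneg fun j _ => by have := ν.var_pos' i j.succ; positivity

lemma exponent_mono (M : Fin k → Fin (m + 1) → ℝ) {a a' b b' : ℝ} (ha : 0 ≤ a) (h : a ≤ a')
    (hb : 0 ≤ b) (h' : b ≤ b') (i : Fin k) : ν.exponent s M b a i ≤ ν.exponent s M b' a' i := by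
  unfold exponent
  have := pairRate_mono (ν.var_pos' i 0) (ν.var_pos' s 0) ha h hb h'
  have := conSum_nonneg (ν := ν) M i
  gcongr

/-- An arm other than the best one has a worse objective mean or violates a constraint. -/
lemma gap_pos (hs : ν.IsUniqueBest s) {i : Fin k} (hi : i ≠ s) :
    0 < max (ν.mean s 0 - ν.mean i 0) 0 ∨
    0 < ∑ j : Fin m, (max (ν.mean i j.succ - ν.thr j) 0) ^ 2 / (2 * (ν.var i j.succ : ℝ)) := by
  by_cases hf : ν.FeasibleAt ν.mean i
  · left
    have := hs.2 i hi hf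
    simp [this]
  · right
    obtain ⟨j, hj⟩ := not_feasibleAt.1 hf
    refine Finset.sum_pos' (fun j _ => ?_) ⟨j, Finset.mem_univ _, ?_⟩
    · have := ν.var_pos' i j.succ; positivity
    · have := ν.var_pos' i j.succ
      have : 0 < max (ν.mean i j.succ - ν.thr j) 0 := by simp [hj]
      positivity

/-- By `gap_pos` at least one of the two coefficients is positive, and for `b > 0` the factors of
both are strictly increasing in `a`. -/
lemma exponent_lt (hs : ν.IsUniqueBest s) {a a' b : ℝ} (ha : 0 ≤ a) (h : a < a') (hb : 0 < b)
    {i : Fin k} (hi : i ≠ s) : ν.exponent s ν.mean b a i < ν.exponent s ν.mean b a' i := by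
  have h1 := pairRate_lt (ν.var_pos' i 0) (ν.var_pos' s 0) ha h hb
  have h2 := conSum_nonneg (ν := ν) ν.mean i
  unfold exponent
  rcases gap_pos hs hi with h0 | h0
  · have : 0 < (max (ν.mean s 0 - ν.mean i 0) 0) ^ 2 / 2 := by positivity
    exact add_lt_add_of_lt_of_le (by gcongr) (by gcongr)
  · exact add_lt_add_of_le_of_lt (by gcongr) (by gcongr)

lemma continuousOn_exponent (M : Fin k → Fin (m + 1) → ℝ) (i : Fin k) :
    ContinuousOn (fun p : ℝ × ℝ => ν.exponent s M p.1 p.2 i) (Ici 0 ×ˢ Ici 0) := by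
  unfold exponent
  refine ContinuousOn.add (continuousOn_const.mul ?_) (by fun_prop)
  exact (continuousOn_pairRate (ν.var_pos' i 0) (ν.var_pos' s 0)).comp
    (f := fun p : ℝ × ℝ => (p.2, p.1)) (by fun_prop) (fun p hp => ⟨hp.2, hp.1⟩)

lemma continuousOn_exponent_right (M : Fin k → Fin (m + 1) → ℝ) {b : ℝ} (hb : 0 ≤ b) (i : Fin k) :
    ContinuousOn (fun a : ℝ => ν.exponent s M b a i) (Ici 0) :=
  (continuousOn_exponent (ν := ν) (s := s) M i).comp (f := fun a : ℝ => (b, a)) (by fun_prop)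
    (fun _ ha => ⟨hb, ha⟩)

@[simp] lemma exponent_zero_right (M : Fin k → Fin (m + 1) → ℝ) (b : ℝ) (i : Fin k) :
    ν.exponent s M b 0 i = 0 := by simp [exponent]

/-- Every level below the exponent at `a` is attained at a smaller sampling rate. -/
lemma exists_exponent_eq (M : Fin k → Fin (m + 1) → ℝ) {a b r : ℝ} (ha : 0 ≤ a) (hb : 0 ≤ b)
    {i : Fin k} (hr : 0 ≤ r) (h : r ≤ ν.exponent s M b a i) :
    ∃ c, 0 ≤ c ∧ c ≤ a ∧ ν.exponent s M b c i = r := by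
  have := intermediate_value_Icc ha
    ((continuousOn_exponent_right (ν := ν) (s := s) M hb i).mono Icc_subset_Ici_self)
  obtain ⟨c, hc, h⟩ := this ⟨by simpa using hr, h⟩
  exact ⟨c, hc.1, hc.2, h⟩

end Problem

/-! ### Optimal allocations and the maximization of `Γ` -/

namespace Problem

variable {k m : ℕ} {ν : Problem k m} {s : Fin k} {β : ℝ}

lemma erase_nonempty (hk : 2 ≤ k) (s : Fin k) : (Finset.univ.erase s).Nonempty := by
  rw [← Finset.card_pos, Finset.card_erase_of_mem (Finset.mem_univ s), Finset.card_fin]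
  omega

/-- Allocations that give the proportion `β` to arm `s`. -/
def allocations (s : Fin k) (β : ℝ) : Set (Fin k → ℝ) :=
  {a | a s = β ∧ (∀ i, 0 ≤ a i) ∧ ∑ i ∈ Finset.univ.erase s, a i = 1 - β}

lemma isCompact_allocations (hβ : β ∈ Ioo (0 : ℝ) 1) : IsCompact (allocations s β) := by
  have hc : IsCompact (Set.pi univ fun _ : Fin k => Icc (0 : ℝ) 1) :=
    isCompact_univ_pi fun _ => isCompact_Icc
  refine hc.of_isClosed_subset ?_ ?_
  · refine (isClosed_eq (by fun_prop) (by fun_prop)).inter (IsClosed.inter ?_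
      (isClosed_eq (by fun_prop) (by fun_prop)))
    exact isClosed_Ici (a := (0 : Fin k → ℝ))
  · rintro a ⟨h1, h2, h3⟩ i -
    refine ⟨h2 i, ?_⟩
    by_cases hi : i = s
    · subst hi; linarith [hβ.2]
    · have := Finset.single_le_sum (f := a) (fun i _ => h2 i)
        (Finset.mem_erase.2 ⟨hi, Finset.mem_univ i⟩)
      linarith [hβ.1]

/-- Adding the same amount to each coordinate fills up an allocation. -/
lemma fill_mem_allocations (hk : 2 ≤ k) (hβ : β ∈ Ioo (0 : ℝ) 1) {c : Fin k → ℝ}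
    (hc : ∀ i, 0 ≤ c i) (hsum : ∑ i ∈ Finset.univ.erase s, c i < 1 - β) :
    ∃ δ > 0, (fun i => if i = s then β else c i + δ) ∈ allocations s β := by
  have hA : (0 : ℝ) < ((Finset.univ.erase s).card : ℝ) := by
    exact_mod_cast (erase_nonempty hk s).card_pos
  have hδ : 0 < (1 - β - ∑ i ∈ Finset.univ.erase s, c i) / ((Finset.univ.erase s).card : ℝ) :=
    div_pos (by linarith) hA
  refine ⟨_, hδ, by simp, fun i => ?_, ?_⟩
  · dsimp only
    split_ifs
    · exact hβ.1.le
    · exact add_nonneg (hc i) hδ.le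
  · rw [Finset.sum_congr rfl fun i hi => if_neg (Finset.ne_of_mem_erase hi),
      Finset.sum_add_distrib, Finset.sum_const, nsmul_eq_mul, mul_div_cancel₀ _ hA.ne']
    ring

/-- The optimal sampling rates exist. -/
theorem exists_isOptimalRates (hk : 2 ≤ k) (hs : ν.IsUniqueBest s) (hβ : β ∈ Ioo (0 : ℝ) 1) :
    ∃ α, ν.IsOptimalRates s β α := by
  set A := Finset.univ.erase s with hAdef
  have hA : A.Nonempty := erase_nonempty hk s
  obtain ⟨δ₀, hδ₀, hmem₀⟩ := fill_mem_allocations (s := s) (c := fun _ => 0) hk hβ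
    (fun _ => le_rfl) (by simpa using hβ.2)
  -- The maximizer of the smallest exponent need not be balanced a priori; it is trimmed to a
  -- balanced vector below.
  obtain ⟨a, ha, hmax⟩ := (isCompact_allocations hβ).exists_isMaxOn ⟨_, hmem₀⟩
    (f := fun a : Fin k → ℝ => A.inf' hA fun i => ν.exponent s ν.mean β (a i) i) (by
      refine ContinuousOn.finset_inf'_apply hA fun i _ => ?_
      exact (continuousOn_exponent_right ν.mean hβ.1.le i).comp (f := fun a : Fin k → ℝ => a i)
        (by fun_prop) fun a ha => ha.2.1 i)
  set V := A.inf' hA fun i => ν.exponent s ν.mean β (a i) i with hV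
  -- A balanced vector of level `V'` that can be increased in every coordinate to an allocation is
  -- not optimal. It is used for `c = 0`, to get `V > 0`, and for the trimmed maximizer.
  have hlt {c : Fin k → ℝ} {δ V' : ℝ} (hc : ∀ i, 0 ≤ c i) (hδ : 0 < δ)
      (hmem : (fun i => if i = s then β else c i + δ) ∈ allocations s β)
      (hV' : ∀ i, i ≠ s → ν.exponent s ν.mean β (c i) i = V') : V' < V := by
    refine lt_of_lt_of_le ?_ (hmax hmem)
    rw [Finset.lt_inf'_iff]
    intro i hi
    have hi' : i ≠ s := Finset.ne_of_mem_erase hi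
    rw [← hV' i hi']
    simp only [if_neg hi']
    exact exponent_lt hs (hc i) (by linarith) hβ.1 hi'
  have hV0 : 0 < V := hlt (c := fun _ => 0) (fun _ => le_rfl) hδ₀ hmem₀ (by simp)
  -- Each coordinate of the maximizer is cut back until its exponent is exactly `V`.
  have hex : ∀ i, ∃ c, 0 ≤ c ∧ (i ≠ s → c ≤ a i ∧ ν.exponent s ν.mean β c i = V) := by
    intro i
    by_cases hi : i = s
    · exact ⟨0, le_rfl, fun h => absurd hi h⟩
    · obtain ⟨c, h1, h2, h3⟩ := exists_exponent_eq (ν := ν) (s := s) ν.mean (ha.2.1 i) hβ.1.le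
        hV0.le (Finset.inf'_le (fun i => ν.exponent s ν.mean β (a i) i)
          (Finset.mem_erase.2 ⟨hi, Finset.mem_univ i⟩))
      exact ⟨c, h1, fun _ => ⟨h2, h3⟩⟩
  choose c hc0 hc using hex
  have hle : ∑ i ∈ A, c i ≤ 1 - β := by
    rw [← ha.2.2]
    exact Finset.sum_le_sum fun i hi => (hc i (Finset.ne_of_mem_erase hi)).1
  have heq : ∑ i ∈ A, c i = 1 - β := by
    -- A surplus left by the trimming could be spread equally over the arms and would lift all
    -- exponents above the maximum.
    refine hle.eq_of_not_lt fun h => ?_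
    obtain ⟨δ, hδ, hmem⟩ := fill_mem_allocations hk hβ hc0 h
    exact lt_irrefl _ (hlt hc0 hδ hmem fun i hi => (hc i hi).2)
  have hpos : ∀ i, i ≠ s → 0 < c i := by
    intro i hi
    refine (hc0 i).lt_of_ne fun h => ?_
    have := (hc i hi).2
    rw [← h, exponent_zero_right] at this
    exact hV0.ne this
  refine ⟨fun i => if i = s then β else c i, by simp, fun i hi => by simpa [hi] using hpos i hi,
    ?_, fun i i' hi hi' => ?_⟩
  · rw [Finset.sum_congr rfl fun i hi => if_neg (Finset.ne_of_mem_erase hi), heq]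
  · simp only [if_neg hi, if_neg hi']
    rw [armRate_eq_exponent hs (hpos i hi) hβ.1 hi, armRate_eq_exponent hs (hpos i' hi') hβ.1 hi',
      (hc i hi).2, (hc i' hi').2]

lemma IsOptimalRates.exponent_eq (hs : ν.IsUniqueBest s) (hβ : β ∈ Ioo (0 : ℝ) 1)
    {α : Fin k → ℝ} (h : ν.IsOptimalRates s β α) {i i' : Fin k} (hi : i ≠ s) (hi' : i' ≠ s) :
    ν.exponent s ν.mean β (α i) i = ν.exponent s ν.mean β (α i') i' := by
  rw [← armRate_eq_exponent hs (h.2.1 i hi) hβ.1 hi, ← armRate_eq_exponent hs (h.2.1 i' hi') hβ.1 hi',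
    h.2.2.2 i i' hi hi']

/-- An allocation of at most `1 - β` to the arms other than `s` gives some arm at most its optimal
rate. -/
lemma IsOptimalRates.exists_le (hk : 2 ≤ k) {α : Fin k → ℝ} (h : ν.IsOptimalRates s β α)
    {w : Fin k → ℝ} (hw : ∑ i ∈ Finset.univ.erase s, w i ≤ 1 - β) : ∃ i, i ≠ s ∧ w i ≤ α i := by
  by_contra! hlt
  have := Finset.sum_lt_sum_of_nonempty (erase_nonempty hk s)
    (fun i hi => hlt i (Finset.ne_of_mem_erase hi))
  rw [h.2.2.1] at this
  linarith

/-- The optimal sampling rates are unique. -/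
theorem IsOptimalRates.unique (hk : 2 ≤ k) (hs : ν.IsUniqueBest s) (hβ : β ∈ Ioo (0 : ℝ) 1)
    {α α' : Fin k → ℝ} (h : ν.IsOptimalRates s β α) (h' : ν.IsOptimalRates s β α') : α = α' := by
  have key : ∀ {α α' : Fin k → ℝ}, ν.IsOptimalRates s β α → ν.IsOptimalRates s β α' →
      ∀ i, i ≠ s → α i ≤ α' i := by
    intro α α' h h' i hi
    by_contra! hlt
    -- Equal totals give an arm `l` that compensates for `i`. The common level of `α` would exceed
    -- that of `α'` at arm `i`, but not at arm `l`.
    obtain ⟨l, hl, hle⟩ := h'.exists_le hk h.2.2.1.le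
    have h1 := exponent_lt hs (h'.2.1 i hi).le hlt hβ.1 hi
    have h2 := exponent_mono (ν := ν) (s := s) ν.mean (h.2.1 l hl).le hle hβ.1.le le_rfl l
    rw [h.exponent_eq hs hβ hi hl, h'.exponent_eq hs hβ hi hl] at h1
    linarith
  ext i
  by_cases hi : i = s
  · rw [hi, h.1, h'.1]
  · exact le_antisymm (key h h' i hi) (key h' h i hi)

lemma isOptimalRates_optRates (hk : 2 ≤ k) (hs : ν.IsUniqueBest s) (hβ : β ∈ Ioo (0 : ℝ) 1) :
    ν.IsOptimalRates s β (ν.optRates s β) :=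
  Classical.epsilon_spec (exists_isOptimalRates hk hs hβ)

lemma conExponent_mean (hs : ν.IsUniqueBest s) (b : ℝ) (j : Fin m) :
    ν.conExponent s ν.mean b j =
      b * ((ν.mean s j.succ - ν.thr j) ^ 2 / (2 * (ν.var s j.succ : ℝ))) := by
  unfold conExponent
  rw [max_eq_left (by linarith [hs.1 j]), sub_sq_comm]

lemma finite_gam (s : Fin k) (β : ℝ) :
    ({r | ∃ i, i ≠ s ∧ r = ν.armRate s β (ν.optRates s β i) i} ∪
    {r | ∃ j ∈ ν.MF s, r = β * ((ν.mean s j.succ - ν.thr j) ^ 2 /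
      (2 * (ν.var s j.succ : ℝ)))}).Finite := by
  refine Set.Finite.union ?_ ?_
  · refine (Set.finite_range fun i => ν.armRate s β (ν.optRates s β i) i).subset ?_
    rintro r ⟨i, -, rfl⟩
    exact ⟨i, rfl⟩
  · refine (Set.finite_range fun j : Fin m => β * ((ν.mean s j.succ - ν.thr j) ^ 2 /
      (2 * (ν.var s j.succ : ℝ)))).subset ?_
    rintro r ⟨j, -, rfl⟩
    exact ⟨j, rfl⟩

lemma gam_le_exponent (hk : 2 ≤ k) (hs : ν.IsUniqueBest s) (hβ : β ∈ Ioo (0 : ℝ) 1) {i : Fin k}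
    (hi : i ≠ s) : ν.Gam s β ≤ ν.exponent s ν.mean β (ν.optRates s β i) i := by
  rw [← armRate_eq_exponent hs ((isOptimalRates_optRates hk hs hβ).2.1 i hi) hβ.1 hi]
  exact csInf_le (finite_gam s β).bddBelow (Or.inl ⟨i, hi, rfl⟩)

lemma gam_le_conExponent (hs : ν.IsUniqueBest s) (j : Fin m) :
    ν.Gam s β ≤ ν.conExponent s ν.mean β j := by
  rw [conExponent_mean hs]
  exact csInf_le (finite_gam s β).bddBelow (Or.inr ⟨j, by simpa [MF] using hs.1 j, rfl⟩)

lemma le_gam (hk : 2 ≤ k) (hs : ν.IsUniqueBest s) (hβ : β ∈ Ioo (0 : ℝ) 1) {x : ℝ}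
    (h₁ : ∀ i, i ≠ s → x ≤ ν.exponent s ν.mean β (ν.optRates s β i) i)
    (h₂ : ∀ j, x ≤ ν.conExponent s ν.mean β j) : x ≤ ν.Gam s β := by
  obtain ⟨i, hi⟩ := erase_nonempty hk s
  refine le_csInf ⟨_, Or.inl ⟨i, Finset.ne_of_mem_erase hi, rfl⟩⟩ ?_
  rintro r (⟨i, hi, rfl⟩ | ⟨j, -, rfl⟩)
  · rw [armRate_eq_exponent hs ((isOptimalRates_optRates hk hs hβ).2.1 i hi) hβ.1 hi]
    exact h₁ i hi
  · rw [← conExponent_mean hs]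
    exact h₂ j

/-- The balanced level is positive because the optimal rates are; the constraint exponents of `s`
are positive because its means avoid the boundary. -/
lemma gam_pos (hk : 2 ≤ k) (hs : ν.IsUniqueBest s) (hb : ν.NoBoundary) (hβ : β ∈ Ioo (0 : ℝ) 1) :
    0 < ν.Gam s β := by
  have hα := isOptimalRates_optRates hk hs hβ
  obtain ⟨i₀, hi₀⟩ := erase_nonempty hk s
  have hi₀ := Finset.ne_of_mem_erase hi₀
  have h1 : 0 < ν.exponent s ν.mean β (ν.optRates s β i₀) i₀ := by
    have := exponent_lt hs le_rfl (hα.2.1 i₀ hi₀) hβ.1 hi₀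
    rwa [exponent_zero_right] at this
  have h2 : ∀ j, 0 < ν.conExponent s ν.mean β j := by
    intro j
    rw [conExponent_mean hs]
    have := ν.var_pos' s j.succ
    have := sub_ne_zero.2 (hb s j)
    have := hβ.1
    positivity
  obtain ⟨x, hx0, hx1, hx2⟩ : ∃ x, 0 < x ∧ x ≤ ν.exponent s ν.mean β (ν.optRates s β i₀) i₀ ∧
      ∀ j, x ≤ ν.conExponent s ν.mean β j := by
    rcases isEmpty_or_nonempty (Fin m) with hm | hm
    · exact ⟨_, h1, le_rfl, fun j => hm.elim j⟩
    · obtain ⟨j, hj⟩ := Finite.exists_min fun j => ν.conExponent s ν.mean β j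
      exact ⟨min _ _, lt_min h1 (h2 j), min_le_left _ _, fun j' => (min_le_right _ _).trans (hj j')⟩
  refine hx0.trans_le (le_gam hk hs hβ (fun i hi => ?_) hx2)
  rwa [hα.exponent_eq hs hβ hi hi₀]

/-- A positive level at most all exponents of an allocation is at most `Γ` of the proportion of
arm `s`. -/
lemma le_gam_of_le_exponents (hk : 2 ≤ k) (hs : ν.IsUniqueBest s) {w : Fin k → ℝ}
    (hw : ∀ i, 0 ≤ w i) (hsum : ∑ i, w i ≤ 1) {x : ℝ} (hx : 0 < x)
    (h₁ : ∀ i, i ≠ s → x ≤ ν.exponent s ν.mean (w s) (w i) i)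
    (h₂ : ∀ j, x ≤ ν.conExponent s ν.mean (w s) j) : w s ∈ Ioo (0 : ℝ) 1 ∧ x ≤ ν.Gam s (w s) := by
  have hsplit := Finset.add_sum_erase Finset.univ w (Finset.mem_univ s)
  obtain ⟨i₀, hi₀⟩ := erase_nonempty hk s
  have hi₀' := Finset.ne_of_mem_erase hi₀
  have hpos : ∀ i, i ≠ s → 0 < w i := by
    intro i hi
    refine (hw i).lt_of_ne fun h => ?_
    have := h₁ i hi
    rw [← h, exponent_zero_right] at this
    linarith
  have hmem : w s ∈ Ioo (0 : ℝ) 1 := by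
    constructor
    · refine (hw s).lt_of_ne fun h => ?_
      -- If `w s = 0`, any constraint of `s` has exponent zero. An infeasible arm could still have a
      -- positive exponent then, so the other arms give a contradiction only when there are no
      -- constraints.
      rcases isEmpty_or_nonempty (Fin m) with hm | ⟨⟨j⟩⟩
      · have := h₁ i₀ hi₀'
        rw [← h] at this
        simp [exponent] at this
        linarith
      · have := h₂ j
        rw [← h] at this
        simp [conExponent] at this
        linarith
    · have := Finset.single_le_sum (f := w) (fun i _ => hw i) hi₀
      linarith [hpos i₀ hi₀']
  refine ⟨hmem, ?_⟩
  have hα := isOptimalRates_optRates hk hs hmem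
  -- At an arm with at most its optimal rate, `x` is bounded by the balanced level, which is the
  -- exponent of all arms.
  obtain ⟨i, hi, hle⟩ := hα.exists_le hk (w := w) (by linarith)
  refine le_gam hk hs hmem (fun i' hi' => ?_) h₂
  rw [hα.exponent_eq hs hmem hi' hi]
  exact (h₁ i hi).trans (exponent_mono _ (hw i) hle (hw s) le_rfl i)

/-- An optimal proportion exists. -/
theorem exists_isOptimalBeta (hk : 2 ≤ k) (hs : ν.IsUniqueBest s) (hb : ν.NoBoundary) :
    ∃ b, ν.IsOptimalBeta s b := by
  have : Nontrivial (Fin k) := Fin.nontrivial_iff_two_le.2 hk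
  have hA : (Finset.univ.erase s).Nonempty := erase_nonempty hk s
  -- The smallest exponent is maximized over the whole simplex, so that no continuity of `β ↦ Γ_β`
  -- is needed. Arm `s` has no exponent of its own; its index repeats that of another arm.
  let f : Fin k ⊕ Fin m → (Fin k → ℝ) → ℝ := fun p w =>
    p.elim (fun i => if i = s then ν.exponent s ν.mean (w s) (w hA.choose) hA.choose
      else ν.exponent s ν.mean (w s) (w i) i) (fun j => ν.conExponent s ν.mean (w s) j)
  have hf : ∀ p, ContinuousOn (f p) (stdSimplex ℝ (Fin k)) := by
    have hcont : ∀ i, ContinuousOn (fun w : Fin k → ℝ => ν.exponent s ν.mean (w s) (w i) i)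
        (stdSimplex ℝ (Fin k)) := fun i =>
      (continuousOn_exponent (ν := ν) (s := s) ν.mean i).comp
        (f := fun w : Fin k → ℝ => (w s, w i)) (by fun_prop) fun w hw => ⟨hw.1 s, hw.1 i⟩
    rintro (i | j)
    · by_cases hi : i = s
      · simpa [f, hi] using hcont hA.choose
      · simpa [f, hi] using hcont i
    · simp only [f, Sum.elim_inr, conExponent]
      fun_prop
  have hne : (Finset.univ : Finset (Fin k ⊕ Fin m)).Nonempty := ⟨Sum.inl s, Finset.mem_univ _⟩
  obtain ⟨w, hw, hmax⟩ := (isCompact_stdSimplex ℝ (Fin k)).exists_isMaxOn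
    ⟨_, single_mem_stdSimplex ℝ s⟩
    (f := fun w => Finset.univ.inf' hne fun p => f p w)
    (ContinuousOn.finset_inf'_apply hne fun p _ => hf p)
  set V := Finset.univ.inf' hne fun p => f p w with hV
  have hgam : ∀ β ∈ Ioo (0 : ℝ) 1, ν.Gam s β ≤ V := by
    intro β hβ
    have hα := isOptimalRates_optRates hk hs hβ
    have hmem : ν.optRates s β ∈ stdSimplex ℝ (Fin k) := by
      refine ⟨fun i => ?_, ?_⟩
      · by_cases hi : i = s
        · rw [hi, hα.1]; exact hβ.1.le
        · exact (hα.2.1 i hi).le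
      · rw [← Finset.add_sum_erase _ _ (Finset.mem_univ s), hα.2.2.1, hα.1]; ring
    refine le_trans ?_ (hmax hmem)
    refine Finset.le_inf' _ _ ?_
    rintro (i | j) -
    · by_cases hi : i = s
      · simpa [f, hi, hα.1] using
          gam_le_exponent hk hs hβ (Finset.ne_of_mem_erase hA.choose_spec)
      · simpa [f, hi, hα.1] using gam_le_exponent hk hs hβ hi
    · simpa [f, hα.1] using gam_le_conExponent hs j
  have hV0 : 0 < V :=
    (gam_pos hk hs hb (β := 1 / 2) (by norm_num)).trans_le (hgam _ (by norm_num))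
  have hVle : ∀ p, V ≤ f p w := fun p => Finset.inf'_le (fun p => f p w) (Finset.mem_univ p)
  -- The maximizer satisfies `V ≤ Γ` at its own proportion `w s`, while `V` bounds `Γ_β` for every
  -- `β`; hence `w s` is optimal.
  obtain ⟨h1, h2⟩ := le_gam_of_le_exponents hk hs hw.1 hw.2.le hV0
    (fun i hi => by simpa [f, hi] using hVle (Sum.inl i)) (fun j => hVle (Sum.inr j))
  exact ⟨w s, h1, fun β hβ => (hgam β hβ).trans h2⟩

end Problem

/-! ### Chernoff bounds and lower bounds for Gaussian product measures -/

/-- The product of the laws `N(M i j, v i j)`. -/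
def gaussPi {k n : ℕ} (M : Fin k → Fin n → ℝ) (v : Fin k → Fin n → ℝ≥0) :
    Measure (Fin k → Fin n → ℝ) :=
  Measure.pi fun i => Measure.pi fun j => gaussianReal (M i j) (v i j)

instance {k n : ℕ} (M : Fin k → Fin n → ℝ) (v : Fin k → Fin n → ℝ≥0) :
    IsProbabilityMeasure (gaussPi M v) := by
  unfold gaussPi; infer_instance

section gaussPi

variable {k n : ℕ} {M : Fin k → Fin n → ℝ} {v : Fin k → Fin n → ℝ≥0}

/-- The Chernoff bound for a linear functional. -/
lemma gaussPi_chernoff (c : ℝ) (l : Fin k → Fin n → ℝ) :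
    (gaussPi M v).real {θ | 0 ≤ c + ∑ i, ∑ j, l i j * θ i j} ≤
      Real.exp (c + ∑ i, ∑ j, (M i j * l i j + v i j * l i j ^ 2 / 2)) := by
  have hexp : ∀ θ : Fin k → Fin n → ℝ, Real.exp (1 * (c + ∑ i, ∑ j, l i j * θ i j)) =
      Real.exp c * ∏ i, ∏ j, Real.exp (l i j * θ i j) := fun θ => by
    rw [one_mul, Real.exp_add, Real.exp_sum]
    simp only [Real.exp_sum]
  have hint : Integrable (fun θ : Fin k → Fin n → ℝ => ∏ i, ∏ j, Real.exp (l i j * θ i j))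
      (gaussPi M v) :=
    Integrable.fintype_prod (E := Fin n → ℝ)
      (f := fun i (x : Fin n → ℝ) => ∏ j, Real.exp (l i j * x j))
      fun i => Integrable.fintype_prod (E := ℝ) (f := fun j (x : ℝ) => Real.exp (l i j * x))
        fun j => integrable_exp_mul_gaussianReal _
  have hprod : ∫ θ, ∏ i, ∏ j, Real.exp (l i j * θ i j) ∂(gaussPi M v) =
      ∏ i, ∏ j, ∫ x, Real.exp (l i j * x) ∂(gaussianReal (M i j) (v i j)) := by
    refine (integral_fintype_prod_eq_prod (E := fun _ : Fin k => Fin n → ℝ)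
      (fun i (x : Fin n → ℝ) => ∏ j, Real.exp (l i j * x j))).trans ?_
    refine Finset.prod_congr rfl fun i _ => ?_
    exact integral_fintype_prod_eq_prod (E := fun _ : Fin n => ℝ)
      (fun j (x : ℝ) => Real.exp (l i j * x))
  have hmgf : mgf (fun θ : Fin k → Fin n → ℝ => c + ∑ i, ∑ j, l i j * θ i j) (gaussPi M v) 1 =
      Real.exp (c + ∑ i, ∑ j, (M i j * l i j + v i j * l i j ^ 2 / 2)) := by
    unfold mgf
    simp only [hexp]
    rw [integral_const_mul, Real.exp_add, hprod, Real.exp_sum]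
    refine congrArg _ (Finset.prod_congr rfl fun i _ => ?_)
    rw [Real.exp_sum]
    refine Finset.prod_congr rfl fun j _ => ?_
    exact congrFun (mgf_fun_id_gaussianReal (μ := M i j) (v := v i j)) (l i j)
  have hint' : Integrable (fun θ : Fin k → Fin n → ℝ =>
      Real.exp (1 * (c + ∑ i, ∑ j, l i j * θ i j))) (gaussPi M v) := by
    simp only [hexp]; exact hint.const_mul _
  have h := measure_ge_le_exp_mul_mgf (μ := gaussPi M v) 0 zero_le_one hint'
  rw [hmgf, mul_zero, Real.exp_zero, one_mul] at h
  exact h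

lemma gaussPi_box_ge {S : Fin k → Fin n → Set ℝ} {C : Fin k → Fin n → ℝ}
    (h : ∀ i j, Real.exp (-C i j) ≤ (gaussianReal (M i j) (v i j)).real (S i j)) :
    Real.exp (-∑ i, ∑ j, C i j) ≤ (gaussPi M v).real {θ | ∀ i j, θ i j ∈ S i j} := by
  have hset : {θ : Fin k → Fin n → ℝ | ∀ i j, θ i j ∈ S i j} =
      Set.pi univ fun i => Set.pi univ fun j => S i j := by
    ext θ; simp [Set.mem_pi]
  rw [hset, measureReal_def, gaussPi, Measure.pi_pi, ENNReal.toReal_prod, ← Finset.sum_neg_distrib,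
    Real.exp_sum]
  refine Finset.prod_le_prod (fun i _ => (Real.exp_pos _).le) fun i _ => ?_
  rw [Measure.pi_pi, ENNReal.toReal_prod, ← Finset.sum_neg_distrib, Real.exp_sum]
  exact Finset.prod_le_prod (fun j _ => (Real.exp_pos _).le) fun j _ => h i j

end gaussPi

/-- The negative logarithm of a lower bound of the probability that a Gaussian variable with
variance `v` exceeds its mean by `d ≥ 0`. -/
def tailCost (d v : ℝ) : ℝ := (d / √v + 1) ^ 2 / 2 + Real.log (√(2 * Real.pi))

/-- With `y = max x μ`, the interval from `y` to `y + √v` lies to the right of the mean, where the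
density decreases, so its mass is at least `√v` times the density at the right endpoint. The factor
`√v` cancels the normalization up to `√(2π)`. -/
lemma gaussianReal_Ioi_ge (μ : ℝ) {v : ℝ≥0} (hv : v ≠ 0) (x : ℝ) :
    Real.exp (-tailCost (max (x - μ) 0) v) ≤ (gaussianReal μ v).real (Ioi x) := by
  have hv0 : (0 : ℝ) < v := by exact_mod_cast pos_iff_ne_zero.2 hv
  have hs : 0 < √(v : ℝ) := Real.sqrt_pos.2 hv0
  set y := max x μ with hy
  have hyμ : max (x - μ) 0 = y - μ := by
    rw [hy, ← max_sub_sub_right, sub_self]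
  have hle : (gaussianReal μ v).real (Ioc y (y + √v)) ≤ (gaussianReal μ v).real (Ioi x) :=
    measureReal_mono fun z hz => lt_of_le_of_lt (le_max_left _ _) hz.1
  refine le_trans ?_ hle
  rw [measureReal_def, gaussianReal_apply_eq_integral μ hv, ENNReal.toReal_ofReal
    (setIntegral_nonneg measurableSet_Ioc fun z _ => gaussianPDFReal_nonneg μ v z)]
  have hconst : ∫ z in Ioc y (y + √v), gaussianPDFReal μ v (y + √v) ≤
      ∫ z in Ioc y (y + √v), gaussianPDFReal μ v z := by
    refine setIntegral_mono_on (integrable_const _) (integrable_gaussianPDFReal μ v).integrableOn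
      measurableSet_Ioc fun z hz => ?_
    have h1 : μ ≤ z := (le_max_right x μ).trans hz.1.le
    have h2 := hz.2
    unfold gaussianPDFReal
    have : (z - μ) ^ 2 ≤ (y + √v - μ) ^ 2 := by
      apply pow_le_pow_left₀ <;> linarith
    gcongr
  refine le_trans (le_of_eq ?_) hconst
  rw [setIntegral_const, measureReal_def, Real.volume_Ioc, ENNReal.toReal_ofReal (by linarith),
    smul_eq_mul, hyμ, tailCost, neg_add, Real.exp_add, Real.exp_neg (Real.log _),
    Real.exp_log (by positivity), gaussianPDFReal,
    Real.sqrt_mul (x := 2 * Real.pi) (by positivity), add_sub_cancel_left]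
  have : -(y + √↑v - μ) ^ 2 / (2 * ↑v) = -(((y - μ) / √v + 1) ^ 2 / 2) := by
    have hsq : √(v : ℝ) ^ 2 = v := Real.sq_sqrt hv0.le
    rw [← hsq]
    field_simp
    ring_nf
    rw [Real.sqrt_sq hs.le]
    ring
  rw [this]
  field_simp

lemma gaussianReal_Iio_ge (μ : ℝ) {v : ℝ≥0} (hv : v ≠ 0) (x : ℝ) :
    Real.exp (-tailCost (max (μ - x) 0) v) ≤ (gaussianReal μ v).real (Iio x) := by
  have h := gaussianReal_Ioi_ge (-μ) hv (-x)
  rw [← gaussianReal_map_neg, map_measureReal_apply measurable_neg measurableSet_Ioi] at h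
  convert h using 2
  · rw [neg_sub_neg]
  · ext z; simp

lemma gaussianReal_Iic_ge (μ : ℝ) {v : ℝ≥0} (hv : v ≠ 0) (x : ℝ) :
    Real.exp (-tailCost (max (μ - x) 0) v) ≤ (gaussianReal μ v).real (Iic x) :=
  (gaussianReal_Iio_ge μ hv x).trans (measureReal_mono Iio_subset_Iic_self)

/-! ### Posterior probabilities of the failure events -/

namespace Problem

variable {k m : ℕ} (ν : Problem k m) {s : Fin k}

/-- The posterior with sample means `M` and sample sizes `N`. -/
def gaussPost (M : Fin k → Fin (m + 1) → ℝ) (N : Fin k → ℕ) :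
    Measure (Fin k → Fin (m + 1) → ℝ) :=
  gaussPi M fun i j => ν.var i j / (N i : ℝ≥0)

instance (M : Fin k → Fin (m + 1) → ℝ) (N : Fin k → ℕ) :
    IsProbabilityMeasure (ν.gaussPost M N) := by
  unfold gaussPost; infer_instance

variable {ν} {M : Fin k → Fin (m + 1) → ℝ} {N : Fin k → ℕ}

/-- The minimum of `-(t * x) + v * t ^ 2 / 2` over `t ≥ 0` is attained at `t = max x 0 / v`. This is
the optimal tilt in each of the Chernoff bounds. -/
lemma neg_mul_max_add (x : ℝ) {v : ℝ} (hv : 0 < v) :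
    -(max x 0 / v * x) + v * (max x 0 / v) ^ 2 / 2 = -((max x 0) ^ 2 / (2 * v)) := by
  have : max x 0 * x = max x 0 ^ 2 := by
    rcases le_total x 0 with h | h
    · simp [h]
    · rw [max_eq_left h]; ring
  field_simp
  linear_combination (-2) * this

/-- Upper bound of the posterior probability that arm `i` is feasible and at least as good as
arm `s`. -/
lemma gaussPost_beat_le (hN : ∀ i, 0 < N i) {i : Fin k} (hi : i ≠ s) :
    (ν.gaussPost M N).real {θ | θ s 0 ≤ θ i 0 ∧ ν.FeasibleAt θ i} ≤
      Real.exp (-ν.exponent s M (N s) (N i) i) := by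
  have hNi : (0 : ℝ) < N i := by exact_mod_cast hN i
  have hNs : (0 : ℝ) < N s := by exact_mod_cast hN s
  have hvi : ∀ j, (0 : ℝ) < ν.var i j / N i := fun j => div_pos (ν.var_pos' i j) hNi
  have hvs : ∀ j, (0 : ℝ) < ν.var s j / N s := fun j => div_pos (ν.var_pos' s j) hNs
  -- The tilts are gap over variance: for `θ i 0 - θ s 0`, whose variance is the sum of the two, and
  -- for each constraint. They are truncated at zero because only a nonnegative combination of the
  -- defining inequalities holds on the event.
  set t := max (M s 0 - M i 0) 0 / (ν.var i 0 / N i + ν.var s 0 / N s) with ht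
  have ht0 : 0 ≤ t := div_nonneg (le_max_right _ _) (add_pos (hvi 0) (hvs 0)).le
  set c : Fin m → ℝ := fun j => max (M i j.succ - ν.thr j) 0 / (ν.var i j.succ / N i) with hc
  have hc0 : ∀ j, 0 ≤ c j := fun j => div_nonneg (le_max_right _ _) (hvi _).le
  set l : Fin k → Fin (m + 1) → ℝ := fun i' => if i' = s then Fin.cons (-t) (fun _ => 0)
    else if i' = i then Fin.cons t (fun j => -c j) else 0 with hl
  have hls : l s = Fin.cons (-t) (fun _ => 0) := by simp [hl]
  have hli : l i = Fin.cons t (fun j => -c j) := by simp [hl, hi]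
  have hlo : ∀ x, x ≠ i ∧ x ≠ s → l x = 0 := fun x hx => by simp [hl, hx.1, hx.2]
  refine le_trans ?_ ((gaussPi_chernoff (M := M) (v := fun i j => ν.var i j / (N i : ℝ≥0))
    (∑ j, c j * ν.thr j) l).trans (le_of_eq ?_))
  · refine measureReal_mono fun θ hθ => ?_
    simp only [mem_ofPred_eq]
    rw [Fintype.sum_eq_add i s hi (fun x hx => by simp [hlo x hx]), hls, hli]
    simp only [Fin.sum_univ_succ, Fin.cons_zero, Fin.cons_succ]
    have h1 : 0 ≤ t * (θ i 0 - θ s 0) := mul_nonneg ht0 (by linarith [hθ.1])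
    have h2 : 0 ≤ ∑ j, c j * (ν.thr j - θ i j.succ) :=
      Finset.sum_nonneg fun j _ => mul_nonneg (hc0 j) (by linarith [hθ.2 j])
    simp only [mul_sub, Finset.sum_sub_distrib] at h2
    simp only [neg_mul, Finset.sum_neg_distrib, zero_mul, Finset.sum_const_zero]
    linarith
  · congr 1
    rw [Fintype.sum_eq_add i s hi (fun x hx => by simp [hlo x hx]), hls, hli]
    simp only [Fin.sum_univ_succ, Fin.cons_zero, Fin.cons_succ, NNReal.coe_div, NNReal.coe_natCast]
    have h1 : -ν.exponent s M (N s) (N i) i =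
        -(max (M s 0 - M i 0) 0 ^ 2 / (2 * (ν.var i 0 / N i + ν.var s 0 / N s))) +
        ∑ j : Fin m, -(max (M i j.succ - ν.thr j) 0 ^ 2 / (2 * (ν.var i j.succ / N i))) := by
      unfold exponent
      rw [pairRate_eq hNi hNs, neg_add, Finset.mul_sum, ← Finset.sum_neg_distrib]
      congr 1
      · have := add_pos (hvi 0) (hvs 0)
        rw [neg_inj, div_mul_div_comm, mul_one]
      · refine Finset.sum_congr rfl fun j _ => ?_
        have := ν.var_pos' i j.succ
        field_simp
    rw [h1, ← neg_mul_max_add _ (add_pos (hvi 0) (hvs 0))]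
    simp_rw [← fun j : Fin m => neg_mul_max_add (M i j.succ - ν.thr j) (hvi j.succ)]
    simp only [← ht]
    have h2 : ∀ j : Fin m, max (M i j.succ - ν.thr j) 0 / (↑(ν.var i j.succ) / ↑(N i)) = c j :=
      fun j => rfl
    simp only [h2]
    simp only [mul_neg, mul_sub, neg_sub, Finset.sum_add_distrib, Finset.sum_sub_distrib,
      Finset.sum_neg_distrib, mul_zero, neg_sq, ne_eq, OfNat.ofNat_ne_zero, not_false_eq_true,
      zero_pow, zero_div, Finset.sum_const_zero, add_zero]
    simp only [mul_comm (M i _) (c _)]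
    ring

/-- Upper bound of the posterior probability that arm `s` violates constraint `j`. -/
lemma gaussPost_violate_le (hN : ∀ i, 0 < N i) (j : Fin m) :
    (ν.gaussPost M N).real {θ | ν.thr j < θ s j.succ} ≤
      Real.exp (-ν.conExponent s M (N s) j) := by
  have hNs : (0 : ℝ) < N s := by exact_mod_cast hN s
  have hvs : (0 : ℝ) < ν.var s j.succ / N s := div_pos (ν.var_pos' s j.succ) hNs
  set t := max (ν.thr j - M s j.succ) 0 / (ν.var s j.succ / N s) with ht
  have ht0 : 0 ≤ t := div_nonneg (le_max_right _ _) hvs.le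
  set l : Fin k → Fin (m + 1) → ℝ := Pi.single s (Pi.single j.succ t) with hl
  have hls : ∀ F : ℝ → Fin k → Fin (m + 1) → ℝ, (∀ i j, F 0 i j = 0) →
      ∑ i, ∑ j, F (l i j) i j = F t s j.succ := by
    intro F hF
    rw [Fintype.sum_eq_single s (fun x hx => by simp [hl, hx, hF]),
      Fintype.sum_eq_single j.succ (fun x hx => by simp [hl, hx, hF])]
    simp [hl]
  refine le_trans ?_ ((gaussPi_chernoff (M := M) (v := fun i j => ν.var i j / (N i : ℝ≥0)) (-(t * ν.thr j)) l).trans (le_of_eq ?_))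
  · refine measureReal_mono fun θ hθ => ?_
    simp only [mem_ofPred_eq] at hθ ⊢
    rw [hls (fun x i j => x * θ i j) (by simp)]
    have h1 : 0 ≤ t * (θ s j.succ - ν.thr j) := mul_nonneg ht0 (by linarith)
    linarith
  · congr 1
    rw [hls (fun x i j => M i j * x + ((ν.var i j / (N i : ℝ≥0) : ℝ≥0) : ℝ) * x ^ 2 / 2)
      (by simp)]
    have h1 : -ν.conExponent s M (N s) j =
        -(max (ν.thr j - M s j.succ) 0 ^ 2 / (2 * (ν.var s j.succ / N s))) := by
      unfold conExponent
      have := ν.var_pos' s j.succ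
      field_simp
    rw [h1, ← neg_mul_max_add _ hvs, ← ht, NNReal.coe_div, NNReal.coe_natCast]
    ring

/-- The posterior variances. -/
abbrev postVar (ν : Problem k m) (N : Fin k → ℕ) (i : Fin k) (j : Fin (m + 1)) : ℝ :=
  ν.var i j / N i

lemma postVar_ne_zero (hN : ∀ i, 0 < N i) (i : Fin k) (j : Fin (m + 1)) :
    ν.var i j / (N i : ℝ≥0) ≠ 0 :=
  div_ne_zero (ν.var_pos i j).ne' (by exact_mod_cast (hN i).ne')

/-- Lower bound of the posterior probability that arm `i` is feasible and better than arm `s`, for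
any level `x` that is meant to separate the two. -/
lemma gaussPost_beat_ge (hN : ∀ i, 0 < N i) {i : Fin k} (hi : i ≠ s) (x : ℝ) :
    Real.exp (-(tailCost (max (x - M i 0) 0) (ν.postVar N i 0) +
        ∑ j : Fin m, tailCost (max (M i j.succ - ν.thr j) 0) (ν.postVar N i j.succ) +
        tailCost (max (M s 0 - x) 0) (ν.postVar N s 0))) ≤
      (ν.gaussPost M N).real {θ | θ s 0 < θ i 0 ∧ ν.FeasibleAt θ i} := by
  -- The box requires `θ s 0 < x < θ i 0` and the feasibility of `i`. By independence the costs add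
  -- up, and free coordinates cost nothing.
  set S : Fin k → Fin (m + 1) → Set ℝ := fun i' => if i' = s then Fin.cons (Iio x) (fun _ => univ)
    else if i' = i then Fin.cons (Ioi x) (fun j => Iic (ν.thr j)) else fun _ => univ with hS
  set C : Fin k → Fin (m + 1) → ℝ := fun i' =>
    if i' = s then Fin.cons (tailCost (max (M s 0 - x) 0) (ν.postVar N s 0)) (fun _ => 0)
    else if i' = i then Fin.cons (tailCost (max (x - M i 0) 0) (ν.postVar N i 0))
      (fun j => tailCost (max (M i j.succ - ν.thr j) 0) (ν.postVar N i j.succ))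
    else 0 with hC
  have hlo : ∀ x, x ≠ i ∧ x ≠ s → C x = 0 := fun x hx => by simp [hC, hx.1, hx.2]
  have hCs : C s = Fin.cons (tailCost (max (M s 0 - x) 0) (ν.postVar N s 0)) (fun _ => 0) := by
    simp [hC]
  have hCi : C i = Fin.cons (tailCost (max (x - M i 0) 0) (ν.postVar N i 0))
      (fun j => tailCost (max (M i j.succ - ν.thr j) 0) (ν.postVar N i j.succ)) := by
    simp [hC, hi]
  have hbox := gaussPi_box_ge (M := M) (v := fun i j => ν.var i j / (N i : ℝ≥0)) (S := S) (C := C)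
    (by
      intro i' j
      have hv := postVar_ne_zero (ν := ν) hN i' j
      simp only [hS, hC]
      split_ifs with h1 h2
      · subst h1
        refine Fin.cases ?_ (fun j => ?_) j
        · simpa using gaussianReal_Iio_ge (M i' 0) (postVar_ne_zero (ν := ν) hN i' 0) x
        · simp
      · subst h2
        refine Fin.cases ?_ (fun j => ?_) j
        · simpa using gaussianReal_Ioi_ge (M i' 0) (postVar_ne_zero (ν := ν) hN i' 0) x
        · simpa using gaussianReal_Iic_ge (M i' j.succ)
            (postVar_ne_zero (ν := ν) hN i' j.succ) (ν.thr j)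
      · simp)
  refine le_trans (le_of_eq ?_) (hbox.trans (measureReal_mono fun θ hθ => ?_))
  · congr 2
    rw [Fintype.sum_eq_add i s hi (fun x hx => by simp [hlo x hx]), hCi, hCs]
    simp [Fin.sum_univ_succ]
  · have h1 := hθ s 0
    have h2 := hθ i 0
    simp only [hS, if_true, Fin.cons_zero, mem_Iio] at h1
    simp only [hS, hi, if_true, if_false, Fin.cons_zero, mem_Ioi] at h2
    refine ⟨h1.trans h2, fun j => ?_⟩
    have h3 := hθ i j.succ
    simpa [hS, hi] using h3

/-- Lower bound of the posterior probability that arm `s` violates constraint `j`. -/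
lemma gaussPost_violate_ge (hN : ∀ i, 0 < N i) (j : Fin m) :
    Real.exp (-tailCost (max (ν.thr j - M s j.succ) 0) (ν.postVar N s j.succ)) ≤
      (ν.gaussPost M N).real {θ | ν.thr j < θ s j.succ} := by
  have hbox := gaussPi_box_ge (M := M) (v := fun i j => ν.var i j / (N i : ℝ≥0))
    (S := fun i' j' => if i' = s ∧ j' = j.succ then Ioi (ν.thr j) else univ)
    (C := fun i' j' => if i' = s ∧ j' = j.succ then
      tailCost (max (ν.thr j - M s j.succ) 0) (ν.postVar N s j.succ) else 0)
    (by
      intro i' j'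
      split_ifs with h
      · obtain ⟨rfl, rfl⟩ := h
        simpa using gaussianReal_Ioi_ge (M i' j.succ)
          (postVar_ne_zero (ν := ν) hN i' j.succ) (ν.thr j)
      · simp)
  refine le_trans (le_of_eq ?_) (hbox.trans (measureReal_mono fun θ hθ => ?_))
  · congr 2
    simp [ite_and]
  · simpa using hθ s j.succ

/-- Lower bound of the posterior probability that arm `i` is feasible and all other arms are worse,
for any level `x`. -/
lemma gaussPost_win_ge (hN : ∀ i, 0 < N i) (i : Fin k) (x : ℝ) :
    Real.exp (-∑ i', if i' = i then tailCost (max (x - M i 0) 0) (ν.postVar N i 0) +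
        ∑ j : Fin m, tailCost (max (M i j.succ - ν.thr j) 0) (ν.postVar N i j.succ)
        else tailCost (max (M i' 0 - x) 0) (ν.postVar N i' 0)) ≤
      (ν.gaussPost M N).real {θ | ν.FeasibleAt θ i ∧ ∀ i', i' ≠ i → θ i' 0 < θ i 0} := by
  -- The other arms are kept below `x` in the objective, whether or not they are feasible.
  have hbox := gaussPi_box_ge (M := M) (v := fun i j => ν.var i j / (N i : ℝ≥0))
    (S := fun i' => if i' = i then Fin.cons (Ioi x) (fun j => Iic (ν.thr j))
      else Fin.cons (Iio x) (fun _ => univ))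
    (C := fun i' => if i' = i then Fin.cons (tailCost (max (x - M i 0) 0) (ν.postVar N i 0))
        (fun j => tailCost (max (M i j.succ - ν.thr j) 0) (ν.postVar N i j.succ))
      else Fin.cons (tailCost (max (M i' 0 - x) 0) (ν.postVar N i' 0)) (fun _ => 0))
    (by
      intro i' j
      split_ifs with h
      · subst h
        refine Fin.cases ?_ (fun j => ?_) j
        · simpa using gaussianReal_Ioi_ge (M i' 0) (postVar_ne_zero (ν := ν) hN i' 0) x
        · simpa using gaussianReal_Iic_ge (M i' j.succ)
            (postVar_ne_zero (ν := ν) hN i' j.succ) (ν.thr j)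
      · refine Fin.cases ?_ (fun j => ?_) j
        · simpa using gaussianReal_Iio_ge (M i' 0) (postVar_ne_zero (ν := ν) hN i' 0) x
        · simp)
  refine le_trans (le_of_eq ?_) (hbox.trans (measureReal_mono fun θ hθ => ?_))
  · congr 2
    refine Finset.sum_congr rfl fun i' _ => ?_
    split_ifs <;> simp [Fin.sum_univ_succ]
  · have h2 := hθ i 0
    simp only [if_true, Fin.cons_zero, mem_Ioi] at h2
    refine ⟨fun j => ?_, fun i' hi' => ?_⟩
    · have h3 := hθ i j.succ
      simpa using h3
    · have h1 := hθ i' 0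
      simp only [hi', if_false, Fin.cons_zero, mem_Iio] at h1
      exact h1.trans h2

end Problem

/-! ### Probabilities of the candidates and of the pulls -/

namespace Problem

variable {k m : ℕ} {ν : Problem k m} {s : Fin k}

lemma measurableSet_feasibleAt (i : Fin k) :
    MeasurableSet {θ : Fin k → Fin (m + 1) → ℝ | ν.FeasibleAt θ i} := by
  have : {θ : Fin k → Fin (m + 1) → ℝ | ν.FeasibleAt θ i} =
      ⋂ j : Fin m, {θ | θ i j.succ ≤ ν.thr j} := by
    ext; simp [FeasibleAt]
  rw [this]
  exact MeasurableSet.iInter fun j => measurableSet_le (by fun_prop) measurable_const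

lemma measurableSet_best (s : Fin k) : MeasurableSet {θ : Fin k → Fin (m + 1) → ℝ |
    (∀ i, i ≠ s → ¬ (θ s 0 < θ i 0 ∧ ν.FeasibleAt θ i)) ∧ ν.FeasibleAt θ s} := by
  have : {θ : Fin k → Fin (m + 1) → ℝ |
      (∀ i, i ≠ s → ¬ (θ s 0 < θ i 0 ∧ ν.FeasibleAt θ i)) ∧ ν.FeasibleAt θ s} =
      (⋂ i : Fin k, ⋂ _ : i ≠ s, ({θ | θ s 0 < θ i 0} ∩ {θ | ν.FeasibleAt θ i})ᶜ) ∩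
        {θ | ν.FeasibleAt θ s} := by
    ext; simp
  rw [this]
  exact (MeasurableSet.iInter fun i => MeasurableSet.iInter fun _ =>
    ((measurableSet_lt (by fun_prop) (by fun_prop)).inter
      (measurableSet_feasibleAt i)).compl).inter (measurableSet_feasibleAt s)

section

variable (ν) (Q : Measure (Fin k → Fin (m + 1) → ℝ))

/-- The probability that arm `i` is feasible and at least as good as arm `s`. -/
def beatProb (s i : Fin k) : ℝ := Q.real {θ | θ s 0 ≤ θ i 0 ∧ ν.FeasibleAt θ i}

/-- The sum of the probabilities that arm `s` violates a constraint. -/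
def violateProb (s : Fin k) : ℝ := ∑ j : Fin m, Q.real {θ | ν.thr j < θ s j.succ}

end

variable {Q : Measure (Fin k → Fin (m + 1) → ℝ)}

lemma measureReal_infeasible_le : Q.real {θ | ¬ ν.FeasibleAt θ s} ≤ ν.violateProb Q s := by
  have : {θ : Fin k → Fin (m + 1) → ℝ | ¬ ν.FeasibleAt θ s} =
      ⋃ j ∈ (Finset.univ : Finset (Fin m)), {θ | ν.thr j < θ s j.succ} := by
    ext; simp [FeasibleAt]
  rw [this]
  exact measureReal_biUnion_finset_le _ _

section isProbabilityMeasure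

variable [IsProbabilityMeasure Q]

lemma one_sub_bestProb : 1 - ν.bestProb Q s = Q.real {θ | (∀ i, i ≠ s →
    ¬ (θ s 0 < θ i 0 ∧ ν.FeasibleAt θ i)) ∧ ν.FeasibleAt θ s}ᶜ := by
  rw [probReal_compl_eq_one_sub (measurableSet_best s)]; rfl

lemma beat_le_one_sub_bestProb {i : Fin k} (hi : i ≠ s) :
    Q.real {θ | θ s 0 < θ i 0 ∧ ν.FeasibleAt θ i} ≤ 1 - ν.bestProb Q s := by
  rw [one_sub_bestProb]
  exact measureReal_mono fun θ hθ h => h.1 i hi hθ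

lemma violate_le_one_sub_bestProb (j : Fin m) :
    Q.real {θ | ν.thr j < θ s j.succ} ≤ 1 - ν.bestProb Q s := by
  rw [one_sub_bestProb]
  exact measureReal_mono fun θ hθ h => (h.2 j).not_gt hθ

lemma one_sub_bestProb_le :
    1 - ν.bestProb Q s ≤ ∑ i ∈ Finset.univ.erase s, ν.beatProb Q s i + ν.violateProb Q s := by
  rw [one_sub_bestProb]
  have hsub : {θ : Fin k → Fin (m + 1) → ℝ | (∀ i, i ≠ s → ¬ (θ s 0 < θ i 0 ∧ ν.FeasibleAt θ i)) ∧
      ν.FeasibleAt θ s}ᶜ ⊆ (⋃ i ∈ Finset.univ.erase s, {θ | θ s 0 ≤ θ i 0 ∧ ν.FeasibleAt θ i}) ∪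
      {θ | ¬ ν.FeasibleAt θ s} := by
    intro θ hθ
    by_contra hcon
    simp only [mem_union, mem_iUnion, not_or, not_exists, mem_ofPred_eq, not_not] at hcon
    refine hθ ⟨fun i hi h => ?_, hcon.2⟩
    exact hcon.1 i (Finset.mem_erase.2 ⟨hi, Finset.mem_univ i⟩) ⟨h.1.le, h.2⟩
  refine (measureReal_mono hsub).trans ((measureReal_union_le _ _).trans ?_)
  exact add_le_add (measureReal_biUnion_finset_le _ _) measureReal_infeasible_le

end isProbabilityMeasure

/-! ### The selection probabilities -/

section selectProb

variable (θ : Fin k → Fin (m + 1) → ℝ)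

lemma mem_feasibleSet {i : Fin k} : i ∈ ν.feasibleSet θ ↔ ν.FeasibleAt θ i := by
  simp [feasibleSet]

lemma mem_argmaxSet {i : Fin k} : i ∈ ν.argmaxSet θ ↔
    ν.FeasibleAt θ i ∧ ∀ i', ν.FeasibleAt θ i' → θ i' 0 ≤ θ i 0 := by
  simp [argmaxSet, mem_feasibleSet]

lemma argmaxSet_nonempty (h : (ν.feasibleSet θ).Nonempty) : (ν.argmaxSet θ).Nonempty := by
  obtain ⟨i, hi, hmax⟩ := Finset.exists_max_image _ (fun i => θ i 0) h
  exact ⟨i, by simpa [argmaxSet] using ⟨hi, hmax⟩⟩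

lemma selectProb_nonneg (i : Fin k) : 0 ≤ ν.selectProb θ i := by
  unfold selectProb; split_ifs <;> positivity

lemma sum_selectProb (hk : 0 < k) : ∑ i, ν.selectProb θ i = 1 := by
  unfold selectProb
  by_cases h : (ν.feasibleSet θ).Nonempty
  · have hc : ((ν.argmaxSet θ).card : ℝ) ≠ 0 := by
      exact_mod_cast (argmaxSet_nonempty θ h).card_pos.ne'
    simp [h, hc]
  · have : (k : ℝ) ≠ 0 := by exact_mod_cast hk.ne'
    simp [h, this]

lemma selectProb_le_one (hk : 0 < k) (i : Fin k) : ν.selectProb θ i ≤ 1 := by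
  rw [← sum_selectProb (ν := ν) θ hk]
  exact Finset.single_le_sum (fun i _ => selectProb_nonneg θ i) (Finset.mem_univ i)

lemma measurable_selectProb (i : Fin k) :
    Measurable fun θ : Fin k → Fin (m + 1) → ℝ => ν.selectProb θ i := by
  -- The selection depends on `θ` only through the feasible set and the set of maximizers, which
  -- take finitely many values; every function of these two sets is measurable for the discrete
  -- sigma algebra.
  let _ : MeasurableSpace (Finset (Fin k)) := ⊤
  have hpre : ∀ (f : (Fin k → Fin (m + 1) → ℝ) → Finset (Fin k)),
      (∀ i, MeasurableSet {θ | i ∈ f θ}) → Measurable f := by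
    intro f hf
    refine measurable_to_countable' fun S => ?_
    have : f ⁻¹' {S} = ⋂ i : Fin k, if i ∈ S then {θ | i ∈ f θ} else {θ | i ∈ f θ}ᶜ := by
      ext θ
      simp only [mem_preimage, mem_singleton_iff, Finset.ext_iff, mem_iInter]
      refine forall_congr' fun i => ?_
      by_cases h : i ∈ S <;> simp [h]
    rw [this]
    refine MeasurableSet.iInter fun i => ?_
    split_ifs
    · exact hf i
    · exact (hf i).compl
  have h1 : Measurable fun θ : Fin k → Fin (m + 1) → ℝ => ν.feasibleSet θ :=
    hpre _ fun i => by simpa only [mem_feasibleSet] using measurableSet_feasibleAt i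
  have h2 : Measurable fun θ : Fin k → Fin (m + 1) → ℝ => ν.argmaxSet θ := by
    refine hpre _ fun i => ?_
    have : {θ : Fin k → Fin (m + 1) → ℝ | i ∈ ν.argmaxSet θ} = {θ | ν.FeasibleAt θ i} ∩
        ⋂ i' : Fin k, ({θ | ν.FeasibleAt θ i'}ᶜ ∪ {θ | θ i' 0 ≤ θ i 0}) := by
      ext θ
      simp only [mem_ofPred_eq, mem_argmaxSet, mem_inter_iff, mem_iInter, mem_union, mem_compl_iff,
        imp_iff_not_or]
    rw [this]
    exact (measurableSet_feasibleAt i).inter (MeasurableSet.iInter fun i' =>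
      (measurableSet_feasibleAt i').compl.union (measurableSet_le (by fun_prop) (by fun_prop)))
  classical
  have h3 : Measurable fun p : Finset (Fin k) × Finset (Fin k) =>
      (if p.1.Nonempty then (if i ∈ p.2 then 1 / (p.2.card : ℝ) else 0) else 1 / (k : ℝ)) :=
    measurable_of_countable _
  convert h3.comp (h1.prodMk h2) using 2 with θ
  simp only [selectProb, Function.comp]

end selectProb

lemma candidateProb_nonneg (i : Fin k) : 0 ≤ ν.candidateProb Q i :=
  integral_nonneg fun θ => selectProb_nonneg θ i

lemma secondProb_self (i : Fin k) : ν.secondProb Q i i = 0 := by simp [secondProb]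

variable {β : ℝ}

lemma secondProb_nonneg (i₁ i : Fin k) : 0 ≤ ν.secondProb Q i₁ i := by
  unfold secondProb
  split_ifs
  · rfl
  · exact tsum_nonneg fun r => mul_nonneg (pow_nonneg (candidateProb_nonneg _) _)
      (candidateProb_nonneg _)

lemma pullProb_eq (i : Fin k) : ν.pullProb β Q i = β * ν.candidateProb Q i +
    (1 - β) * ∑ i₁ ∈ Finset.univ.erase i, ν.candidateProb Q i₁ * ν.secondProb Q i₁ i := by
  unfold pullProb
  rw [← Finset.add_sum_erase _ _ (Finset.mem_univ i), secondProb_self, Finset.mul_sum]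
  congr 1
  · simp; ring
  · refine Finset.sum_congr rfl fun i₁ hi₁ => ?_
    rw [if_neg (Finset.ne_of_mem_erase hi₁).symm]
    ring

lemma le_pullProb (hβ : β ∈ Ioo (0 : ℝ) 1) (i : Fin k) :
    β * ν.candidateProb Q i ≤ ν.pullProb β Q i := by
  rw [pullProb_eq]
  refine le_add_of_nonneg_right (mul_nonneg (by linarith [hβ.2]) (Finset.sum_nonneg fun i₁ _ => ?_))
  exact mul_nonneg (candidateProb_nonneg _) (secondProb_nonneg _ _)

variable [IsProbabilityMeasure Q]

lemma integrable_selectProb (hk : 0 < k) (i : Fin k) :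
    Integrable (fun θ => ν.selectProb θ i) Q :=
  Integrable.of_bound (measurable_selectProb i).aestronglyMeasurable 1 (ae_of_all _ fun θ => by
    rw [Real.norm_eq_abs, abs_of_nonneg (selectProb_nonneg θ i)]
    exact selectProb_le_one θ hk i)

lemma sum_candidateProb (hk : 0 < k) : ∑ i, ν.candidateProb Q i = 1 := by
  unfold candidateProb
  rw [← integral_finsetSum _ fun i _ => integrable_selectProb hk i]
  simp [sum_selectProb _ hk]

lemma candidateProb_add_sum (hk : 0 < k) (s : Fin k) :
    ν.candidateProb Q s + ∑ i ∈ Finset.univ.erase s, ν.candidateProb Q i = 1 := by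
  rw [Finset.add_sum_erase _ _ (Finset.mem_univ s), sum_candidateProb hk]

lemma candidateProb_add_le (hk : 0 < k) {i l : Fin k} (h : i ≠ l) :
    ν.candidateProb Q i + ν.candidateProb Q l ≤ 1 := by
  rw [← candidateProb_add_sum (ν := ν) (Q := Q) hk l, add_comm]
  gcongr
  exact Finset.single_le_sum (fun i _ => candidateProb_nonneg i)
    (Finset.mem_erase.2 ⟨h, Finset.mem_univ i⟩)

lemma candidateProb_le_one (hk : 0 < k) (i : Fin k) : ν.candidateProb Q i ≤ 1 := by
  rw [← sum_candidateProb (ν := ν) (Q := Q) hk]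
  exact Finset.single_le_sum (fun i _ => candidateProb_nonneg i) (Finset.mem_univ i)

/-- When `s` is feasible, `l` can be selected only if it is feasible and at least as good as `s`.
The second summand also covers the uniform choice made when no arm is feasible. -/
lemma candidateProb_le (hk : 0 < k) {l : Fin k} :
    ν.candidateProb Q l ≤ ν.beatProb Q s l + ν.violateProb Q s := by
  have hm1 : MeasurableSet {θ : Fin k → Fin (m + 1) → ℝ | θ s 0 ≤ θ l 0 ∧ ν.FeasibleAt θ l} := by
    have : {θ : Fin k → Fin (m + 1) → ℝ | θ s 0 ≤ θ l 0 ∧ ν.FeasibleAt θ l} =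
        {θ | θ s 0 ≤ θ l 0} ∩ {θ | ν.FeasibleAt θ l} := by ext; simp
    rw [this]
    exact (measurableSet_le (by fun_prop) (by fun_prop)).inter (measurableSet_feasibleAt l)
  have hm2 : MeasurableSet {θ : Fin k → Fin (m + 1) → ℝ | ¬ ν.FeasibleAt θ s} :=
    (measurableSet_feasibleAt s).compl
  have hle : ν.candidateProb Q l ≤ Q.real ({θ | θ s 0 ≤ θ l 0 ∧ ν.FeasibleAt θ l} ∪
      {θ | ¬ ν.FeasibleAt θ s}) := by
    rw [← integral_indicator_one (hm1.union hm2)]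
    refine integral_mono (integrable_selectProb hk l)
      ((integrable_const 1).indicator (hm1.union hm2)) fun θ => ?_
    by_cases h : θ ∈ ({θ : Fin k → Fin (m + 1) → ℝ | θ s 0 ≤ θ l 0 ∧ ν.FeasibleAt θ l} ∪
      {θ | ¬ ν.FeasibleAt θ s})
    · rw [indicator_of_mem h]
      exact selectProb_le_one θ hk l
    · rw [indicator_of_notMem h]
      simp only [mem_union, mem_ofPred_eq, not_or, not_not] at h
      have hne : (ν.feasibleSet θ).Nonempty := ⟨s, (mem_feasibleSet θ).2 h.2⟩
      have : l ∉ ν.argmaxSet θ := fun hl => by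
        rw [mem_argmaxSet] at hl
        exact h.1 ⟨hl.2 s h.2, hl.1⟩
      simp [selectProb, hne, this]
  refine hle.trans ((measureReal_union_le _ _).trans ?_)
  gcongr
  · exact le_rfl
  · exact measureReal_infeasible_le

/-- If `s` is not best under `θ`, it is selected with probability zero when some arm is feasible,
and `1 / k ≤ 1 / 2` otherwise. The factor `2` pays for the uniform choice. -/
lemma one_sub_bestProb_le_candidate (hk : 2 ≤ k) :
    (1 - ν.bestProb Q s) / 2 ≤ 1 - ν.candidateProb Q s := by
  have hm := (measurableSet_best (ν := ν) s).compl
  have h1 : ν.candidateProb Q s ≤ ∫ θ, (1 - (1 / 2) * ({θ : Fin k → Fin (m + 1) → ℝ |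
      (∀ i, i ≠ s → ¬ (θ s 0 < θ i 0 ∧ ν.FeasibleAt θ i)) ∧
      ν.FeasibleAt θ s}ᶜ).indicator (1 : (Fin k → Fin (m + 1) → ℝ) → ℝ) θ) ∂Q := by
    refine integral_mono (integrable_selectProb (by omega) s) ((integrable_const 1).sub
      (((integrable_const (1 : ℝ)).indicator hm).const_mul _)) fun θ => ?_
    by_cases h : θ ∈ {θ : Fin k → Fin (m + 1) → ℝ |
      (∀ i, i ≠ s → ¬ (θ s 0 < θ i 0 ∧ ν.FeasibleAt θ i)) ∧ ν.FeasibleAt θ s}ᶜ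
    · simp only [indicator_of_mem h, Pi.one_apply]
      unfold selectProb
      split_ifs with h1 h2
      · exfalso
        rw [mem_argmaxSet] at h2
        exact h ⟨fun i _ hi => (h2.2 i hi.2).not_gt hi.1, h2.1⟩
      · norm_num
      · have : (2 : ℝ) ≤ k := by exact_mod_cast hk
        have : 1 / (k : ℝ) ≤ 1 / 2 := by gcongr
        linarith
    · simp only [indicator_of_notMem h, mul_zero, sub_zero]
      exact selectProb_le_one θ (by omega) s
  rw [integral_sub (integrable_const 1) (((integrable_const (1 : ℝ)).indicator (f := 1) hm).const_mul _),
    integral_const_mul, integral_indicator_one hm, ← one_sub_bestProb] at h1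
  simp only [integral_const, probReal_univ, smul_eq_mul, mul_one] at h1
  linarith

lemma le_candidateProb (hk : 0 < k) (i : Fin k) :
    Q.real {θ | ν.FeasibleAt θ i ∧ ∀ i', i' ≠ i → θ i' 0 < θ i 0} ≤ ν.candidateProb Q i := by
  have hm : MeasurableSet {θ : Fin k → Fin (m + 1) → ℝ |
      ν.FeasibleAt θ i ∧ ∀ i', i' ≠ i → θ i' 0 < θ i 0} := by
    have : {θ : Fin k → Fin (m + 1) → ℝ | ν.FeasibleAt θ i ∧ ∀ i', i' ≠ i → θ i' 0 < θ i 0} =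
        {θ | ν.FeasibleAt θ i} ∩ ⋂ i' : Fin k, ⋂ _ : i' ≠ i, {θ | θ i' 0 < θ i 0} := by
      ext; simp
    rw [this]
    exact (measurableSet_feasibleAt i).inter (MeasurableSet.iInter fun i' =>
      MeasurableSet.iInter fun _ => measurableSet_lt (by fun_prop) (by fun_prop))
  rw [← integral_indicator_one hm]
  refine integral_mono ((integrable_const 1).indicator hm) (integrable_selectProb hk i) fun θ => ?_
  by_cases h : θ ∈ {θ : Fin k → Fin (m + 1) → ℝ |
      ν.FeasibleAt θ i ∧ ∀ i', i' ≠ i → θ i' 0 < θ i 0}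
  · rw [indicator_of_mem h]
    have hne : (ν.feasibleSet θ).Nonempty := ⟨i, (mem_feasibleSet θ).2 h.1⟩
    have : ν.argmaxSet θ = {i} := by
      ext l
      rw [mem_argmaxSet, Finset.mem_singleton]
      constructor
      · rintro ⟨-, h2⟩
        by_contra hl
        exact (h2 i h.1).not_gt (h.2 l hl)
      · rintro rfl
        refine ⟨h.1, fun i' _ => ?_⟩
        rcases eq_or_ne i' l with rfl | hne
        · rfl
        · exact (h.2 i' hne).le
    simp [selectProb, hne, this]
  · rw [indicator_of_notMem h]
    exact selectProb_nonneg θ i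

/-! ### The pulling probabilities -/

/-- This is the geometric series of the repeated draws. If `i₁` is drawn with probability one, all
terms vanish, in agreement with the default value of the quotient. -/
lemma secondProb_eq (hk : 0 < k) {i₁ i : Fin k} (h : i ≠ i₁) :
    ν.secondProb Q i₁ i = ν.candidateProb Q i / (1 - ν.candidateProb Q i₁) := by
  unfold secondProb
  rw [if_neg h, tsum_mul_right]
  rcases (candidateProb_le_one (ν := ν) (Q := Q) hk i₁).lt_or_eq with h1 | h1
  · rw [tsum_geometric_of_lt_one (candidateProb_nonneg _) h1]
    ring
  · have h2 := candidateProb_add_le (ν := ν) (Q := Q) hk h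
    have h3 := candidateProb_nonneg (ν := ν) (Q := Q) i
    have : ν.candidateProb Q i = 0 := by linarith
    simp [this]

/-- For a first candidate `i₁ ≠ s`, the denominator `1 - candidateProb i₁` is at least
`candidateProb s ≥ 1 / 2`, so the second-candidate probability is at most `2`, a crude bound that
suffices. -/
lemma pullProb_best_le (hk : 0 < k) (hβ : β ∈ Ioo (0 : ℝ) 1) (hs : 1 / 2 ≤ ν.candidateProb Q s) :
    ν.pullProb β Q s ≤ β + 2 * (1 - ν.candidateProb Q s) := by
  have hc := candidateProb_add_sum (ν := ν) (Q := Q) hk s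
  have h1 : ∑ i₁ ∈ Finset.univ.erase s, ν.candidateProb Q i₁ * ν.secondProb Q i₁ s ≤
      ∑ i₁ ∈ Finset.univ.erase s, ν.candidateProb Q i₁ * 2 := by
    refine Finset.sum_le_sum fun i₁ hi₁ => ?_
    have hne := Finset.ne_of_mem_erase hi₁
    refine mul_le_mul_of_nonneg_left ?_ (candidateProb_nonneg _)
    have h2 := candidateProb_add_le (ν := ν) (Q := Q) hk hne
    have h3 := candidateProb_le_one (ν := ν) (Q := Q) hk s
    rw [secondProb_eq hk hne.symm, div_le_iff₀ (by linarith)]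
    linarith
  rw [← Finset.sum_mul] at h1
  have h3 := candidateProb_le_one (ν := ν) (Q := Q) hk s
  have h4 := hβ.1
  have h5 := hβ.2
  rw [pullProb_eq]
  have h6 : β * ν.candidateProb Q s ≤ β := mul_le_of_le_one_right h4.le h3
  have h7 : (1 - β) * ∑ i₁ ∈ Finset.univ.erase s, ν.candidateProb Q i₁ * ν.secondProb Q i₁ s ≤
      1 * (2 * (1 - ν.candidateProb Q s)) := by
    refine mul_le_mul (by linarith) (by linarith) (Finset.sum_nonneg fun i₁ _ =>
      mul_nonneg (candidateProb_nonneg _) (secondProb_nonneg _ _)) zero_le_one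
  linarith

/-- The main contribution has first candidate `s`. A first candidate other than `s` leaves the
denominator at least `1 / 2`, so its conditional probability for `l` is at most twice the ratio. The
constant `4` is not sharp. -/
lemma pullProb_le (hk : 0 < k) (hβ : β ∈ Ioo (0 : ℝ) 1) (hs : 1 / 2 ≤ ν.candidateProb Q s)
    (hs1 : ν.candidateProb Q s < 1) {l : Fin k} (hl : l ≠ s) :
    ν.pullProb β Q l ≤ 4 * (ν.candidateProb Q l / (1 - ν.candidateProb Q s)) := by
  have hcl := candidateProb_nonneg (ν := ν) (Q := Q) l
  have hr : ν.candidateProb Q l ≤ ν.candidateProb Q l / (1 - ν.candidateProb Q s) := by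
    rw [le_div_iff₀ (by linarith)]
    nlinarith
  set r := ν.candidateProb Q l / (1 - ν.candidateProb Q s) with hr'
  have hr0 : 0 ≤ r := hcl.trans hr
  have h1 : ∀ i₁ ∈ Finset.univ.erase l, ν.candidateProb Q i₁ * ν.secondProb Q i₁ l ≤
      ν.candidateProb Q i₁ * (2 * r) := by
    intro i₁ hi₁
    have hne := Finset.ne_of_mem_erase hi₁
    refine mul_le_mul_of_nonneg_left ?_ (candidateProb_nonneg _)
    rw [secondProb_eq hk hne.symm]
    rcases eq_or_ne i₁ s with rfl | h
    · linarith
    · have h2 := candidateProb_add_le (ν := ν) (Q := Q) hk h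
      rw [div_le_iff₀ (by linarith)]
      nlinarith
  have h2 := Finset.sum_le_sum h1
  rw [← Finset.sum_mul] at h2
  have h3 := candidateProb_add_sum (ν := ν) (Q := Q) hk l
  rw [pullProb_eq]
  have h4 := hβ.1
  have h5 := hβ.2
  have h6 : β * ν.candidateProb Q l ≤ 1 * r := mul_le_mul h5.le hr hcl zero_le_one
  have h7 : (1 - β) * ∑ i₁ ∈ Finset.univ.erase l, ν.candidateProb Q i₁ * ν.secondProb Q i₁ l ≤
      1 * (2 * r) := by
    refine mul_le_mul (by linarith) (h2.trans ?_) (Finset.sum_nonneg fun i₁ _ =>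
      mul_nonneg (candidateProb_nonneg _) (secondProb_nonneg _ _)) zero_le_one
    exact mul_le_of_le_one_left (by linarith) (by linarith)
  linarith

end Problem

/-! ### Kronecker's lemma and a law of large numbers for martingale differences -/

/-- **Kronecker's lemma**. -/
lemma kronecker {x a : ℕ → ℝ} {l : ℝ}
    (hx : Tendsto (fun n => ∑ t ∈ Finset.range n, x t) atTop (𝓝 l)) (hmono : Monotone a)
    (ha : Tendsto a atTop atTop) :
    Tendsto (fun n => (∑ t ∈ Finset.range n, a t * x t) / a n) atTop (𝓝 0) := by
  set T : ℕ → ℝ := fun n => ∑ t ∈ Finset.range n, x t - l with hT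
  have hT0 : Tendsto T atTop (𝓝 0) := by simpa [hT] using hx.sub_const l
  -- Summation by parts against the remainders `T`, which tend to zero.
  have habel : ∀ n, ∑ t ∈ Finset.range n, a t * x t =
      a n * T n - a 0 * T 0 - ∑ t ∈ Finset.range n, (a (t + 1) - a t) * T (t + 1) := by
    intro n
    induction n with
    | zero => simp
    | succ n ih =>
      rw [Finset.sum_range_succ, ih, Finset.sum_range_succ (fun t => (a (t + 1) - a t) * T (t + 1))]
      have : T (n + 1) = T n + x n := by simp [hT, Finset.sum_range_succ]; ring
      rw [this]; ring
  have hsum : ∀ n, ∑ t ∈ Finset.range n, (a (t + 1) - a t) = a n - a 0 := fun n =>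
    Finset.sum_range_sub a n
  -- Up to normalization this is a weighted average of the remainders, with nonnegative weights of
  -- diverging total `a n - a 0`.
  have ho : (fun n => ∑ t ∈ Finset.range n, (a (t + 1) - a t) * T (t + 1)) =o[atTop]
      fun n => ∑ t ∈ Finset.range n, (a (t + 1) - a t) := by
    refine Asymptotics.IsLittleO.sum_range ?_ (fun n => sub_nonneg.2 (hmono n.le_succ)) ?_
    · have := (Asymptotics.isBigO_refl (fun t => a (t + 1) - a t) atTop).mul_isLittleO
        ((Asymptotics.isLittleO_one_iff ℝ).2 (hT0.comp (tendsto_add_atTop_nat 1)))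
      simpa using this
    · simp_rw [hsum]
      exact tendsto_atTop_add_const_right _ _ ha
  have hO : (fun n => ∑ t ∈ Finset.range n, (a (t + 1) - a t)) =O[atTop] a := by
    simp_rw [hsum]
    refine (Asymptotics.isBigO_refl a atTop).sub ?_
    exact ((Asymptotics.isLittleO_const_left).2 (Or.inr
      (tendsto_norm_atTop_atTop.comp ha))).isBigO
  have h3 := (ho.trans_isBigO hO).tendsto_div_nhds_zero
  have h2 : Tendsto (fun n => a 0 * T 0 / a n) atTop (𝓝 0) := ha.const_div_atTop _
  have := (hT0.sub h2).sub h3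
  simp only [sub_zero] at this
  refine this.congr' ?_
  filter_upwards [ha.eventually_gt_atTop 0] with n hn
  rw [habel]
  field_simp

section martingale

variable {Ω : Type*} {m0 : MeasurableSpace Ω} {P : Measure Ω} [IsProbabilityMeasure P]

/-- The series of square-integrable martingale differences with summable variances converges. -/
lemma ae_tendsto_sum_of_condExp_eq_zero {ℱ : Filtration ℕ m0} {D : ℕ → Ω → ℝ}
    (hadp : ∀ t, StronglyMeasurable[ℱ (t + 1)] (D t)) (hL2 : ∀ t, MemLp (D t) 2 P)
    (hcond : ∀ t, P[D t | ℱ t] =ᵐ[P] 0) {C : ℝ}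
    (hC : ∀ n, ∑ t ∈ Finset.range n, ∫ ω, D t ω ^ 2 ∂P ≤ C) :
    ∀ᵐ ω ∂P, ∃ l, Tendsto (fun n => ∑ t ∈ Finset.range n, D t ω) atTop (𝓝 l) := by
  set M : ℕ → Ω → ℝ := fun n ω => ∑ t ∈ Finset.range n, D t ω with hM
  have hMsucc : ∀ n, M (n + 1) = M n + D n := fun n => by
    ext ω; simp [hM, Finset.sum_range_succ]
  have hML2 : ∀ n, MemLp (M n) 2 P := fun n => memLp_finsetSum _ fun t _ => hL2 t
  have hMadp : StronglyAdapted ℱ M := fun n =>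
    Finset.stronglyMeasurable_fun_sum _ fun t ht =>
      (hadp t).mono (ℱ.mono (Finset.mem_range.1 ht))
  have hmart : Martingale M ℱ P := by
    refine martingale_of_condExp_sub_eq_zero_nat hMadp
      (fun n => (hML2 n).integrable one_le_two) fun n => ?_
    rw [hMsucc, add_sub_cancel_left]
    exact hcond n
  -- Martingale differences are orthogonal, so the variances add up.
  have hsq : ∀ n, ∫ ω, M n ω ^ 2 ∂P = ∑ t ∈ Finset.range n, ∫ ω, D t ω ^ 2 ∂P := by
    intro n
    induction n with
    | zero => simp [hM]
    | succ n ih =>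
      have hint : Integrable (M n * D n) P := (hML2 n).integrable_mul (hL2 n)
      have hcross : ∫ ω, (M n * D n) ω ∂P = 0 := by
        rw [← integral_condExp (ℱ.le n)]
        have h1 := condExp_mul_of_stronglyMeasurable_left (hMadp n) hint
          ((hL2 n).integrable one_le_two)
        have h2 : P[M n * D n | ℱ n] =ᵐ[P] 0 := by
          filter_upwards [h1, hcond n] with ω h1 h2
          rw [h1, Pi.mul_apply, h2]; simp
        rw [integral_congr_ae h2]; simp
      have hexp : (fun ω => M (n + 1) ω ^ 2) =
          fun ω => (M n ω ^ 2 + 2 * (M n * D n) ω) + D n ω ^ 2 := by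
        ext ω; rw [hMsucc]; simp only [Pi.add_apply, Pi.mul_apply]; ring
      have hint2 : Integrable (fun ω => M n ω ^ 2 + 2 * (M n * D n) ω) P :=
        (hML2 n).integrable_sq.add (hint.const_mul 2)
      rw [Finset.sum_range_succ, ← ih, hexp, integral_add hint2 (hL2 n).integrable_sq,
        integral_add (hML2 n).integrable_sq (hint.const_mul 2), integral_const_mul, hcross]
      ring
  refine hmart.submartingale.exists_ae_tendsto_of_bdd (R := Real.toNNReal (1 + C)) fun n => ?_
  rw [eLpNorm_one_eq_lintegral_enorm,
    ← ofReal_integral_norm_eq_lintegral_enorm ((hML2 n).integrable one_le_two)]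
  refine ENNReal.ofReal_le_ofReal ?_
  -- Boundedness in `L²` yields the `L¹` bound needed for martingale convergence, through `|x| ≤ 1 +
  -- x ^ 2`.
  have h1 : ∫ ω, ‖M n ω‖ ∂P ≤ ∫ ω, (1 + M n ω ^ 2) ∂P := by
    refine integral_mono ((hML2 n).integrable one_le_two).norm
      ((integrable_const 1).add (hML2 n).integrable_sq) fun ω => ?_
    simp only [Real.norm_eq_abs]
    nlinarith [sq_abs (M n ω), sq_nonneg (|M n ω| - 1)]
  rw [integral_add (integrable_const 1) (hML2 n).integrable_sq, hsq] at h1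
  simp only [integral_const, probReal_univ, smul_eq_mul, mul_one] at h1
  linarith [hC n]

/-- A strong law of large numbers for martingale differences with predictable weights. -/
lemma ae_tendsto_div_of_condExp_eq_zero {ℱ : Filtration ℕ m0} {D a : ℕ → Ω → ℝ}
    (hadp : ∀ t, StronglyMeasurable[ℱ (t + 1)] (D t)) (hL2 : ∀ t, MemLp (D t) 2 P)
    (hcond : ∀ t, P[D t | ℱ t] =ᵐ[P] 0) (ha : ∀ t, StronglyMeasurable[ℱ t] (a t))
    (ha1 : ∀ t ω, 1 ≤ a t ω) (hmono : ∀ ω, Monotone fun t => a t ω) {C : ℝ}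
    (hC : ∀ n, ∑ t ∈ Finset.range n, ∫ ω, (D t ω / a t ω) ^ 2 ∂P ≤ C) :
    ∀ᵐ ω ∂P, Tendsto (fun n => a n ω) atTop atTop →
      Tendsto (fun n => (∑ t ∈ Finset.range n, D t ω) / a n ω) atTop (𝓝 0) := by
  have hameas : ∀ t, StronglyMeasurable[ℱ t] (fun ω => (a t ω)⁻¹) := fun t =>
    (ha t).measurable.inv.stronglyMeasurable
  have habd : ∀ t ω, ‖(a t ω)⁻¹‖ ≤ 1 := fun t ω => by
    rw [norm_inv, Real.norm_of_nonneg (by linarith [ha1 t ω])]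
    exact inv_le_one_of_one_le₀ (ha1 t ω)
  have hL2' : ∀ t, MemLp (fun ω => (a t ω)⁻¹ * D t ω) 2 P := fun t => by
    refine (hL2 t).of_le (((hameas t).mono (ℱ.le t)).aestronglyMeasurable.mul
      (hL2 t).aestronglyMeasurable) (ae_of_all _ fun ω => ?_)
    rw [norm_mul]
    exact mul_le_of_le_one_left (norm_nonneg _) (habd t ω)
  have h := ae_tendsto_sum_of_condExp_eq_zero (P := P) (ℱ := ℱ)
    (D := fun t ω => (a t ω)⁻¹ * D t ω) (C := C)
    (fun t => ((hameas t).mono (ℱ.mono t.le_succ)).mul (hadp t)) hL2' (fun t => ?_) (fun n => ?_)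
  · filter_upwards [h] with ω ⟨l, hl⟩ hω
    refine (kronecker hl (hmono ω) hω).congr fun n => ?_
    congr 1
    refine Finset.sum_congr rfl fun t _ => ?_
    rw [mul_inv_cancel_left₀ (by linarith [ha1 t ω])]
  · have h1 := condExp_mul_of_stronglyMeasurable_left (hameas t)
      ((hL2' t).integrable one_le_two) ((hL2 t).integrable one_le_two)
    filter_upwards [h1, hcond t] with ω h1 h2
    refine h1.trans ?_
    rw [Pi.mul_apply, h2]; simp
  · refine (hC n).trans' (le_of_eq (Finset.sum_congr rfl fun t _ => ?_))
    congr 1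
    ext ω
    rw [div_eq_inv_mul]

end martingale

/-! ### Sample counts and the filtration of the observations -/

section run

variable {k m : ℕ} {Ω : Type*} {X : ℕ → Ω → Fin k → Fin (m + 1) → ℝ} {I : ℕ → Ω → Fin k}

lemma count_succ {t : ℕ} (ht : 1 ≤ t) (i : Fin k) (ω : Ω) :
    count I (t + 1) i ω = count I t i ω + if I t ω = i then 1 else 0 := by
  unfold count
  rw [Finset.sum_Ico_succ_top ht]

lemma count_one (i : Fin k) (ω : Ω) : count I 1 i ω = 0 := by simp [count]

lemma postMean_succ_of_count_eq {t : ℕ} {i : Fin k} {ω : Ω}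
    (h : count I (t + 1) i ω = count I t i ω) (j : Fin (m + 1)) :
    postMean X I (t + 1) i j ω = postMean X I t i j ω := by
  unfold postMean
  rw [h]
  congr 1
  rcases t.eq_zero_or_pos with rfl | ht
  · simp
  · rw [count_succ ht] at h
    rw [Finset.sum_Ico_succ_top ht]
    have : I t ω ≠ i := fun h' => by simp [h'] at h
    simp [this]

lemma count_mono (i : Fin k) (ω : Ω) : Monotone fun t => count I t i ω := by
  intro t t' h
  exact Finset.sum_le_sum_of_subset (Finset.Ico_subset_Ico_right h)

lemma sum_count (t : ℕ) (ω : Ω) : ∑ i, count I t i ω = t - 1 := by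
  unfold count
  rw [Finset.sum_comm]
  simp

/-- A term is present only when the count `c` increases to `c + 1`, and `1 / (c + 2) ^ 2 ≤ 1 / (c +
1) - 1 / (c + 2)`, so the sum telescopes along the pulls of `i`. The resulting bound `1` does not
depend on the algorithm and controls the variance of its weighted sample sums. -/
lemma sum_sq_count_le (i : Fin k) (ω : Ω) (n : ℕ) :
    ∑ t ∈ Finset.range n, (if I (t + 1) ω = i then (1 : ℝ) else 0) *
      (((count I (t + 1) i ω : ℝ) + 2)⁻¹) ^ 2 ≤ 1 - ((count I (n + 1) i ω : ℝ) + 1)⁻¹ := by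
  induction n with
  | zero => simp [count_one]
  | succ n ih =>
    rw [Finset.sum_range_succ, count_succ (t := n + 1) (by omega)]
    refine (add_le_add_left ih _).trans ?_
    set c : ℝ := (count I (n + 1) i ω : ℝ) with hc
    have hc0 : 0 ≤ c := Nat.cast_nonneg _
    split_ifs
    · push_cast
      rw [← hc]
      have : ((c + 2)⁻¹) ^ 2 ≤ (c + 1)⁻¹ - (c + 1 + 1)⁻¹ := by
        rw [inv_sub_inv (by positivity) (by positivity), inv_pow, inv_eq_one_div]
        rw [div_le_div_iff₀ (by positivity) (by positivity)]
        nlinarith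
      linarith
    · simp [← hc]

lemma measurable_pair_observed {l t : ℕ} (hl : 1 ≤ l) (hlt : l < t) :
    Measurable[observed X I t] fun ω => (I l ω, X l ω (I l ω)) := by
  refine Measurable.mono (comap_measurable _) ?_ le_rfl
  exact le_iSup₂_of_le (f := fun l (_ : l ∈ Finset.Ico 1 t) =>
    MeasurableSpace.comap (fun ω => (I l ω, X l ω (I l ω))) inferInstance) l
    (Finset.mem_Ico.2 ⟨hl, hlt⟩) le_rfl

lemma measurable_pull_observed {l t : ℕ} (hl : 1 ≤ l) (hlt : l < t) :
    Measurable[observed X I t] (I l) :=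
  measurable_fst.comp (measurable_pair_observed (X := X) hl hlt)

lemma measurable_reward_observed {l t : ℕ} (hl : 1 ≤ l) (hlt : l < t) :
    Measurable[observed X I t] fun ω => X l ω (I l ω) :=
  measurable_snd.comp (measurable_pair_observed (X := X) hl hlt)

lemma measurable_count_observed (t : ℕ) (i : Fin k) :
    Measurable[observed X I t] (count I t i) := by
  unfold count
  refine Finset.measurable_fun_sum _ fun l hl => ?_
  rw [Finset.mem_Ico] at hl
  refine Measurable.ite ?_ measurable_const measurable_const
  exact measurable_pull_observed hl.1 hl.2 (measurableSet_singleton i)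

lemma observed_mono : Monotone (observed X I) := fun _ _ h =>
  biSup_mono fun _ hl => Finset.Ico_subset_Ico_right h hl

variable [m0 : MeasurableSpace Ω] {ν : Problem k m} {P : Measure Ω}

lemma IsAlgorithmRun.observed_le (hrun : IsAlgorithmRun ν P X I) (t : ℕ) :
    observed X I t ≤ m0 := by
  refine iSup₂_le fun l _ => ?_
  refine Measurable.comap_le ?_
  refine (hrun.measurable_pull l).prodMk ?_
  have h1 : Measurable fun p : Fin k × (Fin k → Fin (m + 1) → ℝ) => p.2 p.1 :=
    measurable_from_prod_countable_right fun i => measurable_pi_apply i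
  exact h1.comp ((hrun.measurable_pull l).prodMk (hrun.measurable_reward l))

/-- The filtration of the observations; index `n` stands for the first `n` rounds. -/
def IsAlgorithmRun.filtration (hrun : IsAlgorithmRun ν P X I) : Filtration ℕ m0 where
  seq n := observed X I (n + 1)
  mono' _ _ h := observed_mono (by omega)
  le' n := hrun.observed_le (n + 1)

end run

/-! ### Almost sure properties of the runs of an algorithm -/

namespace IsAlgorithmRun

variable {k m : ℕ} {Ω : Type*} [m0 : MeasurableSpace Ω] {ν : Problem k m} {P : Measure Ω}
  {X : ℕ → Ω → Fin k → Fin (m + 1) → ℝ} {I : ℕ → Ω → Fin k}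

lemma measurable_coord (hrun : IsAlgorithmRun ν P X I) (t : ℕ) (i : Fin k) (j : Fin (m + 1)) :
    Measurable fun ω => X t ω i j := by
  have := hrun.measurable_reward t
  fun_prop

/-- The observations before round `t` and the choice in round `t`. -/
abbrev past (_ : IsAlgorithmRun ν P X I) (t : ℕ) : MeasurableSpace Ω :=
  observed X I t ⊔ MeasurableSpace.comap (I t) inferInstance

lemma past_le (hrun : IsAlgorithmRun ν P X I) (t : ℕ) : hrun.past t ≤ m0 :=
  sup_le (hrun.observed_le t) (hrun.measurable_pull t).comap_le

lemma measurable_indicator_past (hrun : IsAlgorithmRun ν P X I) (t : ℕ) (i : Fin k) :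
    Measurable[hrun.past t] fun ω => if I t ω = i then (1 : ℝ) else 0 := by
  have h : Measurable[hrun.past t] (I t) :=
    Measurable.mono (comap_measurable (I t)) le_sup_right le_rfl
  exact Measurable.ite (h (measurableSet_singleton i)) measurable_const measurable_const

/-- The conditional probability of pulling arm `i` in round `t`, given the observations. -/
def condPull (_ : IsAlgorithmRun ν P X I) (t : ℕ) (i : Fin k) : Ω → ℝ :=
  P[({ω | I t ω = i}).indicator (fun _ => (1 : ℝ)) | observed X I t]

lemma measurableSet_pull (hrun : IsAlgorithmRun ν P X I) (t : ℕ) (i : Fin k) :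
    MeasurableSet {ω | I t ω = i} := hrun.measurable_pull t (measurableSet_singleton i)

lemma stronglyMeasurable_condPull (hrun : IsAlgorithmRun ν P X I) (t : ℕ) (i : Fin k) :
    StronglyMeasurable[observed X I t] (hrun.condPull t i) := stronglyMeasurable_condExp

lemma memLp_reward (hrun : IsAlgorithmRun ν P X I) {t : ℕ} (ht : 1 ≤ t) (i : Fin k)
    (j : Fin (m + 1)) : MemLp (fun ω => X t ω i j) 2 P := by
  have h := memLp_id_gaussianReal' (μ := ν.mean i j) (v := ν.var i j) 2 (by simp)
  rw [← hrun.reward_law t ht i j, memLp_map_measure_iff aestronglyMeasurable_id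
    (hrun.measurable_coord t i j).aemeasurable] at h
  exact h

lemma integral_reward (hrun : IsAlgorithmRun ν P X I) {t : ℕ} (ht : 1 ≤ t) (i : Fin k)
    (j : Fin (m + 1)) : ∫ ω, X t ω i j ∂P = ν.mean i j := by
  rw [← integral_id_gaussianReal (μ := ν.mean i j) (v := ν.var i j), ← hrun.reward_law t ht i j,
    integral_map (hrun.measurable_coord t i j).aemeasurable (by fun_prop)]

lemma integral_reward_sq (hrun : IsAlgorithmRun ν P X I) {t : ℕ} (ht : 1 ≤ t) (i : Fin k)
    (j : Fin (m + 1)) : ∫ ω, (X t ω i j - ν.mean i j) ^ 2 ∂P = ν.var i j := by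
  rw [← variance_fun_id_gaussianReal (μ := ν.mean i j) (v := ν.var i j),
    variance_eq_integral (by fun_prop), integral_id_gaussianReal, ← hrun.reward_law t ht i j,
    integral_map (hrun.measurable_coord t i j).aemeasurable (by fun_prop)]

variable [IsProbabilityMeasure P]

/-- A function of the rewards of round `t` has conditional expectation given the past of round `t`
equal to its expectation. -/
lemma condExp_past (hrun : IsAlgorithmRun ν P X I) {t : ℕ} (ht : 1 ≤ t)
    {f : (Fin k → Fin (m + 1) → ℝ) → ℝ} (hf : Measurable f) :
    P[fun ω => f (X t ω) | hrun.past t] =ᵐ[P] fun _ => ∫ ω, f (X t ω) ∂P :=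
  condExp_indep_eq (hrun.measurable_reward t).comap_le (hrun.past_le t)
    (hf.comp (comap_measurable (X t))).stronglyMeasurable (hrun.nonanticipating t ht)

/-- The sample means of an arm that is pulled infinitely often converge to the true means. -/
theorem ae_tendsto_postMean (hrun : IsAlgorithmRun ν P X I) (i : Fin k) (j : Fin (m + 1)) :
    ∀ᵐ ω ∂P, Tendsto (fun n => count I n i ω) atTop atTop →
      Tendsto (fun n => postMean X I n i j ω) atTop (𝓝 (ν.mean i j)) := by
  set g : ℕ → Ω → ℝ := fun t ω => if I (t + 1) ω = i then (1 : ℝ) else 0 with hg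
  set Y : ℕ → Ω → ℝ := fun t ω => X (t + 1) ω i j - ν.mean i j with hY
  -- The weight of round `t + 1` is known before that round, and it is comparable to the count. The
  -- shift by `2` is the one of `sum_sq_count_le`.
  set a : ℕ → Ω → ℝ := fun t ω => (count I (t + 1) i ω : ℝ) + 2 with ha
  have hfm : Measurable fun x : Fin k → Fin (m + 1) → ℝ => x i j - ν.mean i j := by fun_prop
  have hgm : ∀ t, Measurable[hrun.past (t + 1)] (g t) := fun t =>
    hrun.measurable_indicator_past (t + 1) i
  have hg1 : ∀ t ω, ‖g t ω‖ ≤ 1 := fun t ω => by simp only [hg]; split_ifs <;> simp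
  have hYL2 : ∀ t, MemLp (Y t) 2 P := fun t =>
    (hrun.memLp_reward (by omega) i j).sub (memLp_const _)
  have hD : ∀ t, MemLp (fun ω => g t ω * Y t ω) 2 P := fun t => by
    refine (hYL2 t).of_le ((((hgm t).mono (hrun.past_le _) le_rfl).aestronglyMeasurable).mul
      (hYL2 t).aestronglyMeasurable) (ae_of_all _ fun ω => ?_)
    rw [norm_mul]
    exact mul_le_of_le_one_left (norm_nonneg _) (hg1 t ω)
  have hYint : ∀ t, ∫ ω, Y t ω ∂P = 0 := fun t => by
    simp only [hY]
    rw [integral_sub ((hrun.memLp_reward (by omega) i j).integrable one_le_two)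
      (integrable_const _), hrun.integral_reward (by omega)]
    simp
  have ham : ∀ t, Measurable[observed X I (t + 1)] (a t) := fun t => by
    have h1 : Measurable fun n : ℕ => (n : ℝ) + 2 := measurable_of_countable _
    exact h1.comp (measurable_count_observed (t + 1) i)
  have ha1 : ∀ t ω, 1 ≤ a t ω := fun t ω => by
    have : (0 : ℝ) ≤ count I (t + 1) i ω := Nat.cast_nonneg _
    simp only [ha]; linarith
  have key := ae_tendsto_div_of_condExp_eq_zero (P := P) (ℱ := hrun.filtration)
    (D := fun t ω => g t ω * Y t ω) (a := a) (C := ν.var i j) (fun t => ?_) hD (fun t => ?_)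
    (fun t => (ham t).stronglyMeasurable) ha1 (fun ω t t' h => ?_) (fun n => ?_)
  · filter_upwards [key] with ω key hω
    have hω1 : Tendsto (fun n => (count I (n + 1) i ω : ℝ)) atTop atTop :=
      tendsto_natCast_atTop_atTop.comp (hω.comp (tendsto_add_atTop_nat 1))
    have h1 := key (tendsto_atTop_add_const_right _ _ hω1)
    rw [← tendsto_add_atTop_iff_nat 1]
    have h2 : Tendsto (fun n => a n ω / (count I (n + 1) i ω : ℝ)) atTop (𝓝 1) := by
      have : Tendsto (fun n => 1 + 2 / (count I (n + 1) i ω : ℝ)) atTop (𝓝 (1 + 0)) :=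
        (hω1.const_div_atTop 2).const_add 1
      rw [add_zero] at this
      refine this.congr' ?_
      filter_upwards [hω1.eventually_gt_atTop 0] with n hn
      simp only [ha]
      field_simp
    have h3 := (h1.mul h2).add_const (ν.mean i j)
    rw [zero_mul, zero_add] at h3
    refine h3.congr' ?_
    filter_upwards [hω1.eventually_gt_atTop 0] with n hn
    have h4 : ∑ l ∈ Finset.Ico 1 (n + 1), (if I l ω = i then X l ω (I l ω) j else 0) =
        ∑ t ∈ Finset.range n, g t ω * Y t ω + count I (n + 1) i ω * ν.mean i j := by
      unfold count
      push_cast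
      rw [Finset.sum_Ico_eq_sum_range, Finset.sum_Ico_eq_sum_range, Finset.sum_mul,
        Nat.add_sub_cancel, ← Finset.sum_add_distrib]
      refine Finset.sum_congr rfl fun t _ => ?_
      rw [add_comm 1 t]
      simp only [hg, hY]
      split_ifs with h
      · rw [h]; ring
      · simp
    unfold postMean
    rw [h4]
    have := ha1 n ω
    field_simp
  · have hI := measurable_pull_observed (X := X) (I := I) (l := t + 1) (t := t + 1 + 1) (by omega)
      (by omega)
    have hR := measurable_reward_observed (X := X) (I := I) (l := t + 1) (t := t + 1 + 1) (by omega)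
      (by omega)
    -- The entry `X (t + 1) ω i j` is not observed unless `i` is pulled, so adaptedness is checked
    -- after rewriting in terms of the observed reward.
    have heq : (fun ω => g t ω * Y t ω) = fun ω => if I (t + 1) ω = i then
        X (t + 1) ω (I (t + 1) ω) j - ν.mean i j else 0 := by
      ext ω
      simp only [hg, hY]
      split_ifs with h
      · rw [h]; ring
      · simp
    change StronglyMeasurable[observed X I (t + 1 + 1)] (fun ω => g t ω * Y t ω)
    rw [heq]
    refine Measurable.stronglyMeasurable ?_
    refine Measurable.ite (hI (measurableSet_singleton i)) ?_ measurable_const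
    exact ((measurable_pi_apply j).comp hR).sub_const _
  -- The conditional mean is first taken given the past including the current choice: the choice is
  -- then known and the centred reward is independent. The tower property removes the choice.
  · have h1 : P[g t * Y t | hrun.past (t + 1)] =ᵐ[P] 0 := by
      have h2 := condExp_mul_of_stronglyMeasurable_left (hgm t).stronglyMeasurable
        ((hD t).integrable one_le_two) ((hYL2 t).integrable one_le_two)
      filter_upwards [h2, hrun.condExp_past (t := t + 1) (by omega) hfm] with ω h2 h3
      rw [h2, Pi.mul_apply]
      have : P[Y t | hrun.past (t + 1)] ω = 0 := h3.trans (hYint t)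
      rw [this]; simp
    have h2 := condExp_condExp_of_le (μ := P) (f := g t * Y t)
      (le_sup_left : observed X I (t + 1) ≤ hrun.past (t + 1)) (hrun.past_le (t + 1))
    refine h2.symm.trans ((condExp_congr_ae h1).trans ?_)
    simp
  · have := count_mono (I := I) i ω (show t + 1 ≤ t' + 1 by omega)
    simpa [ha] using this
  -- By the same conditioning, the squared reward contributes its variance, and what remains is the
  -- sum bounded by `sum_sq_count_le`.
  · have hterm : ∀ t, ∫ ω, (g t ω * Y t ω / a t ω) ^ 2 ∂P =
        ν.var i j * ∫ ω, g t ω * ((a t ω)⁻¹) ^ 2 ∂P := by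
      intro t
      set w : Ω → ℝ := fun ω => g t ω * ((a t ω)⁻¹) ^ 2 with hw
      have hwm : Measurable[hrun.past (t + 1)] w :=
        (hgm t).mul (((ham t).mono le_sup_left le_rfl).inv.pow_const 2)
      have hw1 : ∀ ω, ‖w ω‖ ≤ 1 := fun ω => by
        have h1 : ‖(a t ω)⁻¹‖ ≤ 1 := by
          rw [norm_inv, Real.norm_of_nonneg (by linarith [ha1 t ω])]
          exact inv_le_one_of_one_le₀ (ha1 t ω)
        simp only [hw, norm_mul, norm_pow]
        exact mul_le_one₀ (hg1 t ω) (by positivity) (pow_le_one₀ (norm_nonneg _) h1)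
      have hint : Integrable (w * fun ω => Y t ω ^ 2) P := by
        refine (hYL2 t).integrable_sq.bdd_mul (c := 1) ?_ (ae_of_all _ hw1)
        exact ((hwm.mono (hrun.past_le _) le_rfl).aestronglyMeasurable)
      have h2 := condExp_mul_of_stronglyMeasurable_left hwm.stronglyMeasurable hint
        (hYL2 t).integrable_sq
      have heq : (fun ω => (g t ω * Y t ω / a t ω) ^ 2) = w * fun ω => Y t ω ^ 2 := by
        ext ω
        simp only [hw, Pi.mul_apply, hg]
        split_ifs
        · rw [div_eq_mul_inv]; ring
        · simp
      rw [heq, ← integral_condExp (hrun.past_le (t + 1)), ← integral_const_mul]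
      refine integral_congr_ae ?_
      filter_upwards [h2, hrun.condExp_past (t := t + 1) (by omega) (hfm.pow_const 2)] with ω h2 h3
      rw [h2, Pi.mul_apply]
      have : P[fun ω => Y t ω ^ 2 | hrun.past (t + 1)] ω = ν.var i j :=
        h3.trans (hrun.integral_reward_sq (by omega) i j)
      rw [this, mul_comm]
    simp_rw [hterm, ← Finset.mul_sum]
    refine mul_le_of_le_one_right (NNReal.coe_nonneg _) ?_
    have hbm : ∀ t, Measurable fun ω => g t ω * ((a t ω)⁻¹) ^ 2 := fun t =>
      ((hgm t).mono (hrun.past_le _) le_rfl).mul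
        (((ham t).mono (hrun.observed_le _) le_rfl).inv.pow_const 2)
    have hbi : ∀ t, Integrable (fun ω => g t ω * ((a t ω)⁻¹) ^ 2) P := fun t => by
      refine Integrable.of_bound (hbm t).aestronglyMeasurable 1 (ae_of_all _ fun ω => ?_)
      have h1 : ‖(a t ω)⁻¹‖ ≤ 1 := by
        rw [norm_inv, Real.norm_of_nonneg (by linarith [ha1 t ω])]
        exact inv_le_one_of_one_le₀ (ha1 t ω)
      simp only [norm_mul, norm_pow]
      exact mul_le_one₀ (hg1 t ω) (by positivity) (pow_le_one₀ (norm_nonneg _) h1)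
    rw [← integral_finsetSum _ fun t _ => hbi t]
    have : ∫ ω, ∑ t ∈ Finset.range n, g t ω * ((a t ω)⁻¹) ^ 2 ∂P ≤ ∫ _, (1 : ℝ) ∂P := by
      refine integral_mono (integrable_finsetSum _ fun t _ => hbi t) (integrable_const 1)
        fun ω => (sum_sq_count_le i ω n).trans ?_
      have : (0 : ℝ) ≤ ((count I (n + 1) i ω : ℝ) + 1)⁻¹ := by positivity
      linarith
    simpa using this

lemma integrable_pull (hrun : IsAlgorithmRun ν P X I) (t : ℕ) (i : Fin k) :
    Integrable (({ω | I t ω = i}).indicator (fun _ => (1 : ℝ))) P :=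
  (integrable_const 1).indicator (hrun.measurableSet_pull t i)

lemma ae_condPull_mem (hrun : IsAlgorithmRun ν P X I) (t : ℕ) (i : Fin k) :
    ∀ᵐ ω ∂P, hrun.condPull t i ω ∈ Icc (0 : ℝ) 1 := by
  have h0 : (0 : Ω → ℝ) ≤ᵐ[P] hrun.condPull t i :=
    condExp_nonneg (ae_of_all _ fun ω => indicator_nonneg (fun _ _ => zero_le_one) ω)
  have h1 : hrun.condPull t i ≤ᵐ[P] P[fun _ => (1 : ℝ) | observed X I t] :=
    condExp_mono (hrun.integrable_pull t i) (integrable_const 1)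
      (ae_of_all _ fun ω => indicator_le_self' (fun _ _ => zero_le_one) ω)
  rw [condExp_const (hrun.observed_le t)] at h1
  filter_upwards [h0, h1] with ω h0 h1 using ⟨h0, h1⟩

/-- The pulls of an arm follow the sum of their conditional probabilities. -/
theorem ae_tendsto_count_sub (hrun : IsAlgorithmRun ν P X I) (i : Fin k) :
    ∀ᵐ ω ∂P, Tendsto (fun n : ℕ => ((count I n i ω : ℝ) -
      ∑ t ∈ Finset.Ico 1 n, hrun.condPull t i ω) / n) atTop (𝓝 0) := by
  set D : ℕ → Ω → ℝ := fun t ω =>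
    ({ω | I (t + 1) ω = i}).indicator (fun _ => (1 : ℝ)) ω - hrun.condPull (t + 1) i ω with hD
  have hDm : ∀ t, StronglyMeasurable[observed X I (t + 1 + 1)] (D t) := fun t => by
    refine StronglyMeasurable.sub ?_
      ((hrun.stronglyMeasurable_condPull (t + 1) i).mono (observed_mono (by omega)))
    exact stronglyMeasurable_const.indicator
      (measurable_pull_observed (X := X) (by omega) (by omega) (measurableSet_singleton i))
  have hDbd : ∀ t, ∀ᵐ ω ∂P, ‖D t ω‖ ≤ 1 := fun t => by
    filter_upwards [hrun.ae_condPull_mem (t + 1) i] with ω hω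
    have h1 : ({ω | I (t + 1) ω = i}).indicator (fun _ => (1 : ℝ)) ω ∈ Icc (0 : ℝ) 1 := by
      by_cases h : ω ∈ {ω | I (t + 1) ω = i} <;> simp [h]
    rw [Real.norm_eq_abs, abs_le]
    simp only [hD]
    constructor <;> linarith [hω.1, hω.2, h1.1, h1.2]
  have hDL2 : ∀ t, MemLp (D t) 2 P := fun t =>
    MemLp.of_bound ((hDm t).mono (hrun.observed_le _)).aestronglyMeasurable 1 (hDbd t)
  -- The differences are bounded by one, so with weights `t + 1` the variances are at most `1 / (t +
  -- 1) ^ 2`, whose sum is at most `2`.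
  have key := ae_tendsto_div_of_condExp_eq_zero (P := P) (ℱ := hrun.filtration) (D := D)
    (a := fun t _ => (t : ℝ) + 1) (C := 2) hDm hDL2 (fun t => ?_)
    (fun t => stronglyMeasurable_const) (fun t _ => by simp) (fun _ t t' h => by simpa using h)
    (fun n => ?_)
  · filter_upwards [key] with ω key
    rw [← tendsto_add_atTop_iff_nat 1]
    refine (key (tendsto_atTop_add_const_right _ _ tendsto_natCast_atTop_atTop)).congr fun n => ?_
    push_cast
    congr 1
    unfold count
    push_cast
    rw [← Finset.sum_sub_distrib, Finset.sum_Ico_eq_sum_range, Nat.add_sub_cancel]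
    refine Finset.sum_congr rfl fun t _ => ?_
    simp only [hD, add_comm 1 t, indicator, mem_ofPred_eq]
  · have h1 : P[hrun.condPull (t + 1) i | observed X I (t + 1)] = hrun.condPull (t + 1) i :=
      condExp_of_stronglyMeasurable (hrun.observed_le _) (hrun.stronglyMeasurable_condPull _ i)
        integrable_condExp
    have h2 := condExp_sub (hrun.integrable_pull (t + 1) i)
      (integrable_condExp : Integrable (hrun.condPull (t + 1) i) P) (observed X I (t + 1))
    refine h2.trans ?_
    rw [condPull] at h1
    rw [h1]
    simp
  · have h1 : ∀ t, ∫ ω, (D t ω / ((t : ℝ) + 1)) ^ 2 ∂P ≤ (((t : ℝ) + 1) ^ 2)⁻¹ := fun t => by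
      have : ∫ ω, (D t ω / ((t : ℝ) + 1)) ^ 2 ∂P ≤ ∫ _, (((t : ℝ) + 1) ^ 2)⁻¹ ∂P := by
        refine integral_mono_ae ?_ (integrable_const _) ?_
        · simp_rw [div_eq_mul_inv]
          exact ((hDL2 t).mul_const _).integrable_sq
        · filter_upwards [hDbd t] with ω hω
          rw [div_pow, div_eq_mul_inv]
          refine mul_le_of_le_one_left (by positivity) ?_
          rw [← sq_abs]
          exact pow_le_one₀ (abs_nonneg _) hω
      simpa using this
    refine (Finset.sum_le_sum fun t _ => h1 t).trans ?_
    have h2 : ∀ n : ℕ, ∑ t ∈ Finset.range n, (((t : ℝ) + 1) ^ 2)⁻¹ ≤ 2 - (n : ℝ)⁻¹ := by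
      intro n
      induction n with
      | zero => simp
      | succ n ih =>
        rw [Finset.sum_range_succ]
        push_cast
        rcases n.eq_zero_or_pos with rfl | hn
        · norm_num
        · have hn' : (0 : ℝ) < n := by exact_mod_cast hn
          have : (((n : ℝ) + 1) ^ 2)⁻¹ ≤ (n : ℝ)⁻¹ - ((n : ℝ) + 1)⁻¹ := by
            rw [inv_sub_inv (by positivity) (by positivity), inv_eq_one_div,
              div_le_div_iff₀ (by positivity) (by positivity)]
            nlinarith
          linarith
    have : (0 : ℝ) ≤ (n : ℝ)⁻¹ := by positivity
    linarith [h2 n]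

/-- An arm is eventually not pulled in rounds in which its conditional probability is exponentially
small. -/
theorem ae_eventually_pull_ne (hrun : IsAlgorithmRun ν P X I) (i : Fin k) :
    ∀ᵐ ω ∂P, ∀ q : ℕ, ∀ᶠ t : ℕ in atTop,
      hrun.condPull t i ω ≤ Real.exp (-((q : ℝ) + 1)⁻¹ * t) → I t ω ≠ i := by
  -- The exponential rates are restricted to `1 / (q + 1)` so that only countably many null sets
  -- arise.
  rw [ae_all_iff]
  intro q
  have hm : ∀ t, MeasurableSet[observed X I t]
      {ω | hrun.condPull t i ω ≤ Real.exp (-((q : ℝ) + 1)⁻¹ * t)} := fun t =>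
    measurableSet_le (hrun.stronglyMeasurable_condPull t i).measurable measurable_const
  -- Whether the conditional probability is small is decided by the observations, so the joint event
  -- has as probability the integral of that small conditional probability. Borel–Cantelli then
  -- applies.
  have hbd : ∀ t, P ({ω | hrun.condPull t i ω ≤ Real.exp (-((q : ℝ) + 1)⁻¹ * t)} ∩
      {ω | I t ω = i}) ≤ ENNReal.ofReal (Real.exp (-((q : ℝ) + 1)⁻¹ * t)) := fun t => by
    have h1 := setIntegral_condExp (hrun.observed_le t) (hrun.integrable_pull t i) (hm t)
    rw [setIntegral_indicator (hrun.measurableSet_pull t i), setIntegral_const, smul_eq_mul,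
      mul_one] at h1
    rw [← ENNReal.ofReal_toReal (measure_ne_top P _)]
    refine ENNReal.ofReal_le_ofReal ?_
    rw [← measureReal_def, ← h1]
    have h2 : ∫ ω in {ω | hrun.condPull t i ω ≤ Real.exp (-((q : ℝ) + 1)⁻¹ * t)},
        hrun.condPull t i ω ∂P ≤ ∫ ω in {ω | hrun.condPull t i ω ≤
        Real.exp (-((q : ℝ) + 1)⁻¹ * t)}, Real.exp (-((q : ℝ) + 1)⁻¹ * t) ∂P := by
      refine setIntegral_mono_on integrable_condExp.integrableOn (integrable_const _)
        (hrun.observed_le t _ (hm t)) fun ω hω => hω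
    refine h2.trans ?_
    rw [setIntegral_const, smul_eq_mul]
    exact mul_le_of_le_one_left (Real.exp_pos _).le measureReal_le_one
  have hsum : Summable fun t : ℕ => Real.exp (-((q : ℝ) + 1)⁻¹ * t) := by
    have := Real.summable_exp_nat_mul_iff (a := -((q : ℝ) + 1)⁻¹)
    simp_rw [mul_comm (-((q : ℝ) + 1)⁻¹)]
    rw [this]
    have : (0 : ℝ) < ((q : ℝ) + 1)⁻¹ := by positivity
    linarith
  have htop : ∑' t, P ({ω | hrun.condPull t i ω ≤ Real.exp (-((q : ℝ) + 1)⁻¹ * t)} ∩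
      {ω | I t ω = i}) ≠ ∞ :=
    ne_top_of_le_ne_top (ENNReal.ofReal_tsum_of_nonneg (fun t => (Real.exp_pos _).le) hsum ▸
      ENNReal.ofReal_ne_top) (ENNReal.tsum_le_tsum hbd)
  filter_upwards [ae_eventually_notMem htop] with ω hω
  filter_upwards [hω] with t ht h1 h2
  exact ht ⟨h1, h2⟩

end IsAlgorithmRun

/-! ### Deterministic sample paths and upper bounds of their rates -/

/-- A path of sample sizes `N` and sample means `M` along which the means of the arms that are
sampled infinitely often converge to the true ones. -/
structure SamplePath {k m : ℕ} (ν : Problem k m) (N : ℕ → Fin k → ℕ)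
    (M : ℕ → Fin k → Fin (m + 1) → ℝ) : Prop where
  sum_eq : ∀ n, ∑ i, N n i = n - 1
  mono : ∀ i, Monotone fun n => N n i
  pos : ∀ᶠ n in atTop, ∀ i, 0 < N n i
  tendsto_mean : ∀ i, Tendsto (fun n => N n i) atTop atTop →
    ∀ j, Tendsto (fun n => M n i j) atTop (𝓝 (ν.mean i j))
  mean_eq : ∀ i n, N (n + 1) i = N n i → ∀ j, M (n + 1) i j = M n i j

/-- The exponent of the posterior probability that arm `s` is not the best one. -/
def pathRate {k m : ℕ} (ν : Problem k m) (N : ℕ → Fin k → ℕ)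
    (M : ℕ → Fin k → Fin (m + 1) → ℝ) (s : Fin k) (n : ℕ) : ℝ :=
  -(1 / (n : ℝ)) * Real.log (1 - ν.bestProb (ν.gaussPost (M n) (N n)) s)

/-- In units of `√n`, the standardized distance is `√(N n / n) * e / √v` plus an error that tends to
zero, uniformly for bounded `e`; the constant in `tailCost` is `o(n)`. The error `r` of the sample
mean enters only weighted by `√(N n / n)`, so it may persist for an arm with a vanishing proportion.
-/
lemma eventually_tailCost_le {N : ℕ → ℕ} (hN : ∀ᶠ n in atTop, 0 < N n) {r : ℕ → ℝ}
    (hr : Tendsto (fun n => √((N n : ℝ) / n) * r n) atTop (𝓝 0)) (hle : ∀ n, N n ≤ n) {v B ε : ℝ}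
    (hv : 0 < v) (hε : 0 < ε) :
    ∀ᶠ n : ℕ in atTop, ∀ d e, 0 ≤ d → d ≤ e + r n → 0 ≤ e → e ≤ B →
      tailCost d (v / N n) ≤ n * ((N n : ℝ) / n * (e ^ 2 / (2 * v)) + ε) := by
  set L := Real.log (√(2 * Real.pi)) with hL
  set η : ℕ → ℝ := fun n => √((N n : ℝ) / n) * r n / √v + 1 / √(n : ℝ) with hη
  have hη0 : Tendsto η atTop (𝓝 0) := by
    have h1 : Tendsto (fun n : ℕ => 1 / √(n : ℝ)) atTop (𝓝 0) :=
      (Real.tendsto_sqrt_atTop.comp tendsto_natCast_atTop_atTop).const_div_atTop 1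
    have h2 := (hr.div_const (√v)).add h1
    rwa [zero_div, add_zero] at h2
  have herr : Tendsto (fun n : ℕ => B / √v * |η n| + η n ^ 2 / 2 + L / n) atTop (𝓝 0) := by
    have h1 : Tendsto (fun n : ℕ => L / (n : ℝ)) atTop (𝓝 0) :=
      tendsto_natCast_atTop_atTop.const_div_atTop L
    simpa using ((hη0.abs.const_mul (B / √v)).add ((hη0.pow 2).div_const 2)).add h1
  filter_upwards [hN, herr.eventually_lt_const hε] with n hNn hn d e hd hde he heB
  have hNpos : (0 : ℝ) < N n := by exact_mod_cast hNn
  have hn0 : (0 : ℝ) < n := by exact_mod_cast hNn.trans_le (hle n)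
  have hsv : 0 < √v := Real.sqrt_pos.2 hv
  have hsn : 0 < √(n : ℝ) := Real.sqrt_pos.2 hn0
  have hw1 : (N n : ℝ) / n ≤ 1 := div_le_one_of_le₀ (by exact_mod_cast hle n) hn0.le
  set w : ℝ := √((N n : ℝ) / n) with hw
  have hw0 : 0 < w := Real.sqrt_pos.2 (by positivity)
  have hwle : w ≤ 1 := Real.sqrt_le_one.2 hw1
  have hwsq : w ^ 2 = (N n : ℝ) / n := Real.sq_sqrt (by positivity)
  have hsq : √(v / N n) = √v / (√(n : ℝ) * w) := by
    rw [hw, ← Real.sqrt_mul hn0.le, mul_div_cancel₀ _ hn0.ne', Real.sqrt_div hv.le]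
  set A := w * e / √v with hA
  have hA0 : 0 ≤ A := by positivity
  have hAB : A ≤ B / √v := by
    rw [hA]
    gcongr
    exact (mul_le_of_le_one_left he hwle).trans heB
  have h1 : d / √(v / N n) + 1 ≤ √(n : ℝ) * (A + η n) := by
    rw [hsq, hA]
    simp only [hη]
    rw [div_div_eq_mul_div]
    have : d * (√(n : ℝ) * w) / √v ≤ (e + r n) * (√(n : ℝ) * w) / √v := by gcongr
    refine (add_le_add_left this 1).trans (le_of_eq ?_)
    field_simp
    ring
  have h2 : (d / √(v / N n) + 1) ^ 2 ≤ n * (A + η n) ^ 2 := by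
    have : 0 ≤ d / √(v / N n) + 1 := by positivity
    refine (pow_le_pow_left₀ this h1 2).trans (le_of_eq ?_)
    rw [mul_pow, Real.sq_sqrt hn0.le]
  have h3 : A * η n ≤ B / √v * |η n| :=
    (mul_le_mul_of_nonneg_left (le_abs_self _) hA0).trans
      (mul_le_mul_of_nonneg_right hAB (abs_nonneg _))
  have h4 : A ^ 2 = (N n : ℝ) / n * (e ^ 2 / v) := by
    rw [hA, div_pow, mul_pow, hwsq, Real.sq_sqrt hv.le, mul_div_assoc]
  have h5 : (A + η n) ^ 2 / 2 + L / n ≤ (N n : ℝ) / n * (e ^ 2 / (2 * v)) + ε := by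
    have : (N n : ℝ) / n * (e ^ 2 / (2 * v)) = A ^ 2 / 2 := by
      rw [h4]; field_simp
    rw [this]
    nlinarith
  unfold tailCost
  calc (d / √(v / N n) + 1) ^ 2 / 2 + L ≤ n * (A + η n) ^ 2 / 2 + L := by gcongr
    _ = n * ((A + η n) ^ 2 / 2 + L / n) := by field_simp
    _ ≤ _ := by gcongr

/-- The cheapest level that separates two Gaussian means. -/
lemma exists_level {u v a b : ℝ} (hu : 0 < u) (hv : 0 < v) (ha : 0 ≤ a) (hb : 0 ≤ b) (y z : ℝ) :
    ∃ x, a * (max (x - y) 0 ^ 2 / (2 * u)) + b * (max (z - x) 0 ^ 2 / (2 * v)) =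
      max (z - y) 0 ^ 2 / 2 * pairRate u v a b ∧
      max (x - y) 0 ≤ |z - y| ∧ max (z - x) 0 ≤ |z - y| := by
  rcases le_or_gt z y with h | h
  · refine ⟨z, ?_, ?_, ?_⟩
    · rw [max_eq_right (by linarith), sub_self, max_self]; simp
    · rw [max_eq_right (by linarith)]; positivity
    · simp
  -- The denominator vanishes only for `a = b = 0`, where every level is free.
  · by_cases hden : u * b + v * a = 0
    · have h1 : 0 ≤ u * b := by positivity
      have h2 : 0 ≤ v * a := by positivity
      have ha0 : a = 0 := by
        have : v * a = 0 := by linarith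
        simpa [hv.ne'] using this
      have hb0 : b = 0 := by
        have : u * b = 0 := by linarith
        simpa [hu.ne'] using this
      refine ⟨z, ?_, ?_, ?_⟩
      · simp [ha0, hb0]
      · rw [max_eq_left (by linarith)]; exact le_abs_self _
      · simp
    · have hpos : 0 < u * b + v * a :=
        lt_of_le_of_ne (by positivity) (Ne.symm hden)
      -- The minimizer is the mean of `y` and `z` weighted by the precisions `a / u` and `b / v`.
      set x := y + (z - y) * (u * b) / (u * b + v * a) with hx
      have hd : 0 < z - y := by linarith
      have h1 : x - y = (z - y) * (u * b) / (u * b + v * a) := by rw [hx]; ring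
      have h2 : z - x = (z - y) * (v * a) / (u * b + v * a) := by
        rw [hx]; field_simp; ring
      have h1' : 0 ≤ x - y := by rw [h1]; positivity
      have h2' : 0 ≤ z - x := by rw [h2]; positivity
      refine ⟨x, ?_, ?_, ?_⟩
      · rw [max_eq_left h1', max_eq_left h2', max_eq_left hd.le, h1, h2]
        unfold pairRate
        field_simp
      · rw [max_eq_left h1', abs_of_pos hd]; linarith
      · rw [max_eq_left h2', abs_of_pos hd]; linarith

lemma max_sub_zero_le_add (x y z : ℝ) : max (x - y) 0 ≤ max (x - z) 0 + |y - z| := by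
  have h1 := le_max_left (x - z) 0
  have h2 := le_max_right (x - z) 0
  have h3 := neg_abs_le (y - z)
  have h4 := abs_nonneg (y - z)
  exact max_le (by linarith) (by linarith)

lemma max_sub_zero_le_add' (x y z : ℝ) : max (y - x) 0 ≤ max (z - x) 0 + |y - z| := by
  have h1 := le_max_left (z - x) 0
  have h2 := le_max_right (z - x) 0
  have h3 := le_abs_self (y - z)
  have h4 := abs_nonneg (y - z)
  exact max_le (by linarith) (by linarith)

namespace SamplePath

variable {k m : ℕ} {ν : Problem k m} {N : ℕ → Fin k → ℕ} {M : ℕ → Fin k → Fin (m + 1) → ℝ}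
  {s : Fin k} {β : ℝ}

lemma le_self (h : SamplePath ν N M) (n : ℕ) (i : Fin k) : N n i ≤ n := by
  have := Finset.single_le_sum (f := N n) (fun i _ => Nat.zero_le _) (Finset.mem_univ i)
  rw [h.sum_eq] at this
  omega

lemma weight_mem (h : SamplePath ν N M) (n : ℕ) (i : Fin k) :
    (N n i : ℝ) / n ∈ Icc (0 : ℝ) 1 :=
  ⟨by positivity, div_le_one_of_le₀ (by exact_mod_cast h.le_self n i) (Nat.cast_nonneg n)⟩

lemma sum_weight_le (h : SamplePath ν N M) (n : ℕ) : ∑ i, (N n i : ℝ) / n ≤ 1 := by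
  rw [← Finset.sum_div]
  refine div_le_one_of_le₀ ?_ (Nat.cast_nonneg n)
  rw [← Nat.cast_sum, h.sum_eq]
  exact_mod_cast Nat.sub_le n 1

/-- An arm that is not sampled infinitely often has eventually constant sample data. -/
lemma eventually_const (h : SamplePath ν N M) {i : Fin k}
    (hi : ¬ Tendsto (fun n => N n i) atTop atTop) :
    ∃ n₀, ∀ n, n₀ ≤ n → N n i = N n₀ i ∧ ∀ j, M n i j = M n₀ i j := by
  rcases tendsto_atTop_of_monotone (h.mono i) with h1 | ⟨l, hl⟩
  · exact absurd h1 hi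
  · rw [nhds_discrete, tendsto_pure, eventually_atTop] at hl
    obtain ⟨n₀, hn₀⟩ := hl
    refine ⟨n₀, fun n hn => ⟨(hn₀ n hn).trans (hn₀ n₀ le_rfl).symm, fun j => ?_⟩⟩
    induction n, hn using Nat.le_induction with
    | base => rfl
    | succ n hn ih =>
      rw [← ih]
      exact h.mean_eq i n ((hn₀ (n + 1) (by omega)).trans (hn₀ n hn).symm) j

/-- Either the sample mean converges, or the sample data are eventually frozen and the proportion
tends to zero. This makes the upper bounds on the rate valid for every algorithm. -/
lemma tendsto_sqrt_mul (h : SamplePath ν N M) (i : Fin k) (j : Fin (m + 1)) :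
    Tendsto (fun n : ℕ => √((N n i : ℝ) / n) * |M n i j - ν.mean i j|) atTop (𝓝 0) := by
  by_cases hi : Tendsto (fun n => N n i) atTop atTop
  · have h1 : Tendsto (fun n => |M n i j - ν.mean i j|) atTop (𝓝 0) := by
      simpa using ((h.tendsto_mean i hi j).sub_const (ν.mean i j)).abs
    refine squeeze_zero (fun n => by positivity) (fun n => ?_) h1
    exact mul_le_of_le_one_left (abs_nonneg _) (Real.sqrt_le_one.2 (h.weight_mem n i).2)
  · obtain ⟨n₀, hn₀⟩ := h.eventually_const hi
    have h1 : Tendsto (fun n : ℕ => √((N n₀ i : ℝ) / n) * |M n₀ i j - ν.mean i j|) atTop (𝓝 0) := by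
      have : Tendsto (fun n : ℕ => (N n₀ i : ℝ) / n) atTop (𝓝 0) :=
        tendsto_natCast_atTop_atTop.const_div_atTop _
      have := (Real.continuous_sqrt.tendsto 0).comp this
      simpa using this.mul_const (|M n₀ i j - ν.mean i j|)
    refine h1.congr' ?_
    filter_upwards [eventually_ge_atTop n₀] with n hn
    rw [(hn₀ n hn).1, (hn₀ n hn).2 j]

/-- Lower bounds of the posterior probability that arm `s` is not the best one. -/
lemma eventually_exp_le (h : SamplePath ν N M) (s : Fin k) {ε : ℝ} (hε : 0 < ε) :
    ∀ᶠ n : ℕ in atTop,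
      (∀ i, i ≠ s → Real.exp (-(n * (ν.exponent s ν.mean ((N n s : ℝ) / n) ((N n i : ℝ) / n) i + ε)))
        ≤ 1 - ν.bestProb (ν.gaussPost (M n) (N n)) s) ∧
      ∀ j, Real.exp (-(n * (ν.conExponent s ν.mean ((N n s : ℝ) / n) j + ε))) ≤
        1 - ν.bestProb (ν.gaussPost (M n) (N n)) s := by
  obtain ⟨B, hB⟩ : ∃ B : ℝ, (∀ i, |ν.mean s 0 - ν.mean i 0| ≤ B) ∧
      (∀ i j, |ν.mean i (Fin.succ j) - ν.thr j| ≤ B) := by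
    obtain ⟨B₁, hB₁⟩ := (Set.finite_range fun i => |ν.mean s 0 - ν.mean i 0|).bddAbove
    obtain ⟨B₂, hB₂⟩ := (Set.finite_range fun p : Fin k × Fin m =>
      |ν.mean p.1 p.2.succ - ν.thr p.2|).bddAbove
    exact ⟨max B₁ B₂, fun i => (hB₁ ⟨i, rfl⟩).trans (le_max_left _ _),
      fun i j => (hB₂ ⟨(i, j), rfl⟩).trans (le_max_right _ _)⟩
  -- At most `m + 2` coordinates are constrained: two objective means and `m` constraint means.
  have hε' : 0 < ε / (m + 2) := by positivity
  have htail : ∀ᶠ n : ℕ in atTop, ∀ i j, ∀ d e, 0 ≤ d → d ≤ e + |M n i j - ν.mean i j| → 0 ≤ e →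
      e ≤ B → tailCost d (ν.postVar (N n) i j) ≤
        n * ((N n i : ℝ) / n * (e ^ 2 / (2 * ν.var i j)) + ε / (m + 2)) := by
    rw [eventually_all]; intro i
    rw [eventually_all]; intro j
    exact eventually_tailCost_le (h.pos.mono fun n hn => hn i) (h.tendsto_sqrt_mul i j)
      (fun n => h.le_self n i) (ν.var_pos' i j) hε'
  filter_upwards [h.pos, htail, eventually_gt_atTop 0] with n hpos htail hn
  have hn0 : (0 : ℝ) < n := by exact_mod_cast hn
  constructor
  · intro i hi
    refine le_trans ?_ (Problem.beat_le_one_sub_bestProb hi)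
    obtain ⟨x, hx, hx1, hx2⟩ := exists_level (ν.var_pos' i 0) (ν.var_pos' s 0)
      (h.weight_mem n i).1 (h.weight_mem n s).1 (ν.mean i 0) (ν.mean s 0)
    refine le_trans (Real.exp_le_exp.2 (neg_le_neg ?_)) (Problem.gaussPost_beat_ge hpos hi x)
    have h1 := htail i 0 (max (x - M n i 0) 0) (max (x - ν.mean i 0) 0) (le_max_right _ _)
      (max_sub_zero_le_add _ _ _) (le_max_right _ _) (hx1.trans (hB.1 i))
    have h2 := htail s 0 (max (M n s 0 - x) 0) (max (ν.mean s 0 - x) 0) (le_max_right _ _)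
      (max_sub_zero_le_add' _ _ _) (le_max_right _ _) (hx2.trans (hB.1 i))
    have h3 : ∀ j : Fin m, tailCost (max (M n i j.succ - ν.thr j) 0) (ν.postVar (N n) i j.succ) ≤
        n * ((N n i : ℝ) / n * ((max (ν.mean i j.succ - ν.thr j) 0) ^ 2 /
          (2 * ν.var i j.succ)) + ε / (m + 2)) := fun j =>
      htail i j.succ _ _ (le_max_right _ _) (max_sub_zero_le_add' _ _ _) (le_max_right _ _)
        ((max_le (le_abs_self _) (abs_nonneg _)).trans (hB.2 i j))
    refine (add_le_add (add_le_add h1 (Finset.sum_le_sum fun j _ => h3 j)) h2).trans (le_of_eq ?_)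
    unfold Problem.exponent
    rw [← hx, ← Finset.mul_sum, Finset.sum_add_distrib, ← Finset.mul_sum]
    simp only [Finset.sum_const, Finset.card_univ, Fintype.card_fin, nsmul_eq_mul]
    have hm : ε = ε / (m + 2) * (m + 2) := by field_simp
    rw [← mul_add, ← mul_add]
    congr 1
    linear_combination (-1 : ℝ) * hm
  · intro j
    refine le_trans ?_ (Problem.violate_le_one_sub_bestProb j)
    refine le_trans (Real.exp_le_exp.2 (neg_le_neg ?_)) (Problem.gaussPost_violate_ge hpos j)
    have h1 := htail s j.succ (max (ν.thr j - M n s j.succ) 0)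
      (max (ν.thr j - ν.mean s j.succ) 0) (le_max_right _ _) (max_sub_zero_le_add _ _ _)
      (le_max_right _ _) ((max_le (by rw [abs_sub_comm]; exact le_abs_self _)
        (abs_nonneg _)).trans (hB.2 s j))
    refine h1.trans ?_
    unfold Problem.conExponent
    gcongr
    exact div_le_self hε.le (by linarith [(Nat.cast_nonneg m : (0 : ℝ) ≤ m)])

lemma pathRate_le_of_exp_le {n : ℕ} (hn : 0 < n) {E : ℝ}
    (h : Real.exp (-(n * E)) ≤ 1 - ν.bestProb (ν.gaussPost (M n) (N n)) s) :
    pathRate ν N M s n ≤ E := by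
  have hn0 : (0 : ℝ) < n := by exact_mod_cast hn
  have h1 := Real.log_le_log (Real.exp_pos _) h
  rw [Real.log_exp] at h1
  unfold pathRate
  rw [neg_mul, one_div, neg_le, ← div_eq_inv_mul, le_div_iff₀ hn0]
  linarith

lemma eventually_pathRate_le (h : SamplePath ν N M) (s : Fin k) {ε : ℝ} (hε : 0 < ε) :
    ∀ᶠ n : ℕ in atTop,
      (∀ i, i ≠ s → pathRate ν N M s n ≤
        ν.exponent s ν.mean ((N n s : ℝ) / n) ((N n i : ℝ) / n) i + ε) ∧
      ∀ j, pathRate ν N M s n ≤ ν.conExponent s ν.mean ((N n s : ℝ) / n) j + ε := by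
  filter_upwards [h.eventually_exp_le s hε, eventually_gt_atTop 0] with n hn hn0
  exact ⟨fun i hi => pathRate_le_of_exp_le hn0 (hn.1 i hi),
    fun j => pathRate_le_of_exp_le hn0 (hn.2 j)⟩

/-- No allocation has a rate larger than that of an optimal proportion. -/
theorem eventually_pathRate_le_optimal (h : SamplePath ν N M) (hk : 2 ≤ k) (hs : ν.IsUniqueBest s)
    (hb : ν.NoBoundary) {b : ℝ} (hopt : ν.IsOptimalBeta s b) {ε : ℝ} (hε : 0 < ε) :
    ∀ᶠ n : ℕ in atTop, pathRate ν N M s n ≤ ν.Gam s b + ε := by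
  filter_upwards [h.eventually_pathRate_le s (half_pos hε)] with n hn
  -- A larger rate would force all exponents at the current proportions above `Γ_b + ε / 2`, hence
  -- also `Γ` at the current proportion of `s`, against the maximality of `b`.
  by_contra! hlt
  have hpos := Problem.gam_pos hk hs hb hopt.1
  obtain ⟨h1, h2⟩ := Problem.le_gam_of_le_exponents hk hs (w := fun i => (N n i : ℝ) / n)
    (fun i => (h.weight_mem n i).1) (h.sum_weight_le n) (x := ν.Gam s b + ε / 2) (by linarith)
    (fun i hi => by linarith [hn.1 i hi]) (fun j => by linarith [hn.2 j])
  linarith [hopt.2 _ h1]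

/-- The rate of an allocation that gives the proportion `β` to arm `s` is at most `Γ_β`. -/
theorem eventually_pathRate_le_gam (h : SamplePath ν N M) (hk : 2 ≤ k) (hs : ν.IsUniqueBest s)
    (hβ : β ∈ Ioo (0 : ℝ) 1) (hw : Tendsto (fun n : ℕ => (N n s : ℝ) / n) atTop (𝓝 β)) {ε : ℝ}
    (hε : 0 < ε) : ∀ᶠ n : ℕ in atTop, pathRate ν N M s n ≤ ν.Gam s β + ε := by
  have hα := Problem.isOptimalRates_optRates hk hs hβ
  set α := ν.optRates s β
  have hcont : ∀ᶠ δ in 𝓝[>] (0 : ℝ), ∀ i, i ≠ s →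
      ν.exponent s ν.mean (β + δ) (α i + δ) i < ν.exponent s ν.mean β (α i) i + ε / 2 := by
    rw [eventually_all]; intro i
    by_cases hi : i = s
    · exact Eventually.of_forall fun δ h => absurd hi h
    have h1 := Problem.continuousOn_exponent (ν := ν) (s := s) ν.mean i (β, α i)
      ⟨hβ.1.le, (hα.2.1 i hi).le⟩
    have h2 : Tendsto (fun δ : ℝ => (β + δ, α i + δ)) (𝓝[>] 0)
        (𝓝[Ici 0 ×ˢ Ici 0] (β, α i)) := by
      refine tendsto_nhdsWithin_iff.2 ⟨?_, ?_⟩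
      · have : Continuous fun δ : ℝ => (β + δ, α i + δ) := by fun_prop
        simpa using (this.tendsto 0).mono_left nhdsWithin_le_nhds
      · filter_upwards [self_mem_nhdsWithin] with δ hδ
        exact ⟨add_nonneg hβ.1.le (le_of_lt hδ), add_nonneg (hα.2.1 i hi).le (le_of_lt hδ)⟩
    filter_upwards [(h1.tendsto.comp h2).eventually_lt_const
      (show ν.exponent s ν.mean β (α i) i < ν.exponent s ν.mean β (α i) i + ε / 2 by linarith)]
      with δ hδ _ using hδ
  obtain ⟨δ, hδ, hδ0⟩ := (hcont.and self_mem_nhdsWithin).exists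
  replace hδ0 : 0 < δ := hδ0
  have hcon : ∀ᶠ n : ℕ in atTop, ∀ j, ν.conExponent s ν.mean ((N n s : ℝ) / n) j <
      ν.conExponent s ν.mean β j + ε / 2 := by
    rw [eventually_all]; intro j
    exact (hw.mul_const _).eventually_lt_const (by unfold Problem.conExponent; linarith)
  filter_upwards [h.eventually_pathRate_le s (half_pos hε), hcon,
    hw.eventually_lt_const (show β < β + δ by linarith),
    hw.eventually_const_lt (show β - δ < β by linarith)] with n hn hcon hlt hgt
  have hsum := h.sum_weight_le n
  rw [← Finset.add_sum_erase _ _ (Finset.mem_univ s)] at hsum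
  have hcard : (1 : ℝ) ≤ ((Finset.univ.erase s).card : ℝ) := by
    exact_mod_cast (Problem.erase_nonempty hk s).card_pos
  -- Lowering each of the other proportions by `δ` compensates for a deficit of at most `δ` in the
  -- proportion of `s`, since there is at least one other arm.
  obtain ⟨i, hi, hle⟩ := hα.exists_le hk (w := fun i => (N n i : ℝ) / n - δ) (by
    rw [Finset.sum_sub_distrib, Finset.sum_const, nsmul_eq_mul]
    nlinarith)
  have h1 : ν.exponent s ν.mean ((N n s : ℝ) / n) ((N n i : ℝ) / n) i ≤
      ν.exponent s ν.mean (β + δ) (α i + δ) i :=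
    Problem.exponent_mono _ (h.weight_mem n i).1 (by linarith) (h.weight_mem n s).1 hlt.le i
  have h2 : pathRate ν N M s n - ε ≤ ν.Gam s β := by
    refine Problem.le_gam hk hs hβ (fun i' hi' => ?_) fun j => ?_
    · rw [hα.exponent_eq hs hβ hi' hi]
      linarith [hn.1 i hi, hδ i hi]
    · linarith [hn.2 j, hcon j]
  linarith

end SamplePath

/-! ### Counting argument: no arm stays deficient for long -/

section counting

variable {k : ℕ} {N : ℕ → Fin k → ℕ} {J : ℕ → Fin k} {s : Fin k} {a : Fin k → ℝ} {β : ℝ}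

/-- If arm `l` is not pulled in the rounds of `(τ, n)` in which it has at least `c t` samples, its
sample size grows to at most `c n + 1` in this window. -/
lemma count_le_max (hstep : ∀ t, 1 ≤ t → ∀ i, N (t + 1) i = N t i + if J t = i then 1 else 0)
    {l : Fin k} {c : ℝ} (hc : 0 ≤ c) {τ : ℕ} (hτ : 1 ≤ τ) (n : ℕ) (hτn : τ < n)
    (h : ∀ t, τ < t → t < n → c * t ≤ N t l → J t ≠ l) :
    (N n l : ℝ) ≤ max (N τ l : ℝ) (c * n) + 1 := by
  induction n, hτn using Nat.le_induction with
  | base =>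
    rw [Nat.succ_eq_add_one, hstep τ hτ l]
    push_cast
    have := le_max_left (N τ l : ℝ) (c * ((τ : ℝ) + 1))
    split_ifs <;> linarith
  | succ n hn ih =>
    have hn' : τ + 1 ≤ n := hn
    have ih := ih fun t h1 h2 => h t h1 (by omega)
    have hmono : max (N τ l : ℝ) (c * n) ≤ max (N τ l : ℝ) (c * ((n + 1 : ℕ) : ℝ)) := by
      push_cast
      gcongr
      linarith
    rw [hstep n (by omega) l]
    split_ifs with hJ
    -- A pull occurs only below the threshold, so it overshoots by at most one.
    · have h1 : (N n l : ℝ) < c * n := by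
        by_contra! hle
        exact h n (by omega) (by omega) hle hJ
      have := le_max_right (N τ l : ℝ) (c * n)
      push_cast at hmono ⊢
      linarith
    · push_cast at hmono ⊢
      linarith

/-- If arms with many samples are not pulled while some arm has few samples, then in the long run
no arm has few samples. -/
theorem eventually_le_count
    (hstep : ∀ t, 1 ≤ t → ∀ i, N (t + 1) i = N t i + if J t = i then 1 else 0)
    (hsum : ∀ n, ∑ i, N n i = n - 1) (hmono : ∀ i, Monotone fun n => N n i)
    (hw : Tendsto (fun n : ℕ => (N n s : ℝ) / n) atTop (𝓝 β))
    (ha0 : ∀ i, i ≠ s → 0 ≤ a i) (ha1 : ∀ i, i ≠ s → a i ≤ 1)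
    (ha : ∑ i ∈ Finset.univ.erase s, a i < 1 - β)
    (h : ∀ ζ > 0, ∀ᶠ n : ℕ in atTop, (∃ i, i ≠ s ∧ (N n i : ℝ) < a i * n) →
      ∀ l, l ≠ s → (a l + ζ) * n ≤ N n l → J n ≠ l) {η : ℝ} (hη : 0 < η) :
    ∀ᶠ n : ℕ in atTop, ∀ i, i ≠ s → (a i - η) * n ≤ N n i := by
  set A := Finset.univ.erase s with hA
  set κ := 1 - β - ∑ i ∈ A, a i with hκ
  have hκ0 : 0 < κ := by linarith
  set K : ℝ := (A.card : ℝ) with hK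
  have hK0 : 0 ≤ K := Nat.cast_nonneg _
  set η' := min η (1 / 2) with hη'
  have hη'0 : 0 < η' := by positivity
  -- The multiples of `ζ * n` to be absorbed are `K` from the thresholds, `K` from the summands `1`
  -- once `ζ * n ≥ 1`, and `2` from the error of the count of `s` at the two ends of a window; one
  -- is to spare.
  set ζ := η' * κ / (2 * K + 3) with hζ
  have hζ0 : 0 < ζ := by positivity
  have hζκ : (2 * K + 3) * ζ = η' * κ := by rw [hζ]; field_simp
  obtain ⟨n₂, hn₂⟩ := eventually_atTop.1 ((h ζ hζ0).and
    ((hw.eventually_lt_const (show β < β + ζ by linarith)).and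
    ((hw.eventually_const_lt (show β - ζ < β by linarith)).and (eventually_ge_atTop 1))))
  obtain ⟨n₃, hn₃⟩ := exists_nat_ge (1 / ζ)
  have hNs : ∀ n, n₂ ≤ n → |(N n s : ℝ) - β * n| ≤ ζ * n := by
    intro n hn
    obtain ⟨-, h1, h2, h3⟩ := hn₂ n hn
    have hn0 : (0 : ℝ) < n := by exact_mod_cast h3
    rw [div_lt_iff₀ hn0] at h1
    rw [lt_div_iff₀ hn0] at h2
    rw [abs_le]
    constructor <;> linarith
  have hsumA : ∀ n, 1 ≤ n → ∑ i ∈ A, (N n i : ℝ) = n - 1 - N n s := by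
    intro n hn
    have h1 := hsum n
    rw [← Finset.add_sum_erase _ _ (Finset.mem_univ s)] at h1
    have h2 : ((N n s + ∑ i ∈ A, N n i : ℕ) : ℝ) = ((n - 1 : ℕ) : ℝ) := by rw [h1]
    push_cast [Nat.cast_sub hn] at h2
    linarith
  -- On a window of deficient rounds each arm `l` grows essentially by at most `a l * (n - τ)`, and
  -- `s` by about `β * (n - τ)`. One pull is made per round, so the missing proportion `κ` bounds
  -- the length of the window. Here `e` is the deficit at its start.
  have hwin : ∀ τ n, n₂ ≤ τ → τ < n → n₃ ≤ n →
      (∀ t, τ < t → t < n → ∃ i, i ≠ s ∧ (N t i : ℝ) < a i * t) → ∀ e : ℝ,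
      (∀ l, l ≠ s → a l * τ ≤ N τ l + e) → 0 ≤ e →
      κ * ((n : ℝ) - τ) ≤ η' * κ * n + K * e := by
    intro τ n hτ hτn hn hdef e hle he
    have hτ1 : 1 ≤ τ := (hn₂ τ hτ).2.2.2
    have hn' : (n₃ : ℝ) ≤ n := by exact_mod_cast hn
    have hτn' : (τ : ℝ) < n := by exact_mod_cast hτn
    have hζn : 1 ≤ ζ * n := by
      have := hn₃.trans hn'
      rwa [div_le_iff₀' hζ0] at this
    have h1 : ∀ l ∈ A, (N n l : ℝ) - N τ l ≤ a l * (n - τ) + ζ * n + 1 + e := by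
      intro l hl
      have hl' := Finset.ne_of_mem_erase hl
      have hcm := count_le_max (N := N) (J := J) hstep (l := l) (c := a l + ζ)
        (by linarith [ha0 l hl']) hτ1 n hτn
        (fun t h1 h2 => (hn₂ t (by omega)).1 (hdef t h1 h2) l hl')
      have h2 := hle l hl'
      have h3 : 0 ≤ a l * ((n : ℝ) - τ) := mul_nonneg (ha0 l hl') (by linarith)
      rcases le_total (N τ l : ℝ) ((a l + ζ) * n) with h4 | h4
      · rw [max_eq_right h4] at hcm
        linarith
      · rw [max_eq_left h4] at hcm
        linarith
    have h2 := Finset.sum_le_sum h1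
    rw [Finset.sum_sub_distrib, hsumA n (by omega), hsumA τ hτ1] at h2
    simp only [Finset.sum_add_distrib, ← Finset.sum_mul, Finset.sum_const, nsmul_eq_mul] at h2
    have h3 := abs_le.1 (hNs n (by omega))
    have h4 := abs_le.1 (hNs τ hτ)
    have h5 : ζ * τ ≤ ζ * n := by gcongr
    have h6 : K * 1 ≤ K * (ζ * n) := by gcongr
    have h7 : η' * κ * n = (2 * K + 3) * ζ * n := by rw [hζκ]
    have h8 : ∑ i ∈ A, a i = 1 - β - κ := by rw [hκ]; ring
    rw [h8] at h2
    nlinarith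
  -- Deficiency cannot last forever: with initial deficit at most `n₂`, because `a l ≤ 1`, and `η' ≤
  -- 1 / 2`, the window bound fails for large `n`.
  have hnd : ∃ τ, n₂ ≤ τ ∧ ∀ i, i ≠ s → a i * τ ≤ N τ i := by
    by_contra! hcon
    obtain ⟨n, hn⟩ := exists_nat_gt (2 * ((κ * n₂ + K * n₂) / κ) + n₂ + n₃ : ℝ)
    have hp : 0 ≤ 2 * ((κ * n₂ + K * n₂) / κ) := by positivity
    have hc1 : (0 : ℝ) ≤ n₂ := Nat.cast_nonneg _
    have hc2 : (0 : ℝ) ≤ n₃ := Nat.cast_nonneg _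
    have hn1 : n₂ < n := by
      have : (n₂ : ℝ) < n := by linarith
      exact_mod_cast this
    have hn2 : n₃ ≤ n := by
      have : (n₃ : ℝ) < n := by linarith
      exact_mod_cast this.le
    have h1 := hwin n₂ n le_rfl hn1 hn2 (fun t ht _ => hcon t ht.le) n₂ (fun l hl => by
      have : a l * n₂ ≤ 1 * n₂ := by gcongr; exact ha1 l hl
      have : (0 : ℝ) ≤ N n₂ l := Nat.cast_nonneg _
      linarith) (Nat.cast_nonneg _)
    have h2 : η' * κ * n ≤ 1 / 2 * κ * n := by gcongr; exact min_le_right _ _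
    have h3 : 2 * ((κ * n₂ + K * n₂) / κ) < n := by linarith
    rw [← mul_div_assoc, div_lt_iff₀ hκ0] at h3
    nlinarith
  obtain ⟨τ₀, hτ₀, hτ₀'⟩ := hnd
  filter_upwards [eventually_ge_atTop τ₀, eventually_ge_atTop n₃] with n hn hn3
  classical
  -- From the last round `τ` without deficiency up to `n` at most `η' * n` rounds pass, and counts
  -- do not decrease meanwhile.
  obtain ⟨τ, hτ, hmax⟩ : ∃ τ, (τ₀ ≤ τ ∧ τ ≤ n ∧ ∀ i, i ≠ s → a i * τ ≤ N τ i) ∧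
      ∀ t, τ < t → t < n → ∃ i, i ≠ s ∧ (N t i : ℝ) < a i * t := by
    set S := (Finset.Icc τ₀ n).filter fun τ => ∀ i, i ≠ s → a i * τ ≤ N τ i with hS
    have hne : S.Nonempty := ⟨τ₀, by simp only [hS, Finset.mem_filter, Finset.mem_Icc]; exact
      ⟨⟨le_rfl, hn⟩, hτ₀'⟩⟩
    have hmem := Finset.mem_filter.1 (S.max'_mem hne)
    rw [Finset.mem_Icc] at hmem
    refine ⟨S.max' hne, ⟨hmem.1.1, hmem.1.2, hmem.2⟩, fun t h1 h2 => ?_⟩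
    by_contra! hcon
    have : t ∈ S := by
      simp only [hS, Finset.mem_filter, Finset.mem_Icc]
      exact ⟨⟨by omega, h2.le⟩, hcon⟩
    exact absurd (S.le_max' t this) (by omega)
  intro i hi
  have hn0 : (0 : ℝ) ≤ n := Nat.cast_nonneg n
  have hηn : η' * n ≤ η * n := by gcongr; exact min_le_left _ _
  rcases hτ.2.1.eq_or_lt with rfl | hlt
  · have := hτ.2.2 i hi
    nlinarith
  · have h1 := hwin τ n (by omega) hlt hn3 hmax 0 (fun l hl => by simpa using hτ.2.2 l hl) le_rfl
    have h2 : (n : ℝ) - τ ≤ η' * n := by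
      rw [mul_zero, add_zero, mul_comm η' κ, mul_assoc] at h1
      exact le_of_mul_le_mul_left h1 hκ0
    have h3 : (N τ i : ℝ) ≤ N n i := by exact_mod_cast hmono i hlt.le
    have h4 := hτ.2.2 i hi
    have h5 : a i * ((n : ℝ) - τ) ≤ 1 * ((n : ℝ) - τ) := by
      have : (τ : ℝ) < n := by exact_mod_cast hlt
      exact mul_le_mul_of_nonneg_right (ha1 i hi) (by linarith)
    linarith

end counting

/-! ### Upper bounds of the posterior probabilities when all arms are sampled infinitely often -/

namespace SamplePath

variable {k m : ℕ} {ν : Problem k m} {N : ℕ → Fin k → ℕ} {M : ℕ → Fin k → Fin (m + 1) → ℝ}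
  {s : Fin k} {β : ℝ}

/-- The exponent is at least the smaller of the two sample sizes times a continuous function of the
sample means, whose limit is positive by `gap_pos`. No growth rate of the sample sizes is needed. -/
lemma tendsto_exponent_atTop (h : SamplePath ν N M) (hs : ν.IsUniqueBest s)
    (hN : ∀ i, Tendsto (fun n => N n i) atTop atTop) {i : Fin k} (hi : i ≠ s) :
    Tendsto (fun n => ν.exponent s (M n) (N n s) (N n i) i) atTop atTop := by
  have hu := ν.var_pos' i 0
  have hv := ν.var_pos' s 0
  set A : (Fin k → Fin (m + 1) → ℝ) → ℝ := fun M =>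
    max (M s 0 - M i 0) 0 ^ 2 / 2 / (ν.var i 0 + ν.var s 0) +
      ∑ j : Fin m, (max (M i j.succ - ν.thr j) 0) ^ 2 / (2 * (ν.var i j.succ : ℝ)) with hA
  have hM := fun i j => h.tendsto_mean i (hN i) j
  have hAt : Tendsto (fun n => A (M n)) atTop (𝓝 (A ν.mean)) := by
    refine Tendsto.add ?_ (tendsto_finsetSum _ fun j _ => ?_)
    · exact (((((hM s 0).sub (hM i 0)).max tendsto_const_nhds).pow 2).div_const _).div_const _
    · exact ((((hM i j.succ).sub_const _).max tendsto_const_nhds).pow 2).div_const _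
  have hApos : 0 < A ν.mean := by
    have h2 := Problem.conSum_nonneg (ν := ν) ν.mean i
    simp only [hA]
    rcases Problem.gap_pos hs hi with h0 | h0 <;> positivity
  have hmin : Tendsto (fun n => min (N n i : ℝ) (N n s)) atTop atTop :=
    tendsto_atTop.2 fun b => by
      filter_upwards [(tendsto_natCast_atTop_atTop (R := ℝ).comp (hN i)).eventually_ge_atTop b,
        (tendsto_natCast_atTop_atTop (R := ℝ).comp (hN s)).eventually_ge_atTop b] with n h1 h2
        using le_min h1 h2
  refine tendsto_atTop_mono (fun n => ?_) (hmin.atTop_mul_pos hApos hAt)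
  have h1 := le_pairRate hu hv (Nat.cast_nonneg (α := ℝ) (N n i)) (Nat.cast_nonneg (N n s))
  have h2 := Problem.conSum_nonneg (ν := ν) (M n) i
  have h3 : min (N n i : ℝ) (N n s) ≤ N n i := min_le_left _ _
  unfold Problem.exponent
  simp only [hA]
  rw [mul_add]
  refine add_le_add ?_ (by gcongr)
  calc min (N n i : ℝ) (N n s) * (max (M n s 0 - M n i 0) 0 ^ 2 / 2 / (ν.var i 0 + ν.var s 0)) =
      max (M n s 0 - M n i 0) 0 ^ 2 / 2 * (min (N n i : ℝ) (N n s) / (ν.var i 0 + ν.var s 0)) := by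
        ring
    _ ≤ _ := by gcongr

lemma tendsto_conExponent_atTop (h : SamplePath ν N M) (hs : ν.IsUniqueBest s)
    (hb : ν.NoBoundary) (hN : ∀ i, Tendsto (fun n => N n i) atTop atTop) (j : Fin m) :
    Tendsto (fun n => ν.conExponent s (M n) (N n s) j) atTop atTop := by
  refine (tendsto_natCast_atTop_atTop.comp (hN s)).atTop_mul_pos
    (C := max (ν.thr j - ν.mean s j.succ) 0 ^ 2 / (2 * (ν.var s j.succ : ℝ))) ?_ ?_
  · have := ν.var_pos' s j.succ
    have : 0 < max (ν.thr j - ν.mean s j.succ) 0 := by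
      have := lt_of_le_of_ne (hs.1 j) (hb s j)
      simp [this]
    positivity
  · exact (((h.tendsto_mean s (hN s) j.succ).const_sub _).max tendsto_const_nhds).pow 2
      |>.div_const _

/-- The exponents at the posterior means are uniformly close to those at the true means. -/
lemma eventually_exponent_mean_le (h : SamplePath ν N M)
    (hN : ∀ i, Tendsto (fun n => N n i) atTop atTop) (s : Fin k) {ε : ℝ} (hε : 0 < ε) :
    ∀ᶠ n in atTop, (∀ i, ∀ a ∈ Icc (0 : ℝ) 1, ∀ b ∈ Icc (0 : ℝ) 1,
      ν.exponent s ν.mean b a i ≤ ν.exponent s (M n) b a i + ε) ∧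
      ∀ j, ∀ b ∈ Icc (0 : ℝ) 1, ν.conExponent s ν.mean b j ≤ ν.conExponent s (M n) b j + ε := by
  have hM := fun i j => h.tendsto_mean i (hN i) j
  refine Filter.Eventually.and ?_ ?_
  · rw [eventually_all]; intro i
    have hu := ν.var_pos' i 0
    have hv := ν.var_pos' s 0
    set A : (Fin k → Fin (m + 1) → ℝ) → ℝ := fun M => max (M s 0 - M i 0) 0 ^ 2 / 2 with hA
    set B : (Fin k → Fin (m + 1) → ℝ) → ℝ := fun M =>
      ∑ j : Fin m, (max (M i j.succ - ν.thr j) 0) ^ 2 / (2 * (ν.var i j.succ : ℝ)) with hB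
    have hAt : Tendsto (fun n => A (M n)) atTop (𝓝 (A ν.mean)) :=
      (((hM s 0).sub (hM i 0)).max tendsto_const_nhds).pow 2 |>.div_const _
    have hBt : Tendsto (fun n => B (M n)) atTop (𝓝 (B ν.mean)) :=
      tendsto_finsetSum _ fun j _ =>
        ((((hM i j.succ).sub_const _).max tendsto_const_nhds).pow 2).div_const _
    -- The exponent is linear in `A` and `B`, with coefficients bounded on the unit square; this
    -- gives uniformity in the proportions.
    have herr : Tendsto (fun n => |A ν.mean - A (M n)| / ν.var i 0 + |B ν.mean - B (M n)|) atTop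
        (𝓝 0) := by
      have h1 := ((hAt.const_sub (A ν.mean)).abs.div_const (ν.var i 0 : ℝ)).add
        (hBt.const_sub (B ν.mean)).abs
      simpa using h1
    filter_upwards [herr.eventually_lt_const hε] with n hn a ha b hb
    have h0 := pairRate_nonneg hu hv ha.1 hb.1
    have h1 : pairRate (ν.var i 0) (ν.var s 0) a b ≤ 1 / ν.var i 0 :=
      (pairRate_le hu hv ha.1 hb.1).trans (by gcongr; exact ha.2)
    have h2 : (A ν.mean - A (M n)) * pairRate (ν.var i 0) (ν.var s 0) a b ≤
        |A ν.mean - A (M n)| * (1 / ν.var i 0) :=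
      mul_le_mul (le_abs_self _) h1 h0 (abs_nonneg _)
    have h3 : a * (B ν.mean - B (M n)) ≤ 1 * |B ν.mean - B (M n)| :=
      (mul_le_mul_of_nonneg_left (le_abs_self _) ha.1).trans
        (mul_le_mul_of_nonneg_right ha.2 (abs_nonneg _))
    rw [mul_one_div] at h2
    change A ν.mean * pairRate (ν.var i 0) (ν.var s 0) a b + a * B ν.mean ≤
      A (M n) * pairRate (ν.var i 0) (ν.var s 0) a b + a * B (M n) + ε
    linarith
  · rw [eventually_all]; intro j
    set B : (Fin k → Fin (m + 1) → ℝ) → ℝ := fun M =>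
      max (ν.thr j - M s j.succ) 0 ^ 2 / (2 * (ν.var s j.succ : ℝ)) with hB
    have hBt : Tendsto (fun n => B (M n)) atTop (𝓝 (B ν.mean)) :=
      (((hM s j.succ).const_sub _).max tendsto_const_nhds).pow 2 |>.div_const _
    have herr : Tendsto (fun n => |B ν.mean - B (M n)|) atTop (𝓝 0) := by
      simpa using (hBt.const_sub (B ν.mean)).abs
    filter_upwards [herr.eventually_lt_const hε] with n hn b hb
    have h3 : b * (B ν.mean - B (M n)) ≤ 1 * |B ν.mean - B (M n)| :=
      (mul_le_mul_of_nonneg_left (le_abs_self _) hb.1).trans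
        (mul_le_mul_of_nonneg_right hb.2 (abs_nonneg _))
    change b * B ν.mean ≤ b * B (M n) + ε
    linarith

/-- Upper bounds of the posterior probabilities of the unlikely events. -/
lemma eventually_le_exp (h : SamplePath ν N M) (hN : ∀ i, Tendsto (fun n => N n i) atTop atTop)
    (s : Fin k) {ε : ℝ} (hε : 0 < ε) : ∀ᶠ n : ℕ in atTop,
      (∀ i, i ≠ s → ν.beatProb (ν.gaussPost (M n) (N n)) s i ≤
        Real.exp (-(n * (ν.exponent s ν.mean ((N n s : ℝ) / n) ((N n i : ℝ) / n) i - ε)))) ∧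
      ∀ r, (∀ j, r ≤ ν.conExponent s ν.mean ((N n s : ℝ) / n) j) →
        ν.violateProb (ν.gaussPost (M n) (N n)) s ≤ m * Real.exp (-(n * (r - ε))) := by
  filter_upwards [h.eventually_exponent_mean_le hN s hε, h.pos, eventually_gt_atTop 0]
    with n hn hpos hn0
  have hn0' : (0 : ℝ) < n := by exact_mod_cast hn0
  have hmul : ∀ i, (n : ℝ) * ((N n i : ℝ) / n) = N n i := fun i => mul_div_cancel₀ _ hn0'.ne'
  constructor
  · intro i hi
    refine (Problem.gaussPost_beat_le hpos hi).trans (Real.exp_le_exp.2 (neg_le_neg ?_))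
    have h1 := hn.1 i _ (h.weight_mem n i) _ (h.weight_mem n s)
    rw [← hmul i, ← hmul s, Problem.exponent_mul, hmul, hmul]
    gcongr
    linarith
  · intro r hr
    unfold Problem.violateProb
    refine (Finset.sum_le_sum (g := fun _ => Real.exp (-(n * (r - ε)))) fun j _ => ?_).trans
      (by simp)
    refine (Problem.gaussPost_violate_le hpos j).trans (Real.exp_le_exp.2 (neg_le_neg ?_))
    have h1 := hn.2 j _ (h.weight_mem n s)
    rw [← hmul s, Problem.conExponent_mul]
    gcongr
    linarith [hr j]

end SamplePath

/-! ### The rate of top-two Thompson sampling along a path -/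

/-- A sample path of top-two Thompson sampling: the arm `J t` is pulled in round `t`, with
conditional probability `p t`. -/
structure TopTwoPath {k m : ℕ} (ν : Problem k m) (N : ℕ → Fin k → ℕ)
    (M : ℕ → Fin k → Fin (m + 1) → ℝ) (J : ℕ → Fin k) (p : ℕ → Fin k → ℝ) (β : ℝ) : Prop
    extends SamplePath ν N M where
  step : ∀ t, 1 ≤ t → ∀ i, N (t + 1) i = N t i + if J t = i then 1 else 0
  nonneg : ∀ t i, 0 ≤ p t i
  lln : ∀ i, Tendsto (fun n : ℕ => ((N n i : ℝ) - ∑ t ∈ Finset.Ico 1 n, p t i) / n) atTop (𝓝 0)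
  rare : ∀ i (q : ℕ), ∀ᶠ t : ℕ in atTop, p t i ≤ Real.exp (-((q : ℝ) + 1)⁻¹ * t) → J t ≠ i
  law : ∀ᶠ t in atTop, ∀ i, p t i = ν.pullProb β (ν.gaussPost (M t) (N t)) i

namespace TopTwoPath

variable {k m : ℕ} {ν : Problem k m} {N : ℕ → Fin k → ℕ} {M : ℕ → Fin k → Fin (m + 1) → ℝ}
  {s : Fin k} {β : ℝ} {J : ℕ → Fin k} {p : ℕ → Fin k → ℝ}

/-- An arm whose conditional probability is bounded below is pulled infinitely often. -/
lemma tendsto_count_of_le (h : TopTwoPath ν N M J p β) {i : Fin k} {c : ℝ} (hc : 0 < c)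
    (hp : ∀ᶠ t in atTop, c ≤ p t i) : Tendsto (fun n => N n i) atTop atTop := by
  by_contra hN
  obtain ⟨n₀, hn₀⟩ := h.eventually_const hN
  obtain ⟨t₀, ht₀⟩ := eventually_atTop.1 (hp.and (eventually_ge_atTop 1))
  -- A frozen count against linearly growing conditional probabilities would give a limit of at most
  -- `-c` in `lln`, where it is zero.
  have h1 : Tendsto (fun n : ℕ => (N n₀ i : ℝ) / n + c * t₀ / n - c) atTop (𝓝 (0 + 0 - c)) :=
    ((tendsto_natCast_atTop_atTop.const_div_atTop _).add
      (tendsto_natCast_atTop_atTop.const_div_atTop _)).sub_const c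
  have h2 := le_of_tendsto_of_tendsto (h.lln i) h1 (by
    filter_upwards [eventually_ge_atTop n₀, eventually_ge_atTop t₀, eventually_gt_atTop 0]
      with n hn hnt hn0
    have hn0' : (0 : ℝ) < n := by exact_mod_cast hn0
    have hsum : c * ((n : ℝ) - t₀) ≤ ∑ t ∈ Finset.Ico 1 n, p t i := by
      have h3 : ∑ t ∈ Finset.Ico t₀ n, p t i ≤ ∑ t ∈ Finset.Ico 1 n, p t i :=
        Finset.sum_le_sum_of_subset_of_nonneg
          (Finset.Ico_subset_Ico_left (ht₀ t₀ le_rfl).2) fun t _ _ => h.nonneg t i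
      refine le_trans ?_ h3
      have h4 := Finset.sum_le_sum (s := Finset.Ico t₀ n) (f := fun _ => c) (g := fun t => p t i)
        fun t ht => (ht₀ t (Finset.mem_Ico.1 ht).1).1
      rw [Finset.sum_const, Nat.card_Ico, nsmul_eq_mul, Nat.cast_sub hnt] at h4
      linarith
    rw [(hn₀ n hn).1, ← add_div, div_sub' hn0'.ne']
    exact div_le_div_of_nonneg_right (by linarith) hn0'.le)
  linarith

/-- Every arm is sampled infinitely often. -/
theorem tendsto_count (h : TopTwoPath ν N M J p β) (hβ : β ∈ Ioo (0 : ℝ) 1) (i : Fin k) :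
    Tendsto (fun n => N n i) atTop atTop := by
  by_contra hi
  have hk : 0 < k := i.pos
  obtain ⟨n₀, hn₀⟩ := h.eventually_const hi
  -- The objective sample means of all arms are bounded above, by convergence or because they are
  -- frozen.
  have hbd : ∀ l, ∃ x, ∀ᶠ n in atTop, M n l 0 ≤ x := by
    intro l
    by_cases hl : Tendsto (fun n => N n l) atTop atTop
    · exact ⟨ν.mean l 0 + 1, (h.tendsto_mean l hl 0).eventually_le_const (by linarith)⟩
    · obtain ⟨n₁, hn₁⟩ := h.eventually_const hl
      exact ⟨M n₁ l 0, by
        filter_upwards [eventually_ge_atTop n₁] with n hn using ((hn₁ n hn).2 0).le⟩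
  choose x hx using hbd
  obtain ⟨y, hy⟩ := (Set.finite_range x).bddAbove
  -- The posterior of the undersampled arm `i` is frozen, so its cost of exceeding `y` and being
  -- feasible is constant. The others stay below `y`, a level not smaller than their means, at the
  -- cost `tailCost 0`, which does not depend on the variance. Hence `i` would be drawn with
  -- probability bounded below.
  set C : ℝ := ∑ i', if i' = i then tailCost (max (y - M n₀ i 0) 0) (ν.postVar (N n₀) i 0) +
        ∑ j : Fin m, tailCost (max (M n₀ i j.succ - ν.thr j) 0) (ν.postVar (N n₀) i j.succ)
        else (1 / 2 + Real.log (√(2 * Real.pi))) with hC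
  refine hi (h.tendsto_count_of_le (c := β * Real.exp (-C))
    (mul_pos hβ.1 (Real.exp_pos _)) ?_)
  filter_upwards [h.law, h.pos, eventually_all.2 hx, eventually_ge_atTop n₀] with n hlaw hpos hx hn
  rw [hlaw i]
  refine le_trans ?_ (Problem.le_pullProb hβ i)
  refine mul_le_mul_of_nonneg_left ?_ hβ.1.le
  refine le_trans ?_ ((Problem.gaussPost_win_ge hpos i y).trans (Problem.le_candidateProb hk i))
  refine Real.exp_le_exp.2 (neg_le_neg (Finset.sum_le_sum fun i' _ => ?_))
  split_ifs with hi'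
  · simp only [Problem.postVar, (hn₀ n hn).1, (hn₀ n hn).2]
    exact le_rfl
  · rw [max_eq_right (by linarith [hx i', hy ⟨i', rfl⟩])]
    unfold tailCost
    norm_num

/-- The first candidate is the best arm with probability tending to one. -/
lemma tendsto_candidateProb (h : TopTwoPath ν N M J p β) (hs : ν.IsUniqueBest s)
    (hb : ν.NoBoundary) (hβ : β ∈ Ioo (0 : ℝ) 1) :
    Tendsto (fun n => ν.candidateProb (ν.gaussPost (M n) (N n)) s) atTop (𝓝 1) := by
  have hk : 0 < k := s.pos
  have hN := h.tendsto_count hβ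
  set U : ℕ → ℝ := fun n => ∑ i ∈ Finset.univ.erase s,
    (Real.exp (-ν.exponent s (M n) (N n s) (N n i) i) +
      ∑ j : Fin m, Real.exp (-ν.conExponent s (M n) (N n s) j)) with hU
  have hU0 : Tendsto (fun n => 1 - U n) atTop (𝓝 1) := by
    have : Tendsto U atTop (𝓝 (∑ i ∈ Finset.univ.erase s, (0 + ∑ j : Fin m, 0))) := by
      refine tendsto_finsetSum _ fun i hi => Tendsto.add ?_ (tendsto_finsetSum _ fun j _ => ?_)
      · exact Real.tendsto_exp_neg_atTop_nhds_zero.comp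
          (h.tendsto_exponent_atTop hs hN (Finset.ne_of_mem_erase hi))
      · exact Real.tendsto_exp_neg_atTop_nhds_zero.comp (h.tendsto_conExponent_atTop hs hb hN j)
    simpa using this.const_sub 1
  refine tendsto_of_tendsto_of_tendsto_of_le_of_le' hU0 tendsto_const_nhds ?_
    (Eventually.of_forall fun n => Problem.candidateProb_le_one (ν := ν)
      (Q := ν.gaussPost (M n) (N n)) hk s)
  filter_upwards [h.pos] with n hpos
  rw [sub_le_iff_le_add, ← Problem.candidateProb_add_sum (ν := ν)
    (Q := ν.gaussPost (M n) (N n)) hk s]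
  gcongr
  refine Finset.sum_le_sum fun i hi => ?_
  refine (Problem.candidateProb_le (ν := ν) (s := s) (Q := ν.gaussPost (M n) (N n)) hk).trans (add_le_add ?_ ?_)
  · exact Problem.gaussPost_beat_le hpos (Finset.ne_of_mem_erase hi)
  · exact Finset.sum_le_sum fun j _ => Problem.gaussPost_violate_le hpos j

/-- The best arm receives the proportion `β` of the samples. -/
theorem tendsto_weight_best (h : TopTwoPath ν N M J p β) (hs : ν.IsUniqueBest s)
    (hb : ν.NoBoundary) (hβ : β ∈ Ioo (0 : ℝ) 1) :
    Tendsto (fun n : ℕ => (N n s : ℝ) / n) atTop (𝓝 β) := by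
  have hk : 0 < k := s.pos
  have hc := h.tendsto_candidateProb hs hb hβ
  have hp : Tendsto (fun t => p t s) atTop (𝓝 β) := by
    have h1 : Tendsto (fun n => β * ν.candidateProb (ν.gaussPost (M n) (N n)) s) atTop (𝓝 β) := by
      simpa using hc.const_mul β
    have h2 : Tendsto (fun n => β + 2 * (1 - ν.candidateProb (ν.gaussPost (M n) (N n)) s)) atTop
        (𝓝 β) := by
      simpa using ((hc.const_sub 1).const_mul 2).const_add β
    refine tendsto_of_tendsto_of_tendsto_of_le_of_le' h1 h2 ?_ ?_
    · filter_upwards [h.law] with n hn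
      rw [hn s]; exact Problem.le_pullProb hβ s
    · filter_upwards [h.law, hc.eventually_const_le (show (1 / 2 : ℝ) < 1 by norm_num)] with n hn hn'
      rw [hn s]; exact Problem.pullProb_best_le hk hβ hn'
  -- Cesàro averages start at index `0` but rounds start at `1`; the term `p 0 s` is subtracted.
  have h1 : Tendsto (fun n : ℕ => (n : ℝ)⁻¹ * ∑ t ∈ Finset.range n, p t s) atTop (𝓝 β) := hp.cesaro
  have h2 : Tendsto (fun n : ℕ => (p 0 s : ℝ) / n) atTop (𝓝 0) :=
    tendsto_natCast_atTop_atTop.const_div_atTop _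
  have h3 := ((h.lln s).add h1).sub h2
  rw [zero_add, sub_zero] at h3
  refine h3.congr' ?_
  filter_upwards [eventually_gt_atTop 0] with n hn
  rw [Finset.range_eq_Ico, Finset.sum_eq_sum_Ico_succ_bot hn]
  have : (n : ℝ) ≠ 0 := by exact_mod_cast hn.ne'
  field_simp
  simp

/-- While some arm has too few samples, arms with enough samples are not pulled. -/
lemma eventually_pull_ne (h : TopTwoPath ν N M J p β) (hk : 2 ≤ k) (hs : ν.IsUniqueBest s)
    (hb : ν.NoBoundary) (hβ : β ∈ Ioo (0 : ℝ) 1) {ρ : ℝ} (hρ : ρ < ν.Gam s β) {a : Fin k → ℝ}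
    (ha0 : ∀ i, i ≠ s → 0 ≤ a i) (ha : ∀ i, i ≠ s → ν.exponent s ν.mean β (a i) i = ρ) {ζ : ℝ}
    (hζ : 0 < ζ) : ∀ᶠ n : ℕ in atTop, (∃ i, i ≠ s ∧ (N n i : ℝ) < a i * n) →
      ∀ l, l ≠ s → (a l + ζ) * n ≤ N n l → J n ≠ l := by
  have hk0 : 0 < k := by omega
  have hN := h.tendsto_count hβ
  have hw := h.tendsto_weight_best hs hb hβ
  -- By strict monotonicity an excess `ζ` in the proportion lifts the exponent by a fixed gap `g`
  -- above `ρ`, chosen so that the constraint exponents of `s` stay above `ρ + g` as well.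
  obtain ⟨g, ⟨hg1, hg2⟩, hg0⟩ : ∃ g, ((∀ l, l ≠ s → ρ + g < ν.exponent s ν.mean β (a l + ζ) l) ∧
      ρ + g < ν.Gam s β) ∧ 0 < g := by
    have hlim : Tendsto (fun g : ℝ => ρ + g) (𝓝[>] 0) (𝓝 ρ) := by
      have : Continuous fun g : ℝ => ρ + g := by fun_prop
      simpa using (this.tendsto 0).mono_left nhdsWithin_le_nhds
    refine Eventually.exists (f := 𝓝[>] (0 : ℝ)) (Eventually.and (Eventually.and ?_
      (hlim.eventually_lt_const hρ)) self_mem_nhdsWithin)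
    rw [eventually_all]; intro l
    by_cases hl : l = s
    · exact Eventually.of_forall fun g h => absurd hl h
    · have := Problem.exponent_lt (ν := ν) hs (ha0 l hl)
        (show a l < a l + ζ by linarith) hβ.1 hl
      rw [ha l hl] at this
      filter_upwards [hlim.eventually_lt_const this] with g hg _ using hg
  -- Three `ε` are lost in the posterior estimates, which leaves a decay of `5 * ε`; one more
  -- absorbs the constant `8 * (m + 1)`.
  set ε := g / 8 with hε
  have hε0 : 0 < ε := by positivity
  have hcont : ∀ i, ∀ c, 0 ≤ c → Tendsto (fun n : ℕ => ν.exponent s ν.mean ((N n s : ℝ) / n) c i)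
      atTop (𝓝 (ν.exponent s ν.mean β c i)) := by
    intro i c hc
    refine (Problem.continuousOn_exponent (ν := ν) (s := s) ν.mean i (β, c) ⟨hβ.1.le, hc⟩).tendsto.comp
      (tendsto_nhdsWithin_iff.2 ⟨hw.prodMk_nhds tendsto_const_nhds, ?_⟩)
    exact Eventually.of_forall fun n => ⟨(h.weight_mem n s).1, hc⟩
  have h1 : ∀ᶠ n : ℕ in atTop, ∀ i, i ≠ s →
      ν.exponent s ν.mean ((N n s : ℝ) / n) (a i) i < ρ + ε := by
    rw [eventually_all]; intro i
    by_cases hi : i = s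
    · exact Eventually.of_forall fun n h => absurd hi h
    · filter_upwards [(hcont i (a i) (ha0 i hi)).eventually_lt_const
        (show ν.exponent s ν.mean β (a i) i < ρ + ε by rw [ha i hi]; linarith)] with n hn _ using hn
  have h2 : ∀ᶠ n : ℕ in atTop, ∀ i, i ≠ s →
      ρ + g < ν.exponent s ν.mean ((N n s : ℝ) / n) (a i + ζ) i := by
    rw [eventually_all]; intro i
    by_cases hi : i = s
    · exact Eventually.of_forall fun n h => absurd hi h
    · filter_upwards [(hcont i (a i + ζ) (by linarith [ha0 i hi])).eventually_const_lt (hg1 i hi)]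
        with n hn _ using hn
  have h3 : ∀ᶠ n : ℕ in atTop, ∀ j, ρ + g < ν.conExponent s ν.mean ((N n s : ℝ) / n) j := by
    rw [eventually_all]; intro j
    exact (hw.mul_const _).eventually_const_lt (hg2.trans_le (Problem.gam_le_conExponent hs j))
  obtain ⟨q, hq⟩ := exists_nat_gt (1 / ε)
  have hq' : ((q : ℝ) + 1)⁻¹ ≤ ε := by
    rw [inv_le_comm₀ (by positivity) hε0, ← one_div]
    linarith
  have h4 : ∀ᶠ n : ℕ in atTop, Real.log (8 * (m + 1)) < n * ε :=
    (tendsto_natCast_atTop_atTop.atTop_mul_const hε0).eventually_gt_atTop _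
  filter_upwards [h1, h2, h3, h4, h.law, h.eventually_exp_le s hε0, h.eventually_le_exp hN s hε0,
    (h.tendsto_candidateProb hs hb hβ).eventually_const_le (show (1 / 2 : ℝ) < 1 by norm_num),
    eventually_all.2 fun l => h.rare l q, eventually_gt_atTop 0]
    with n h1 h2 h3 h4 hlaw hlow hup hc hrare hn
  rintro ⟨i, hi, hdef⟩ l hl hover
  refine hrare l ?_
  have hn0 : (0 : ℝ) < n := by exact_mod_cast hn
  set Q := ν.gaussPost (M n) (N n)
  have hwi : (N n i : ℝ) / n ≤ a i := (div_le_iff₀ hn0).2 hdef.le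
  have hwl : a l + ζ ≤ (N n l : ℝ) / n := (le_div_iff₀ hn0).2 hover
  have he1 : ν.exponent s ν.mean ((N n s : ℝ) / n) ((N n i : ℝ) / n) i ≤ ρ + ε :=
    (Problem.exponent_mono _ (h.weight_mem n i).1 hwi (h.weight_mem n s).1 le_rfl i).trans
      (h1 i hi).le
  have he2 : ρ + g ≤ ν.exponent s ν.mean ((N n s : ℝ) / n) ((N n l : ℝ) / n) l :=
    (h2 l hl).le.trans (Problem.exponent_mono _ (by linarith [ha0 l hl]) hwl
      (h.weight_mem n s).1 le_rfl l)
  -- The deficient arm `i` keeps the probability of a first candidate other than `s` from being too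
  -- small.
  have hbelow : Real.exp (-(n * (ρ + 2 * ε))) / 2 ≤ 1 - ν.candidateProb Q s := by
    refine le_trans ?_ (Problem.one_sub_bestProb_le_candidate hk)
    gcongr
    refine le_trans (Real.exp_le_exp.2 (neg_le_neg ?_)) (hlow.1 i hi)
    exact mul_le_mul_of_nonneg_left (by linarith) hn0.le
  have hpos : 0 < 1 - ν.candidateProb Q s := lt_of_lt_of_le (by positivity) hbelow
  -- The oversampled arm `l` is an exponentially less likely candidate.
  have habove : ν.candidateProb Q l ≤ (m + 1) * Real.exp (-(n * (ρ + g - ε))) := by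
    refine (Problem.candidateProb_le (s := s) hk0).trans ?_
    have hb1 : ν.beatProb Q s l ≤ Real.exp (-(n * (ρ + g - ε))) := by
      refine (hup.1 l hl).trans (Real.exp_le_exp.2 (neg_le_neg ?_))
      gcongr
    have hb2 := hup.2 (ρ + g) fun j => (h3 j).le
    linarith
  rw [hlaw l]
  refine (Problem.pullProb_le hk0 hβ hc (by linarith) hl).trans ?_
  have hratio : ν.candidateProb Q l / (1 - ν.candidateProb Q s) ≤
      (m + 1) * Real.exp (-(n * (ρ + g - ε))) / (Real.exp (-(n * (ρ + 2 * ε))) / 2) := by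
    gcongr
  have hexp : (m + 1) * Real.exp (-(n * (ρ + g - ε))) / (Real.exp (-(n * (ρ + 2 * ε))) / 2) =
      2 * (m + 1) * Real.exp (-(n * (5 * ε))) := by
    have : Real.exp (-(n * (ρ + g - ε))) =
        Real.exp (-(n * (5 * ε))) * Real.exp (-(n * (ρ + 2 * ε))) := by
      rw [← Real.exp_add]; congr 1; rw [hε]; ring
    rw [this]
    field_simp
  rw [hexp] at hratio
  have hlog : (8 * (m + 1) : ℝ) ≤ Real.exp (n * ε) := by
    rw [← Real.log_le_iff_le_exp (by positivity)]
    exact h4.le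
  calc 4 * (ν.candidateProb Q l / (1 - ν.candidateProb Q s)) ≤
      (8 * (m + 1)) * Real.exp (-(n * (5 * ε))) := by linarith
    _ ≤ Real.exp (n * ε) * Real.exp (-(n * (5 * ε))) := by gcongr
    _ = Real.exp (-(4 * ε * n)) := by rw [← Real.exp_add]; congr 1; ring
    _ ≤ Real.exp (-((q : ℝ) + 1)⁻¹ * n) := by
      refine Real.exp_le_exp.2 ?_
      have : ((q : ℝ) + 1)⁻¹ * n ≤ 4 * ε * n := by gcongr; linarith
      linarith

/-- All exponents are eventually almost as large as `Γ_β`. -/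
theorem eventually_le_exponent (h : TopTwoPath ν N M J p β) (hk : 2 ≤ k) (hs : ν.IsUniqueBest s)
    (hb : ν.NoBoundary) (hβ : β ∈ Ioo (0 : ℝ) 1) {ε : ℝ} (hε : 0 < ε) :
    ∀ᶠ n : ℕ in atTop,
      (∀ i, i ≠ s → ν.Gam s β - ε < ν.exponent s ν.mean ((N n s : ℝ) / n) ((N n i : ℝ) / n) i) ∧
      ∀ j, ν.Gam s β - ε < ν.conExponent s ν.mean ((N n s : ℝ) / n) j := by
  have hw := h.tendsto_weight_best hs hb hβ
  have hα := Problem.isOptimalRates_optRates hk hs hβ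
  set α := ν.optRates s β
  have hgam := Problem.gam_pos hk hs hb hβ
  refine Eventually.and ?_ ?_
  swap
  · rw [eventually_all]; intro j
    refine (hw.mul_const _).eventually_const_lt ?_
    have := Problem.gam_le_conExponent (β := β) hs j
    unfold Problem.conExponent at this
    linarith
  -- The second entry keeps the level positive, hence also the proportions `a i` that attain it.
  set ρ := max (ν.Gam s β - ε / 2) (ν.Gam s β / 2) with hρ
  have hρ0 : 0 < ρ := lt_of_lt_of_le (by linarith) (le_max_right _ _)
  have hρ1 : ρ < ν.Gam s β := max_lt (by linarith) (by linarith)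
  have hex : ∀ i, ∃ c, i ≠ s → 0 < c ∧ c < α i ∧ ν.exponent s ν.mean β c i = ρ := by
    intro i
    by_cases hi : i = s
    · exact ⟨0, fun h => absurd hi h⟩
    have hle := Problem.gam_le_exponent hk hs hβ hi
    obtain ⟨c, h1, h2, h3⟩ := Problem.exists_exponent_eq (ν := ν) (s := s) ν.mean
      (hα.2.1 i hi).le hβ.1.le hρ0.le (hρ1.le.trans hle)
    refine ⟨c, fun _ => ⟨h1.lt_of_ne fun h0 => ?_, h2.lt_of_ne fun h0 => ?_, h3⟩⟩
    · rw [← h0, Problem.exponent_zero_right] at h3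
      linarith
    · rw [h0] at h3
      linarith
  choose a ha using hex
  have hsum : ∑ i ∈ Finset.univ.erase s, a i < 1 - β := by
    rw [← hα.2.2.1]
    exact Finset.sum_lt_sum_of_nonempty (Problem.erase_nonempty hk s)
      fun i hi => (ha i (Finset.ne_of_mem_erase hi)).2.1
  have ha1 : ∀ i, i ≠ s → a i ≤ 1 := by
    intro i hi
    have h1 := Finset.single_le_sum (f := a) (s := Finset.univ.erase s)
      (fun i hi => (ha i (Finset.ne_of_mem_erase hi)).1.le)
      (Finset.mem_erase.2 ⟨hi, Finset.mem_univ i⟩)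
    linarith [hβ.1]
  have hcont : ∀ᶠ δ in 𝓝[>] (0 : ℝ), ∀ i, i ≠ s → δ ≤ β ∧ δ ≤ a i ∧
      ρ - ε / 2 < ν.exponent s ν.mean (β - δ) (a i - δ) i := by
    rw [eventually_all]; intro i
    by_cases hi : i = s
    · exact Eventually.of_forall fun δ h => absurd hi h
    obtain ⟨hai, -, hae⟩ := ha i hi
    have hid : Tendsto (fun δ : ℝ => δ) (𝓝[>] 0) (𝓝 0) := tendsto_id.mono_left nhdsWithin_le_nhds
    have hδ1 := hid.eventually_le_const hβ.1
    have hδ2 := hid.eventually_le_const hai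
    have h1 := Problem.continuousOn_exponent (ν := ν) (s := s) ν.mean i (β, a i)
      ⟨hβ.1.le, hai.le⟩
    have h2 : Tendsto (fun δ : ℝ => (β - δ, a i - δ)) (𝓝[>] 0)
        (𝓝[Ici 0 ×ˢ Ici 0] (β, a i)) := by
      refine tendsto_nhdsWithin_iff.2 ⟨?_, ?_⟩
      · have : Continuous fun δ : ℝ => (β - δ, a i - δ) := by fun_prop
        simpa using (this.tendsto 0).mono_left nhdsWithin_le_nhds
      · filter_upwards [hδ1, hδ2] with δ h1 h2
        exact ⟨sub_nonneg.2 h1, sub_nonneg.2 h2⟩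
    filter_upwards [hδ1, hδ2, (h1.tendsto.comp h2).eventually_const_lt
      (show ρ - ε / 2 < ν.exponent s ν.mean β (a i) i by rw [hae]; linarith)]
      with δ h1 h2 h3 _ using ⟨h1, h2, h3⟩
  obtain ⟨δ, hδ, hδ0⟩ := (hcont.and self_mem_nhdsWithin).exists
  replace hδ0 : 0 < δ := hδ0
  -- Since `ρ < Γ_β`, each `a i` is strictly below its optimal rate, and this is the slack required
  -- by the counting argument.
  have hcount := eventually_le_count h.step h.sum_eq h.mono hw (fun i hi => (ha i hi).1.le) ha1 hsum
    (fun ζ hζ => h.eventually_pull_ne hk hs hb hβ hρ1 (fun i hi => (ha i hi).1.le)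
      (fun i hi => (ha i hi).2.2) hζ) hδ0
  filter_upwards [hcount, hw.eventually_const_lt (show β - δ < β by linarith),
    eventually_gt_atTop 0] with n hn hwn hn0 i hi
  have hn0' : (0 : ℝ) < n := by exact_mod_cast hn0
  obtain ⟨h1, h2, h3⟩ := hδ i hi
  have h4 : a i - δ ≤ (N n i : ℝ) / n := (le_div_iff₀ hn0').2 (hn i hi)
  have h5 := Problem.exponent_mono (ν := ν) (s := s) ν.mean (sub_nonneg.2 h2) h4
    (sub_nonneg.2 h1) hwn.le i
  have h6 : ν.Gam s β - ε / 2 ≤ ρ := le_max_left _ _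
  linarith

/-- Top-two Thompson sampling attains the rate `Γ_β`. -/
theorem tendsto_pathRate (h : TopTwoPath ν N M J p β) (hk : 2 ≤ k) (hs : ν.IsUniqueBest s)
    (hb : ν.NoBoundary) (hβ : β ∈ Ioo (0 : ℝ) 1) :
    Tendsto (pathRate ν N M s) atTop (𝓝 (ν.Gam s β)) := by
  have hN := h.tendsto_count hβ
  have hw := h.tendsto_weight_best hs hb hβ
  refine tendsto_order.2 ⟨fun c hc => ?_, fun c hc => ?_⟩
  swap
  · filter_upwards [h.eventually_pathRate_le_gam hk hs hβ hw
      (show 0 < (c - ν.Gam s β) / 2 by linarith)] with n hn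
    linarith
  set ε := (ν.Gam s β - c) / 3 with hε
  have hε0 : 0 < ε := by linarith
  have hlog : ∀ᶠ n : ℕ in atTop, Real.log (k + m) < n * ε :=
    (tendsto_natCast_atTop_atTop.atTop_mul_const hε0).eventually_gt_atTop _
  obtain ⟨i₀, hi₀⟩ := Problem.erase_nonempty hk s
  have hkm : (0 : ℝ) < k + m := by
    have : (0 : ℝ) < k := by exact_mod_cast (by omega : 0 < k)
    positivity
  filter_upwards [hlog, h.eventually_le_exponent hk hs hb hβ hε0, h.eventually_exp_le s hε0,
    h.eventually_le_exp hN s hε0, eventually_gt_atTop 0] with n hlog hexp hlow hup hn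
  have hn0 : (0 : ℝ) < n := by exact_mod_cast hn
  set Q := ν.gaussPost (M n) (N n)
  -- Positivity excludes the default value of the logarithm at zero.
  have hpos : 0 < 1 - ν.bestProb Q s :=
    (Real.exp_pos _).trans_le (hlow.1 i₀ (Finset.ne_of_mem_erase hi₀))
  have hle : 1 - ν.bestProb Q s ≤ (k + m) * Real.exp (-(n * (ν.Gam s β - 2 * ε))) := by
    have hb1 : ∑ i ∈ Finset.univ.erase s, ν.beatProb Q s i ≤
        ∑ _i : Fin k, Real.exp (-(n * (ν.Gam s β - 2 * ε))) := by
      refine (Finset.sum_le_sum fun i hi => ?_).trans (Finset.sum_le_sum_of_subset_of_nonneg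
        (Finset.subset_univ _) fun i _ _ => (Real.exp_pos _).le)
      have hi' := Finset.ne_of_mem_erase hi
      refine (hup.1 i hi').trans (Real.exp_le_exp.2 (neg_le_neg ?_))
      exact mul_le_mul_of_nonneg_left (by linarith [hexp.1 i hi']) hn0.le
    have hb2 := hup.2 (ν.Gam s β - ε) fun j => (hexp.2 j).le
    rw [show ν.Gam s β - ε - ε = ν.Gam s β - 2 * ε by ring] at hb2
    simp only [Finset.sum_const, Finset.card_univ, Fintype.card_fin, nsmul_eq_mul] at hb1
    refine (Problem.one_sub_bestProb_le).trans ?_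
    linarith
  have h1 := Real.log_le_log hpos hle
  rw [Real.log_mul hkm.ne' (Real.exp_pos _).ne', Real.log_exp] at h1
  have h2 : Real.log (1 - ν.bestProb Q s) < -(n * c) := by
    have : (n : ℝ) * c = n * (ν.Gam s β - 2 * ε) - n * ε := by rw [hε]; ring
    linarith
  unfold pathRate
  rw [neg_mul, one_div, lt_neg, ← div_eq_inv_mul, div_lt_iff₀ hn0]
  linarith

end TopTwoPath

/-! ### From sample paths to algorithms -/

namespace IsAlgorithmRun

variable {k m : ℕ} {Ω : Type*} [m0 : MeasurableSpace Ω] {ν : Problem k m} {P : Measure Ω}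
  [IsProbabilityMeasure P] {X : ℕ → Ω → Fin k → Fin (m + 1) → ℝ} {I : ℕ → Ω → Fin k}

/-- Only the convergence of the finitely many sample means is random; the remaining properties hold
on every path once each arm has been sampled. -/
theorem ae_samplePath (hrun : IsAlgorithmRun ν P X I) :
    ∀ᵐ ω ∂P, (∀ i, ∃ t, 0 < count I t i ω) →
      SamplePath ν (fun n i => count I n i ω) (fun n i j => postMean X I n i j ω) := by
  have h : ∀ᵐ ω ∂P, ∀ i j, Tendsto (fun n => count I n i ω) atTop atTop →
      Tendsto (fun n => postMean X I n i j ω) atTop (𝓝 (ν.mean i j)) :=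
    ae_all_iff.2 fun i => ae_all_iff.2 fun j => hrun.ae_tendsto_postMean i j
  filter_upwards [h] with ω h hpos
  refine ⟨fun n => sum_count n ω, fun i => count_mono i ω, ?_, fun i hi j => h i j hi,
    fun i n hn j => postMean_succ_of_count_eq hn j⟩
  rw [eventually_all]
  intro i
  obtain ⟨t, ht⟩ := hpos i
  filter_upwards [eventually_ge_atTop t] with n hn using ht.trans_le (count_mono i ω hn)

theorem ae_topTwoPath (hrun : IsAlgorithmRun ν P X I) {n₀ : ℕ} (hn₀ : 1 ≤ n₀) {β : ℝ}
    (hts : IsBFAITS ν P X I n₀ β) :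
    ∀ᵐ ω ∂P, TopTwoPath ν (fun n i => count I n i ω) (fun n i j => postMean X I n i j ω)
      (fun t => I t ω) (fun t i => hrun.condPull t i ω) β := by
  have h1 : ∀ᵐ ω ∂P, ∀ t i, hrun.condPull t i ω ∈ Icc (0 : ℝ) 1 :=
    ae_all_iff.2 fun t => ae_all_iff.2 fun i => hrun.ae_condPull_mem t i
  have h2 := ae_all_iff.2 fun i => hrun.ae_tendsto_count_sub i
  have h3 := ae_all_iff.2 fun i => hrun.ae_eventually_pull_ne i
  have h4 : ∀ᵐ ω ∂P, ∀ t, k * n₀ < t → ∀ i,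
      hrun.condPull t i ω = ν.pullProb β (posterior ν X I t ω) i :=
    ae_all_iff.2 fun t => by
      by_cases ht : k * n₀ < t
      · filter_upwards [ae_all_iff.2 fun i => hts.pull_law t ht i] with ω hω _ using hω
      · exact ae_of_all _ fun ω h => absurd h ht
  filter_upwards [hrun.ae_samplePath, h1, h2, h3, h4, hts.init] with ω h h1 h2 h3 h4 h5
  -- Counts refer to rounds before the index, so the initial phase is complete at index `k * n₀ +
  -- 1`.
  refine ⟨h fun i => ⟨k * n₀ + 1, by rw [h5 i]; exact hn₀⟩, fun t ht i => count_succ ht i ω,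
    fun t i => (h1 t i).1, h2, h3, ?_⟩
  filter_upwards [eventually_gt_atTop (k * n₀)] with t ht using h4 t ht

theorem ae_tendsto_empRate (hrun : IsAlgorithmRun ν P X I) (hk : 2 ≤ k) {s : Fin k}
    (hs : ν.IsUniqueBest s) (hb : ν.NoBoundary) {β : ℝ} (hβ : β ∈ Ioo (0 : ℝ) 1) {n₀ : ℕ}
    (hn₀ : 1 ≤ n₀) (hts : IsBFAITS ν P X I n₀ β) :
    ∀ᵐ ω ∂P, Tendsto (fun n => empRate ν X I s n ω) atTop (𝓝 (ν.Gam s β)) := by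
  filter_upwards [hrun.ae_topTwoPath hn₀ hts] with ω h
  -- Along the path of `ω`, `posterior` and `empRate` unfold to `gaussPost` and `pathRate`.
  exact h.tendsto_pathRate hk hs hb hβ

end IsAlgorithmRun

/-- Taking the limit superior in `EReal` makes the bound meaningful without any lower bound on the
sequence. -/
lemma limsup_coe_le_of_forall_pos {u : ℕ → ℝ} {c : ℝ}
    (h : ∀ ε > 0, ∀ᶠ n in atTop, u n ≤ c + ε) :
    limsup (fun n => (u n : EReal)) atTop ≤ (c : EReal) := by
  refine EReal.le_of_forall_lt_iff_le.1 fun z hz => ?_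
  have hz' : c < z := EReal.coe_lt_coe_iff.1 hz
  refine limsup_le_of_le (by isBoundedDefault) ?_
  filter_upwards [h (z - c) (by linarith)] with n hn
  exact EReal.coe_le_coe_iff.2 (by linarith)

end

end BFAI

theorem theorem2 {k m : ℕ} (hk : 2 ≤ k) (ν : BFAI.Problem k m) (s : Fin k)
    (hs : ν.IsUniqueBest s) (hb : ν.NoBoundary)
    {Ω : Type*} [MeasurableSpace Ω] (P : Measure Ω) [IsProbabilityMeasure P]
    (X : ℕ → Ω → Fin k → Fin (m + 1) → ℝ) (I : ℕ → Ω → Fin k)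
    (hrun : BFAI.IsAlgorithmRun ν P X I) :
    -- the optimal sampling rates and the optimal proportion are well defined
    (∀ β ∈ Ioo (0 : ℝ) 1, ∃! α : Fin k → ℝ, ν.IsOptimalRates s β α) ∧
    (∃ b, ν.IsOptimalBeta s b) ∧
    -- algorithms that give the proportion `β` of the samples to the best feasible arm
    (∀ᵐ ω ∂P, (∀ i, ∃ t, 0 < BFAI.count I t i ω) →
      ∀ β ∈ Ioo (0 : ℝ) 1,
        Tendsto (fun n : ℕ => (BFAI.count I n s ω : ℝ) / (n : ℝ)) atTop (𝓝 β) →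
        limsup (fun n : ℕ => ((BFAI.empRate ν X I s n ω : ℝ) : EReal)) atTop
          ≤ ((ν.Gam s β : ℝ) : EReal)) ∧
    (∀ β ∈ Ioo (0 : ℝ) 1, ∀ n₀ : ℕ, 1 ≤ n₀ → BFAI.IsBFAITS ν P X I n₀ β →
      ∀ᵐ ω ∂P, Tendsto (fun n : ℕ => BFAI.empRate ν X I s n ω) atTop (𝓝 (ν.Gam s β))) ∧
    -- all algorithms
    (∀ b, ν.IsOptimalBeta s b →
      (∀ᵐ ω ∂P, (∀ i, ∃ t, 0 < BFAI.count I t i ω) →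
        limsup (fun n : ℕ => ((BFAI.empRate ν X I s n ω : ℝ) : EReal)) atTop
          ≤ ((ν.Gam s b : ℝ) : EReal)) ∧
      (∀ n₀ : ℕ, 1 ≤ n₀ → BFAI.IsBFAITS ν P X I n₀ b →
        ∀ᵐ ω ∂P, Tendsto (fun n : ℕ => BFAI.empRate ν X I s n ω) atTop (𝓝 (ν.Gam s b)))) := by
  refine ⟨fun β hβ => ?_, BFAI.Problem.exists_isOptimalBeta hk hs hb, ?_,
    fun β hβ n₀ hn₀ hts => hrun.ae_tendsto_empRate hk hs hb hβ hn₀ hts,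
    fun b hopt => ⟨?_, fun n₀ hn₀ hts => hrun.ae_tendsto_empRate hk hs hb hopt.1 hn₀ hts⟩⟩
  · obtain ⟨α, hα⟩ := BFAI.Problem.exists_isOptimalRates hk hs hβ
    exact ⟨α, hα, fun α' hα' => BFAI.Problem.IsOptimalRates.unique hk hs hβ hα' hα⟩
  -- The null set does not depend on `β`, because the bound holds on each sample path for every
  -- limit of the proportion.
  · filter_upwards [hrun.ae_samplePath] with ω h hpos β hβ hw
    exact BFAI.limsup_coe_le_of_forall_pos fun ε hε =>
      (h hpos).eventually_pathRate_le_gam hk hs hβ hw hε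
  · filter_upwards [hrun.ae_samplePath] with ω h hpos
    exact BFAI.limsup_coe_le_of_forall_pos fun ε hε =>
      (h hpos).eventually_pathRate_le_optimal hk hs hb hopt hε
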